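/- **Setting.** Let $Z=(f=0)$ be the germ at the origin $O\in\mathbb C^2$ of an irreducible plane curve, with $f\in\mathbb C\{x,y\}$ irreducible, and assume that $Z$ is singular and not tangent to the $y$-axis. Write a Puiseux series $S$ with $f(x,S(x))=0$ (a $y$-root of $f$) as $S=\sum_{j>0}c_jx^{j/n}$, where $n=\nu(S)$ (the polydromy order) is coprime to $\gcd\{j: c_j\ne 0\}$. The characteristic sequence $(n;m_1,\dots,m_g)$, $g\ge 1$, of $Z$ is defined by $d_0=n$, $m_i=\min\{j: c_j\neq 0,\ d_{i-1}\nmid j\}$, $d_i=\gcd(n,m_1,\dots,m_i)$, $d_{g}=1$; it does not depend on the choice of $S$. Put $m_0=0$. For $1\le i\le g$ let $h_{i,0},h_{i,1},\dots,h_{i,k_i}$ be the successive quotients of the Euclidean algorithm for the pair $(m_i-m_{i-1},\,d_{i-1})$ (so $m_i-m_{i-1}=h_{i,0}d_{i-1}+r_{i,1}$, $d_{i-1}=h_{i,1}r_{i,1}+r_{i,2}$, and so on down to remainder $0$), and put $\gamma_0=0$, $\gamma_i=\gamma_{i-1}+\sum_{j=0}^{k_i}h_{i,j}$. Let $\pi:Y=Y_k\to\cdots\to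 Y_0=\mathbb C^2$ be the standard resolution of $Z$, i.e. the composition of the smallest number of point blow-ups over $O$ such that $\pi^*Z$ has normal crossing support. Let $q_1,\dots,q_k$ be its centers, $E_1,\dots,E_k$ the corresponding exceptional divisors (and their strict transforms), and $M_i$ the multiplicity at $q_i$ of the strict transform of $Z$. For $G\in\mathbb C\{x,y\}$, $G\neq 0$, let $\mathrm{ord}(G)\in\mathbb Z^k$ be the vector of the multiplicities at $q_1,\dots,q_k$ of the strict transforms of the curve $G=0$. Let $P=(p_{i,j})$ be the proximity matrix: $p_{i,i}=1$, $p_{i,j}=-1$ if $q_i$ is proximate to $q_j$ (that is, $q_i$ lies, as an ordinary or infinitely near point, on the exceptional divisor of the blow-up of $q_j$), and $p_{i,j}=0$ otherwise. Let $X_i$ be the $i$-th row of $P^{-1}$. Write $$K_{Y/\mathbb C^2}=\sum_{i=1}^k a^{(i)}E_i,\qquad \pi^*Z=\tilde Z+\sum_{i=1}^k b^{(i)}E_i .$$ *Standard factors.* Let $S$ be a $y$-root of $f$ that is modified, i.e. its order in $x$ is not an integer. A set of standard factors of $S$ is a family of polynomials $F_1,\dots,F_{g-1}\in\mathbb C[x,y]$,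 each of them irreducible in $\mathbb C\{x,y\}$, which arises as follows. There are polynomials $H_{i,j}\in\mathbb C[x,y]$ such that, with $F_0=y$, $$F_{i,j}=F_{i-1}^{\,d_{i-1}/d_i}+H_{i,0}+\cdots+H_{i,j},\qquad F_i=F_{i,h_{i+1,0}}\quad(1\le i\le g-1),$$ the following hold for all $(i,j)$ with $1\le i\le g-1$, $0\le j\le h_{i+1,0}$, and for $(i,j)=(g,0)$: - $F_{i,j}$ has a $y$-root of polydromy order $n/d_i$ whose terms of exponent $\le (m_i+jd_i)/n$ are the same as those of $S$; - $H_{i,j}$ is a linear combination of monomials $x^\alpha y^\beta F_1^{\delta_1}\cdots F_{i-1}^{\delta_{i-1}}$ with $\mathrm{ord}(x^\alpha y^\beta F_1^{\delta_1}\cdots F_{i-1}^{\delta_{i-1}})\cdot X_{\gamma_l}\ge X_{\gamma_i+j}\cdot X_{\gamma_l}$ for all $1\le l\le g$. **Lemma.** For all $1\le i\le g$ one has $1\le\gamma_i\le k$ and $$a^{(\gamma_i)}+1=\frac{m_i+n}{d_i},\qquad b^{(\gamma_i)}=\frac{M_1^2+\cdots+M_{\gamma_i}^2}{d_i}.$$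 Moreover, for every modified $y$-root $S$ of $f$, every set of standard factors $F_1,\dots,F_{g-1}$ of $S$, and all $1\le i\le g$, $1\le j\le g-1$, $$\mathrm{ord}(F_j)\cdot X_{\gamma_i}=\begin{cases}\dfrac{b^{(\gamma_i)}}{d_j}=\dfrac{M_1^2+\cdots+M_{\gamma_i}^2}{d_id_j}, & i\le j,\\[2ex] \dfrac{b^{(\gamma_j)}}{d_i}+\dfrac{m_{j+1}-m_j}{d_i}=\dfrac{M_1^2+\cdots+M_{\gamma_{j+1}}^2}{d_id_j}, & i>j.\end{cases}$$ -/

import Mathlib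

noncomputable section

namespace PlaneCurve

/-! ### Convergent power series in two variables -/

/-- Formal power series in `x = X 0` and `y = X 1` over `ℂ`. -/
abbrev Series : Type := MvPowerSeries (Fin 2) ℂ

/-- `∑ c_α x^α` converges (absolutely) on some polydisc of positive radius. -/
def IsConvergent (G : Series) : Prop :=
  ∃ r : ℝ, 0 < r ∧
    Summable fun α : Fin 2 →₀ ℕ => ‖MvPowerSeries.coeff α G‖ * r ^ α.degree

theorem summable_of_le {G : Series} {r s : ℝ} (hs : 0 ≤ s) (hsr : s ≤ r)
    (h : Summable fun α : Fin 2 →₀ ℕ => ‖MvPowerSeries.coeff α G‖ * r ^ α.degree) :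
    Summable fun α : Fin 2 →₀ ℕ => ‖MvPowerSeries.coeff α G‖ * s ^ α.degree := by
  refine Summable.of_nonneg_of_le (fun α => by positivity) (fun α => ?_) h
  gcongr

theorem isConvergent_coe (p : MvPolynomial (Fin 2) ℂ) : IsConvergent (p : Series) := by
  refine ⟨1, one_pos, summable_of_hasFiniteSupport (p.support.finite_toSet.subset ?_)⟩
  intro α hα
  simp only [Function.mem_support, MvPolynomial.coeff_coe] at hα
  simp only [Finset.mem_coe, MvPolynomial.mem_support_iff]
  intro h
  simp [h] at hα

theorem IsConvergent.add {G K : Series} (hG : IsConvergent G) (hK : IsConvergent K) :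
    IsConvergent (G + K) := by
  obtain ⟨r, hr, hG⟩ := hG
  obtain ⟨s, hs, hK⟩ := hK
  have h0 : 0 < min r s := lt_min hr hs
  refine ⟨min r s, h0, Summable.of_nonneg_of_le (fun α => by positivity) (fun α => ?_)
    ((summable_of_le h0.le (min_le_left r s) hG).add
      (summable_of_le h0.le (min_le_right r s) hK))⟩
  rw [← add_mul, map_add]
  gcongr
  exact norm_add_le _ _

theorem IsConvergent.mul {G K : Series} (hG : IsConvergent G) (hK : IsConvergent K) :
    IsConvergent (G * K) := by
  classical
  obtain ⟨r, hr, hG⟩ := hG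
  obtain ⟨s, hs, hK⟩ := hK
  obtain ⟨ρ, hρ, hr', hs'⟩ : ∃ ρ : ℝ, 0 < ρ ∧ ρ ≤ r ∧ ρ ≤ s :=
    ⟨min r s, lt_min hr hs, min_le_left r s, min_le_right r s⟩
  have hG' := summable_of_le hρ.le hr' hG
  have hK' := summable_of_le hρ.le hs' hK
  have hp := hG'.mul_of_nonneg hK' (fun α => mul_nonneg (norm_nonneg _) (pow_nonneg hρ.le _))
    (fun α => mul_nonneg (norm_nonneg _) (pow_nonneg hρ.le _))
  have hq := summable_sum_mul_antidiagonal_of_summable_mul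
    (f := fun α : Fin 2 →₀ ℕ => ‖MvPowerSeries.coeff α G‖ * ρ ^ α.degree)
    (g := fun α : Fin 2 →₀ ℕ => ‖MvPowerSeries.coeff α K‖ * ρ ^ α.degree) hp
  refine ⟨ρ, hρ, Summable.of_nonneg_of_le
    (fun α => mul_nonneg (norm_nonneg _) (pow_nonneg hρ.le _)) (fun α => ?_) hq⟩
  have key : ‖MvPowerSeries.coeff α (G * K)‖ ≤ ∑ p ∈ Finset.HasAntidiagonal.antidiagonal α,
      ‖MvPowerSeries.coeff p.1 G‖ * ‖MvPowerSeries.coeff p.2 K‖ := by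
    rw [MvPowerSeries.coeff_mul]
    refine (norm_sum_le _ _).trans (le_of_eq (Finset.sum_congr rfl fun p _ => norm_mul _ _))
  refine (mul_le_mul_of_nonneg_right key (pow_nonneg hρ.le _)).trans (le_of_eq ?_)
  rw [Finset.sum_mul]
  refine Finset.sum_congr rfl fun p hp => ?_
  have hd : α.degree = p.1.degree + p.2.degree := by
    rw [← Finset.HasAntidiagonal.mem_antidiagonal.mp hp, map_add]
  rw [hd, pow_add]
  ring

/-- The ring `ℂ{x,y}` of convergent power series. -/
def ConvergentSeries : Subring Series where
  carrier := {G | IsConvergent G}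
  mul_mem' := IsConvergent.mul
  add_mem' := IsConvergent.add
  one_mem' := by simpa using isConvergent_coe 1
  zero_mem' := by simpa using isConvergent_coe 0
  neg_mem' := by
    rintro G ⟨r, hr, h⟩
    exact ⟨r, hr, by simpa using h⟩

/-- A polynomial, as an element of `ℂ{x,y}`. -/
def polyGerm (p : MvPolynomial (Fin 2) ℂ) : ConvergentSeries :=
  ⟨(p : Series), isConvergent_coe p⟩

/-- Multiplicity at the point where `G` is expanded: the lowest degree of a monomial of `G`
(only used for `G ≠ 0`). -/
def mult (G : Series) : ℕ := (MvPowerSeries.order G).toNat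

/-- The initial form of `G` contains the monomial `y ^ mult G`, i.e. the `y`-axis `x = 0` is
not in the tangent cone of the germ `G = 0`. -/
def NotTangentToYAxis (G : Series) : Prop :=
  MvPowerSeries.coeff (Finsupp.single (1 : Fin 2) (mult G)) G ≠ 0

/-! ### Infinitely near points, blow-ups -/

/-- A point of the exceptional line `ℙ¹(ℂ)` of the blow-up of a point with local coordinates
`x, y`: the direction of the line `y = c x`, or of the line `x = 0`. -/
inductive Direction : Type
  | slope (c : ℂ)
  | vertical

/-- A point equal or infinitely near to the origin `O` of `ℂ²`: the empty list is `O`, and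
`p ++ [d]` is the point in the first neighbourhood of `p` in the direction `d`, with respect to
the local coordinates at `p` fixed by `Direction.chart`. -/
abbrev InfNear : Type := List Direction

/-- The blow-up map in the local coordinates around the point `d` of the exceptional line:
`(x, y) ↦ (x, x (y + c))` at `slope c`, and `(x, y) ↦ (x y, y)` at `vertical`. -/
def Direction.chart : Direction → Fin 2 → Series
  | .slope c => ![MvPowerSeries.X 0, MvPowerSeries.X 0 * (MvPowerSeries.X 1 + MvPowerSeries.C c)]
  | .vertical => ![MvPowerSeries.X 0 * MvPowerSeries.X 1, MvPowerSeries.X 1]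

/-- In the coordinates of `Direction.chart`, the exceptional line is `X d.exc = 0`. -/
def Direction.exc : Direction → Fin 2
  | .slope _ => 0
  | .vertical => 1

/-- Pull-back of `G` under one blow-up, expanded at the point `d`. -/
def pullback (d : Direction) (G : Series) : Series := MvPowerSeries.subst d.chart G

/-- Quotient of `G` by `X e ^ N` (used when `X e ^ N` divides `G`). -/
def divX (e : Fin 2) (N : ℕ) (G : Series) : Series :=
  fun α => MvPowerSeries.coeff (α + Finsupp.single e N) G

/-- Total transform (pull-back) of `G` at the infinitely near point `p`. -/
def total : InfNear → Series → Series
  | [], G => G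
  | d :: p, G => total p (pullback d G)

/-- Strict transform of the germ `G = 0` at the infinitely near point `p`: after each blow-up
the exceptional line is removed from the pull-back as many times as the multiplicity of the
blown up germ. -/
def strict : InfNear → Series → Series
  | [], G => G
  | d :: p, G => strict p (divX d.exc (mult G) (pullback d G))

/-- `p` is proximate to `q`: `p` lies, as an ordinary or infinitely near point, on the
exceptional line `E^q` of the blow-up of `q`. -/
def Proximate (p q : InfNear) : Prop :=
  ∃ (d : Direction) (t : InfNear), p = q ++ d :: t ∧
    MvPowerSeries.constantCoeff (strict t (MvPowerSeries.X d.exc)) = 0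

/-- The determinant of the Jacobian matrix of `(u, v)` with respect to the coordinates. -/
def jacobian (u v : Series) : Series :=
  MvPowerSeries.pderiv ℂ 0 u * MvPowerSeries.pderiv ℂ 1 v -
    MvPowerSeries.pderiv ℂ 1 u * MvPowerSeries.pderiv ℂ 0 v

/-- The divisor `G = 0` has normal crossing support at the point where `G` is expanded:
up to a unit, `G` is a monomial in a regular system of parameters `u, v`. -/
def HasNormalCrossing (G : Series) : Prop :=
  ∃ u v w : Series, ∃ a b : ℕ,
    MvPowerSeries.constantCoeff u = 0 ∧ MvPowerSeries.constantCoeff v = 0 ∧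
    MvPowerSeries.constantCoeff (jacobian u v) ≠ 0 ∧ IsUnit w ∧ G = w * u ^ a * v ^ b

/-- `q 0, …, q (k-1)` are the centers of a sequence of `k` blow-ups over `O`
(`Y = Y_k → ⋯ → Y_0 = ℂ²`): every center is a point over `O` of the surface produced so far,
that is, it has not been blown up yet, and it is `O` or lies on the exceptional line of
an earlier blow-up. -/
def IsBlowupSequence {k : ℕ} (q : Fin k → InfNear) : Prop :=
  Function.Injective q ∧
    ∀ i, q i = [] ∨ ∃ i' < i, ∃ d : Direction, q i = q i' ++ [d]

/-- The points over `O` of the surface obtained by blowing up the centers `q`. -/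
def IsPointOver {k : ℕ} (q : Fin k → InfNear) (p : InfNear) : Prop :=
  p ∉ Set.range q ∧ (p = [] ∨ ∃ (i : Fin k) (d : Direction), p = q i ++ [d])

/-- Blowing up `q` makes the total transform of `f = 0` a divisor with normal crossing support. -/
def IsResolution (f : Series) {k : ℕ} (q : Fin k → InfNear) : Prop :=
  IsBlowupSequence q ∧ ∀ p, IsPointOver q p → HasNormalCrossing (total p f)

/-- The standard resolution of `f = 0`: the one with the smallest number of blow-ups. -/
def IsStandardResolution (f : Series) {k : ℕ} (q : Fin k → InfNear) : Prop :=
  IsResolution f q ∧ ∀ (k' : ℕ) (q' : Fin k' → InfNear), IsResolution f q' → k ≤ k'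

/-- The point of the exceptional line of the blow-up of `p` at which orders along this line are
computed (any point of the line may be used); there the line is `X 0 = 0`. -/
def excPoint (p : InfNear) : InfNear := p ++ [Direction.slope 0]

/-- The coefficient of the exceptional divisor `E` of the blow-up of `p` in the pull-back of the
divisor `G = 0`: the order of vanishing along `E` of the pull-back of `G`. -/
def excOrder (p : InfNear) (G : Series) : ℕ :=
  multiplicity (MvPowerSeries.X 0 : Series) (total (excPoint p) G)

/-- The coefficient of the exceptional divisor `E` of the blow-up of `p` in the relative canonical
divisor `K_{Y/ℂ²}`: the order of vanishing along `E` of the Jacobian determinant of `Y → ℂ²`. -/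
def canonicalCoeff (p : InfNear) : ℕ :=
  multiplicity (MvPowerSeries.X 0 : Series)
    (jacobian (total (excPoint p) (MvPowerSeries.X 0)) (total (excPoint p) (MvPowerSeries.X 1)))

/-- The multiplicities of the strict transforms of `G = 0` at the centers `q`. For `G = f` this
is the multiplicity sequence of `f = 0`. -/
def ordVec {k : ℕ} (q : Fin k → InfNear) (G : Series) : Fin k → ℚ :=
  fun i => (mult (strict (q i) G) : ℚ)

open Classical in
/-- The proximity matrix of the points `q`. -/
def proximityMatrix {k : ℕ} (q : Fin k → InfNear) : Matrix (Fin k) (Fin k) ℚ :=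
  fun i j => if i = j then 1 else if Proximate (q i) (q j) then -1 else 0

/-- The `r`-th row of the inverse proximity matrix. -/
def invRow {k : ℕ} (q : Fin k → InfNear) (r : Fin k) : Fin k → ℚ := (proximityMatrix q)⁻¹ r

/-! ### Puiseux series -/

/-- A Puiseux series `∑_{i > 0} c_i x^{i/ν}` in reduced form: `ser = ∑ c_i t^i` with
`t = x^{1/ν}`, where the polydromy order `ν` is coprime to the gcd of the `i` with `c_i ≠ 0`. -/
structure PuiseuxSeries where
  ν : ℕ
  ser : PowerSeries ℂ
  ν_pos : 0 < ν
  constantCoeff_ser : PowerSeries.constantCoeff ser = 0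
  reduced : ∀ e : ℕ, e ∣ ν → (∀ i, PowerSeries.coeff i ser ≠ 0 → e ∣ i) → e = 1

namespace PuiseuxSeries

/-- `S` is a `y`-root of `G`: `G (x, S) = 0`, written with `x = t ^ ν`. -/
def IsRoot (S : PuiseuxSeries) (G : Series) : Prop :=
  MvPowerSeries.subst (![PowerSeries.X ^ S.ν, S.ser] : Fin 2 → PowerSeries ℂ) G
    = (0 : PowerSeries ℂ)

/-- The coefficient of `x ^ e` in `S`. -/
def coeffAt (S : PuiseuxSeries) (e : ℚ) : ℂ :=
  if (e * S.ν).den = 1 then PowerSeries.coeff (e * S.ν).num.toNat S.ser else 0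

/-- The partial sums `[S]_{≤ l}` and `[S']_{≤ l}` agree. -/
def AgreeUpTo (S S' : PuiseuxSeries) (l : ℚ) : Prop :=
  ∀ e : ℚ, e ≤ l → S.coeffAt e = S'.coeffAt e

/-- The order of `S` in `x` is not an integer. -/
def IsModified (S : PuiseuxSeries) : Prop := ¬ S.ν ∣ S.ser.order.toNat

end PuiseuxSeries

/-! ### Characteristic sequence -/

/-- `d_i = gcd (n, m_1, …, m_i)`. -/
def charGcd (n : ℕ) (m : ℕ → ℕ) : ℕ → ℕ
  | 0 => n
  | i + 1 => Nat.gcd (charGcd n m i) (m (i + 1))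

/-- `(ν; m_1, …, m_g)` is the characteristic sequence of `S` (with `g ≥ 1`, so `S` is not an
integral power series): `m_i` is the first exponent (over `ν`) occurring in `S` that is not
divisible by `d_{i-1}`, and `d_g = 1`. By convention `m 0 = 0`. -/
def PuiseuxSeries.IsCharSeq (S : PuiseuxSeries) (g : ℕ) (m : ℕ → ℕ) : Prop :=
  1 ≤ g ∧ m 0 = 0 ∧
    (∀ i, 1 ≤ i → i ≤ g →
      IsLeast {j | PowerSeries.coeff j S.ser ≠ 0 ∧ ¬ charGcd S.ν m (i - 1) ∣ j} (m i)) ∧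
    charGcd S.ν m g = 1

/-- `(n; m_1, …, m_g)` is the characteristic sequence of the germ `f = 0`. -/
def HasCharSeq (f : Series) (n g : ℕ) (m : ℕ → ℕ) : Prop :=
  ∃ S : PuiseuxSeries, S.IsRoot f ∧ S.ν = n ∧ S.IsCharSeq g m

/-- The successive quotients of the Euclidean algorithm `a = h_0 b + r_1`, `b = h_1 r_1 + r_2`, … -/
def euclidQuotients (a b : ℕ) : List ℕ :=
  if b = 0 then [] else a / b :: euclidQuotients b (a % b)
termination_by b
decreasing_by exact Nat.mod_lt _ (Nat.pos_of_ne_zero (by assumption))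

/-- The quotients `h_{i,0}, …, h_{i,k_i}` of the `i`-th Euclidean algorithm, which starts with
`m_i - m_{i-1}` (with `m_0 = 0`) and the last nonzero remainder `d_{i-1}` of the previous one
(`d_0 = n`). -/
def quotients (n : ℕ) (m : ℕ → ℕ) (i : ℕ) : List ℕ :=
  euclidQuotients (m i - m (i - 1)) (charGcd n m (i - 1))

/-- The first quotient `h_{i,0}`. -/
def firstQuotient (n : ℕ) (m : ℕ → ℕ) (i : ℕ) : ℕ := (m i - m (i - 1)) / charGcd n m (i - 1)

/-- `γ_0 = 0`, `γ_i = γ_{i-1} + ∑_j h_{i,j}`. -/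
def gam (n : ℕ) (m : ℕ → ℕ) : ℕ → ℕ
  | 0 => 0
  | i + 1 => gam n m i + (quotients n m (i + 1)).sum

/-! ### Standard factors -/

/-- `F_0 = y` and `F_i = F_{i-1} ^ (d_{i-1} / d_i) + ∑_{0 ≤ t ≤ h_{i+1,0}} H_{i,t}`. -/
def stdFactor (n : ℕ) (m : ℕ → ℕ) (H : ℕ → ℕ → MvPolynomial (Fin 2) ℂ) :
    ℕ → MvPolynomial (Fin 2) ℂ
  | 0 => MvPolynomial.X 1
  | i + 1 => stdFactor n m H i ^ (charGcd n m i / charGcd n m (i + 1)) +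
      ∑ t ∈ Finset.range (firstQuotient n m (i + 2) + 1), H (i + 1) t

/-- `F_{i,j} = F_{i-1} ^ (d_{i-1} / d_i) + H_{i,0} + ⋯ + H_{i,j}`. -/
def partialFactor (n : ℕ) (m : ℕ → ℕ) (H : ℕ → ℕ → MvPolynomial (Fin 2) ℂ) (i j : ℕ) :
    MvPolynomial (Fin 2) ℂ :=
  stdFactor n m H (i - 1) ^ (charGcd n m (i - 1) / charGcd n m i) +
    ∑ t ∈ Finset.range (j + 1), H i t

/-- The monomial `x^α y^β F_1^{δ_1} ⋯ F_{i-1}^{δ_{i-1}}`. -/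
def factorMonomial (F : ℕ → MvPolynomial (Fin 2) ℂ) (i α β : ℕ) (δ : ℕ → ℕ) :
    MvPolynomial (Fin 2) ℂ :=
  MvPolynomial.X 0 ^ α * MvPolynomial.X 1 ^ β * ∏ t ∈ Finset.Icc 1 (i - 1), F t ^ δ t

/-- `H_{i,j}` is a linear combination of those monomials `x^α y^β F_1^{δ_1} ⋯ F_{i-1}^{δ_{i-1}}`
for which `ord (·) · X_{γ_l} ≥ X_{γ_i + j} · X_{γ_l}` for all `1 ≤ l ≤ g`. The centers are indexed
from `0`, so that `X_γ` is the row of index `γ - 1`. -/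
def IsAdmissibleTerm {k : ℕ} (q : Fin k → InfNear) (n g : ℕ) (m : ℕ → ℕ)
    (H : ℕ → ℕ → MvPolynomial (Fin 2) ℂ) (i j : ℕ) : Prop :=
  H i j ∈ Submodule.span ℂ
    {P : MvPolynomial (Fin 2) ℂ | ∃ (α β : ℕ) (δ : ℕ → ℕ),
      P = factorMonomial (stdFactor n m H) i α β δ ∧
      ∀ l, 1 ≤ l → l ≤ g → ∀ r s : Fin k,
        (r : ℕ) + 1 = gam n m l → (s : ℕ) + 1 = gam n m i + j →
          invRow q s ⬝ᵥ invRow q r ≤ ordVec q (P : Series) ⬝ᵥ invRow q r}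

/-- `F_1, …, F_{g-1}` is a set of standard factors of the modified Puiseux series `S` with
characteristic sequence `(n; m_1, …, m_g)`, where `n = ν(S)`; `q` are the centers of the standard
resolution of the germ that has `S` as a `y`-root. The standard factors are irreducible germs. -/
def IsStandardFactors {k : ℕ} (q : Fin k → InfNear) (S : PuiseuxSeries) (g : ℕ) (m : ℕ → ℕ)
    (F : ℕ → MvPolynomial (Fin 2) ℂ) : Prop :=
  S.IsModified ∧ S.IsCharSeq g m ∧
    ∃ H : ℕ → ℕ → MvPolynomial (Fin 2) ℂ,
      (∀ i j : ℕ,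
        (1 ≤ i ∧ i + 1 ≤ g ∧ j ≤ firstQuotient S.ν m (i + 1)) ∨ (i = g ∧ j = 0) →
          (∃ S' : PuiseuxSeries, S'.IsRoot (partialFactor S.ν m H i j : Series) ∧
            S'.ν = S.ν / charGcd S.ν m i ∧
            S'.AgreeUpTo S (((m i : ℚ) + j * charGcd S.ν m i) / S.ν)) ∧
          IsAdmissibleTerm q S.ν g m H i j) ∧
      ∀ i : ℕ, 1 ≤ i → i + 1 ≤ g →
        F i = partialFactor S.ν m H i (firstQuotient S.ν m (i + 1)) ∧ Irreducible (polyGerm (F i))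

/-- `M_1² + ⋯ + M_N²`, where `(M_1, …, M_k)` is the multiplicity sequence of `f = 0`. -/
def sumSqMult (f : Series) {k : ℕ} (q : Fin k → InfNear) (N : ℕ) : ℚ :=
  ∑ s ∈ Finset.univ.filter (fun s : Fin k => (s : ℕ) < N), ordVec q f s ^ 2

end PlaneCurve

end

/-! Parametrize the branch by a root, x = t^n, y = S(t), and lift it through its infinitely near
points (`Chain`). All quantities become orders of power series in t: the multiplicity at a point is
the order of the coordinate cutting out the next exceptional line, that is, the smaller of the
orders of x and y. This requires f to generate the ideal of all formal series vanishing on the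
parametrization, and strict transforms to inherit this property; the latter is `step_slope`, proved
by Weierstrass division. The former holds for f irreducible in ℂ{x,y} because the root S converges
(`isConvergent_of_eval_graph`): the product of the factors y - S(ζ^i t) then descends to a
convergent divisor of f, and equals f up to a unit.

A blow-up subtracts the smaller of the two orders from the larger one, so the orders a, b run
through the subtractive Euclidean algorithm (`Chain.toric`). The multiplicities of one run add up to
a + b - gcd(a, b), and their squares to a b. After a run the branch passes through a free point,
where its new coordinates are no longer explicit. What can still be controlled is the contact with
the conjugates t ↦ ζ t: conjugation commutes with lifting, and each run lowers a contact by a known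
amount. The contact with the conjugate by a primitive d_i-th root of unity detects the first
exponent of y not divisible by d_i; at the point γ_i it is m_{i+1} - m_i, so the next run is the
algorithm for (m_{i+1} - m_i, d_i) (`Chain.close_conj`, `Chain.block`). Adding up, the
multiplicities before γ_i have sum m_i + n - d_i, and the squares of those between γ_i and γ_{i+1}
have sum (m_{i+1} - m_i) d_i.

Multiplicities w_t prescribed at the points determine orders along the exceptional divisors by a
linear recursion (`Chain.excOrd`) whose matrix form is multiplication by P⁻¹. The divisor E_{γ_i}
meets the strict transform of the branch in a free point, with intersection number d_i, whence d_i ·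
excOrd = ∑ w_t M_t over the first γ_i points (`Chain.excOrd_mul`). Every formula of the lemma is a
case of this: w = 1 for K, w = M for f, and w = ord(F_j) for the standard factors. The branch of F_j
has multiplicities M_t / d_j as long as it follows S, has multiplicity 1 at the point where S first
turns vertical after γ_j, and leaves S there (`Chain.truncatedMult`); the part beyond γ_j thus
contributes m_{j+1} - m_j.

Finally, the centers of the standard resolution are the initial points of the branch
(`Chain.eq_pt_of_isStandardResolution`), and at none of its first γ_g points does the total
transform have normal crossings, so γ_g ≤ k. -/

noncomputable section

namespace PlaneCurve

/-! ### Parametrized curves -/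

/-- A formal parametrized curve through the origin. -/
@[ext] structure Param where
  x : PowerSeries ℂ
  y : PowerSeries ℂ
  x_zero : PowerSeries.constantCoeff x = 0
  y_zero : PowerSeries.constantCoeff y = 0

theorem Param.hasSubst (φ : Param) :
    MvPowerSeries.HasSubst (![φ.x, φ.y] : Fin 2 → PowerSeries ℂ) := by
  refine MvPowerSeries.hasSubst_of_constantCoeff_zero ?_
  intro s
  fin_cases s
  · exact φ.x_zero
  · exact φ.y_zero

/-- Restriction of a series to a parametrized curve. -/
def Param.eval (φ : Param) : Series →ₐ[ℂ] PowerSeries ℂ :=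
  MvPowerSeries.substAlgHom φ.hasSubst

theorem Param.eval_apply (φ : Param) (G : Series) :
    φ.eval G = MvPowerSeries.subst (![φ.x, φ.y] : Fin 2 → PowerSeries ℂ) G := by
  rw [Param.eval, MvPowerSeries.coe_substAlgHom]

@[simp] theorem Param.eval_X_zero (φ : Param) : φ.eval (MvPowerSeries.X 0) = φ.x := by
  rw [Param.eval, MvPowerSeries.substAlgHom_X]; rfl

@[simp] theorem Param.eval_X_one (φ : Param) : φ.eval (MvPowerSeries.X 1) = φ.y := by
  rw [Param.eval, MvPowerSeries.substAlgHom_X]; rfl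

@[simp] theorem Param.eval_C (φ : Param) (c : ℂ) :
    φ.eval (MvPowerSeries.C c) = PowerSeries.C c :=
  φ.eval.commutes c

theorem Direction.hasSubst (d : Direction) : MvPowerSeries.HasSubst d.chart := by
  refine MvPowerSeries.hasSubst_of_constantCoeff_zero ?_
  intro s
  cases d <;> fin_cases s <;> simp [Direction.chart]

/-- `pullback` as an algebra homomorphism. -/
def Direction.pull (d : Direction) : Series →ₐ[ℂ] Series :=
  MvPowerSeries.substAlgHom d.hasSubst

theorem pullback_eq (d : Direction) (G : Series) : pullback d G = d.pull G := by
  rw [Direction.pull, MvPowerSeries.coe_substAlgHom, pullback]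

theorem Direction.pull_X (d : Direction) (i : Fin 2) :
    d.pull (MvPowerSeries.X i) = d.chart i := by
  rw [Direction.pull, MvPowerSeries.substAlgHom_X]

@[simp] theorem Direction.pull_C (d : Direction) (c : ℂ) :
    d.pull (MvPowerSeries.C c) = MvPowerSeries.C c := d.pull.commutes c

/-- `φ'` is the lift of `φ` to the blow-up, through the point in direction `d`. -/
def IsLift : Direction → Param → Param → Prop
  | .slope c, φ, φ' => φ.x = φ'.x ∧ φ.y = φ'.x * (φ'.y + PowerSeries.C c)
  | .vertical, φ, φ' => φ.x = φ'.x * φ'.y ∧ φ.y = φ'.y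

theorem IsLift.eval_pull {d : Direction} {φ φ' : Param} (h : IsLift d φ φ') (G : Series) :
    φ'.eval (d.pull G) = φ.eval G := by
  rw [Param.eval_apply φ, Direction.pull, MvPowerSeries.coe_substAlgHom, Param.eval_apply φ',
    MvPowerSeries.subst_comp_subst_apply d.hasSubst φ'.hasSubst]
  congr 1
  funext s
  have key : ∀ s, φ'.eval (d.chart s) = ![φ.x, φ.y] s := by
    intro s
    cases d with
    | slope c =>
      obtain ⟨h1, h2⟩ := h
      fin_cases s <;> simp [Direction.chart, h1, h2]
    | vertical =>
      obtain ⟨h1, h2⟩ := h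
      fin_cases s <;> simp [Direction.chart, h1, h2]
  rw [← key s, Param.eval_apply]

/-! ### Coefficients -/

/-- The exponent of `x ^ a * y ^ b`. -/
def mon (a b : ℕ) : Fin 2 →₀ ℕ := Finsupp.single 0 a + Finsupp.single 1 b

@[simp] theorem mon_zero (a b : ℕ) : mon a b 0 = a := by simp [mon]
@[simp] theorem mon_one (a b : ℕ) : mon a b 1 = b := by simp [mon]
@[simp] theorem mon_degree (a b : ℕ) : (mon a b).degree = a + b := by
  simp [mon, Finsupp.degree_single]

theorem eq_mon (α : Fin 2 →₀ ℕ) : α = mon (α 0) (α 1) := by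
  ext i; fin_cases i <;> simp

theorem mon_inj {a b a' b' : ℕ} : mon a b = mon a' b' ↔ a = a' ∧ b = b' := by
  refine ⟨fun h => ⟨?_, ?_⟩, fun h => by rw [h.1, h.2]⟩
  · simpa using DFunLike.congr_fun h 0
  · simpa using DFunLike.congr_fun h 1

theorem series_ext {G H : Series}
    (h : ∀ a b, MvPowerSeries.coeff (mon a b) G = MvPowerSeries.coeff (mon a b) H) : G = H := by
  ext α; rw [eq_mon α]; exact h _ _

theorem coeff_X_zero_mul (G : Series) (a b : ℕ) :
    MvPowerSeries.coeff (mon (a + 1) b) (MvPowerSeries.X 0 * G) =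
      MvPowerSeries.coeff (mon a b) G := by
  have : mon (a + 1) b = Finsupp.single 0 1 + mon a b := by
    ext i; fin_cases i <;> simp [add_comm]
  rw [this, MvPowerSeries.X, MvPowerSeries.coeff_add_monomial_mul, one_mul]

theorem coeff_X_one_mul (G : Series) (a b : ℕ) :
    MvPowerSeries.coeff (mon a (b + 1)) (MvPowerSeries.X 1 * G) =
      MvPowerSeries.coeff (mon a b) G := by
  have : mon a (b + 1) = Finsupp.single 1 1 + mon a b := by
    ext i; fin_cases i <;> simp [add_comm]
  rw [this, MvPowerSeries.X, MvPowerSeries.coeff_add_monomial_mul, one_mul]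

theorem coeff_X_zero_mul_zero (G : Series) (b : ℕ) :
    MvPowerSeries.coeff (mon 0 b) (MvPowerSeries.X 0 * G) = 0 :=
  (MvPowerSeries.X_dvd_iff (φ := MvPowerSeries.X _ * G)).1 (dvd_mul_right _ _) _ (by simp)

theorem coeff_X_one_mul_zero (G : Series) (a : ℕ) :
    MvPowerSeries.coeff (mon a 0) (MvPowerSeries.X 1 * G) = 0 :=
  (MvPowerSeries.X_dvd_iff (φ := MvPowerSeries.X _ * G)).1 (dvd_mul_right _ _) _ (by simp)

theorem X_pow_mul_divX {e : Fin 2} {N : ℕ} {G : Series} (h : MvPowerSeries.X e ^ N ∣ G) :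
    MvPowerSeries.X e ^ N * divX e N G = G := by
  obtain ⟨K, rfl⟩ := h
  congr 1
  ext α
  change MvPowerSeries.coeff (α + Finsupp.single e N) (MvPowerSeries.X e ^ N * K : Series) =
    MvPowerSeries.coeff α K
  rw [add_comm, MvPowerSeries.X_pow_eq, MvPowerSeries.coeff_add_monomial_mul, one_mul]

theorem X_ne_zero (e : Fin 2) : (MvPowerSeries.X e : Series) ≠ 0 := by
  intro h
  have := congrArg (MvPowerSeries.coeff (Finsupp.single e 1)) h
  simp at this

theorem divX_X_pow_mul (e : Fin 2) (N : ℕ) (K : Series) :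
    divX e N (MvPowerSeries.X e ^ N * K) = K :=
  mul_left_cancel₀ (pow_ne_zero N (X_ne_zero e)) (X_pow_mul_divX (dvd_mul_right _ _))

theorem isUnit_iff_constantCoeff {G : Series} :
    IsUnit G ↔ MvPowerSeries.constantCoeff G ≠ 0 := by
  rw [MvPowerSeries.isUnit_iff_constantCoeff, isUnit_iff_ne_zero]

theorem coeff_mon_zero_zero (G : Series) :
    MvPowerSeries.coeff (mon 0 0) G = MvPowerSeries.constantCoeff G := by
  simp [mon]

theorem isUnit_powerSeries_iff {G : PowerSeries ℂ} :
    IsUnit G ↔ PowerSeries.constantCoeff G ≠ 0 := by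
  rw [PowerSeries.isUnit_iff_constantCoeff, isUnit_iff_ne_zero]

/-! ### Restriction to the axes -/

/-- The axis `x = 0`. -/
def yAxis : Param := ⟨0, PowerSeries.X, by simp, by simp⟩
/-- The axis `y = 0`. -/
def xAxis : Param := ⟨PowerSeries.X, 0, by simp, by simp⟩

theorem coeff_yAxis_eval (G : Series) (j : ℕ) :
    PowerSeries.coeff j (yAxis.eval G) = MvPowerSeries.coeff (mon 0 j) G := by
  rw [Param.eval_apply, PowerSeries.coeff, MvPowerSeries.coeff_subst yAxis.hasSubst,
    finsum_eq_single _ (mon 0 j)]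
  · have : (mon 0 j).prod (fun s e => (![yAxis.x, yAxis.y] s : MvPowerSeries Unit ℂ) ^ e) =
        (PowerSeries.X ^ j : PowerSeries ℂ) := by
      rw [Finsupp.prod_fintype _ _ (by simp), Fin.prod_univ_two]
      simp [yAxis]
    rw [this, ← PowerSeries.coeff, PowerSeries.coeff_X_pow]
    simp
  · intro d hd
    rw [eq_mon d] at hd ⊢
    have : (mon (d 0) (d 1)).prod
        (fun s e => (![yAxis.x, yAxis.y] s : MvPowerSeries Unit ℂ) ^ e) =
        ((0 : PowerSeries ℂ) ^ (d 0) * PowerSeries.X ^ (d 1) : PowerSeries ℂ) := by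
      rw [Finsupp.prod_fintype _ _ (by simp), Fin.prod_univ_two]
      simp [yAxis]
    rw [this, ← PowerSeries.coeff]
    by_cases h0 : d 0 = 0
    · rw [h0, pow_zero, one_mul, PowerSeries.coeff_X_pow, if_neg, smul_zero]
      rintro rfl
      exact hd (by rw [h0])
    · rw [zero_pow h0, zero_mul]; simp

theorem coeff_xAxis_eval (G : Series) (j : ℕ) :
    PowerSeries.coeff j (xAxis.eval G) = MvPowerSeries.coeff (mon j 0) G := by
  rw [Param.eval_apply, PowerSeries.coeff, MvPowerSeries.coeff_subst xAxis.hasSubst,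
    finsum_eq_single _ (mon j 0)]
  · have : (mon j 0).prod (fun s e => (![xAxis.x, xAxis.y] s : MvPowerSeries Unit ℂ) ^ e) =
        (PowerSeries.X ^ j : PowerSeries ℂ) := by
      rw [Finsupp.prod_fintype _ _ (by simp), Fin.prod_univ_two]
      simp [xAxis]
    rw [this, ← PowerSeries.coeff, PowerSeries.coeff_X_pow]
    simp
  · intro d hd
    rw [eq_mon d] at hd ⊢
    have : (mon (d 0) (d 1)).prod
        (fun s e => (![xAxis.x, xAxis.y] s : MvPowerSeries Unit ℂ) ^ e) =
        (PowerSeries.X ^ (d 0) * (0 : PowerSeries ℂ) ^ (d 1) : PowerSeries ℂ) := by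
      rw [Finsupp.prod_fintype _ _ (by simp), Fin.prod_univ_two]
      simp [xAxis]
    rw [this, ← PowerSeries.coeff]
    by_cases h0 : d 1 = 0
    · rw [h0, pow_zero, mul_one, PowerSeries.coeff_X_pow, if_neg, smul_zero]
      rintro rfl
      exact hd (by rw [h0])
    · rw [zero_pow h0, mul_zero]; simp

theorem constantCoeff_yAxis_eval (G : Series) :
    PowerSeries.constantCoeff (yAxis.eval G) = MvPowerSeries.constantCoeff G := by
  rw [← PowerSeries.coeff_zero_eq_constantCoeff_apply, coeff_yAxis_eval, coeff_mon_zero_zero]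

theorem constantCoeff_xAxis_eval (G : Series) :
    PowerSeries.constantCoeff (xAxis.eval G) = MvPowerSeries.constantCoeff G := by
  rw [← PowerSeries.coeff_zero_eq_constantCoeff_apply, coeff_xAxis_eval, coeff_mon_zero_zero]

theorem X_zero_dvd_iff {G : Series} : MvPowerSeries.X 0 ∣ G ↔ yAxis.eval G = 0 := by
  refine ⟨fun ⟨K, hK⟩ => by rw [hK, map_mul, Param.eval_X_zero]; exact zero_mul _, fun h => ?_⟩
  rw [MvPowerSeries.X_dvd_iff]
  intro m hm
  rw [eq_mon m, hm, ← coeff_yAxis_eval, h, map_zero]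

/-- The series of `y` alone. -/
def inY : PowerSeries ℂ →ₐ[ℂ] Series :=
  PowerSeries.substAlgHom (PowerSeries.HasSubst.X (1 : Fin 2))
/-- The series of `x` alone. -/
def inX : PowerSeries ℂ →ₐ[ℂ] Series :=
  PowerSeries.substAlgHom (PowerSeries.HasSubst.X (0 : Fin 2))

theorem coeff_inY (p : PowerSeries ℂ) (a b : ℕ) :
    MvPowerSeries.coeff (mon a b) (inY p) = if a = 0 then PowerSeries.coeff b p else 0 := by
  rw [inY, PowerSeries.coe_substAlgHom, PowerSeries.coeff_subst_single]
  have : (mon a b = Finsupp.single 1 b) ↔ a = 0 := by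
    constructor
    · intro h; simpa using DFunLike.congr_fun h 0
    · rintro rfl; simp [mon]
  simp [this]

theorem coeff_inX (p : PowerSeries ℂ) (a b : ℕ) :
    MvPowerSeries.coeff (mon a b) (inX p) = if b = 0 then PowerSeries.coeff a p else 0 := by
  rw [inX, PowerSeries.coe_substAlgHom, PowerSeries.coeff_subst_single]
  have : (mon a b = Finsupp.single 0 a) ↔ b = 0 := by
    constructor
    · intro h; simpa using DFunLike.congr_fun h 1
    · rintro rfl; simp [mon]
  simp [this]

theorem yAxis_eval_inY (p : PowerSeries ℂ) : yAxis.eval (inY p) = p := by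
  ext j; rw [coeff_yAxis_eval, coeff_inY, if_pos rfl]

theorem xAxis_eval_inX (p : PowerSeries ℂ) : xAxis.eval (inX p) = p := by
  ext j; rw [coeff_xAxis_eval, coeff_inX, if_pos rfl]

theorem yAxis_eval_inX (p : PowerSeries ℂ) :
    yAxis.eval (inX p) = PowerSeries.C (PowerSeries.constantCoeff p) := by
  ext j
  rw [coeff_yAxis_eval, coeff_inX, PowerSeries.coeff_C]
  simp

theorem inY_X : inY PowerSeries.X = MvPowerSeries.X 1 := by
  rw [inY, PowerSeries.substAlgHom_X]

theorem inX_X : inX PowerSeries.X = MvPowerSeries.X 0 := by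
  rw [inX, PowerSeries.substAlgHom_X]

theorem exists_eq_inY_add (G : Series) :
    ∃ K, G = inY (yAxis.eval G) + MvPowerSeries.X 0 * K := by
  have : MvPowerSeries.X 0 ∣ G - inY (yAxis.eval G) := by
    rw [X_zero_dvd_iff, map_sub, yAxis_eval_inY, sub_self]
  obtain ⟨K, hK⟩ := this
  exact ⟨K, by rw [← hK]; ring⟩

/-- Every series without constant term is in the ideal `(x, y)`. -/
theorem exists_eq_C_add (G : Series) :
    ∃ K L, G = MvPowerSeries.C (MvPowerSeries.constantCoeff G) + MvPowerSeries.X 0 * K +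
      MvPowerSeries.X 1 * L ∧ ∀ a b, MvPowerSeries.coeff (mon (a + 1) b) L = 0 := by
  obtain ⟨K, hK⟩ := exists_eq_inY_add G
  obtain ⟨p, hp⟩ : PowerSeries.X ∣ yAxis.eval G -
      PowerSeries.C (PowerSeries.constantCoeff (yAxis.eval G)) := by
    rw [PowerSeries.X_dvd_iff]; simp
  -- All monomials divisible by x go into K, so L is a series in y alone and each monomial of G
  -- comes from only one of the two terms.
  refine ⟨K, inY p, ?_, fun a b => by rw [coeff_inY, if_neg (by simp)]⟩
  have h2 : yAxis.eval G = PowerSeries.C (PowerSeries.constantCoeff (yAxis.eval G)) +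
      PowerSeries.X * p := by rw [← hp]; ring
  have h3 : inY (PowerSeries.C (MvPowerSeries.constantCoeff G)) =
      MvPowerSeries.C (MvPowerSeries.constantCoeff G) := inY.commutes _
  have h4 : inY (yAxis.eval G) = MvPowerSeries.C (MvPowerSeries.constantCoeff G) +
      MvPowerSeries.X 1 * inY p := by
    rw [h2, map_add, map_mul, inY_X, constantCoeff_yAxis_eval, h3]
  rw [← add_right_comm, ← h4]
  exact hK

end PlaneCurve

end

noncomputable section

namespace PlaneCurve

/-! ### Weierstrass division -/

theorem eq_zero_of_X_pow_dvd {e : Fin 2} {G : Series}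
    (h : ∀ N, MvPowerSeries.X e ^ N ∣ G) : G = 0 := by
  ext m
  rw [(MvPowerSeries.X_pow_dvd_iff.1 (h (m e + 1))) m (Nat.lt_succ_self _), map_zero]

theorem powerSeries_eq_sum_add (p : PowerSeries ℂ) (A : ℕ) :
    ∃ k, p = ∑ j ∈ Finset.range A, PowerSeries.C (PowerSeries.coeff j p) * PowerSeries.X ^ j +
      PowerSeries.X ^ A * k := by
  have : (PowerSeries.X : PowerSeries ℂ) ^ A ∣ p -
      ∑ j ∈ Finset.range A, PowerSeries.C (PowerSeries.coeff j p) * PowerSeries.X ^ j := by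
    rw [PowerSeries.X_pow_dvd_iff]
    intro m hm
    rw [map_sub, map_sum, Finset.sum_eq_single m]
    · simp [PowerSeries.coeff_C_mul, PowerSeries.coeff_X_pow]
    · intro b _ hb
      simp [PowerSeries.coeff_C_mul, PowerSeries.coeff_X_pow, hb.symm]
    · intro h; exact absurd (Finset.mem_range.2 hm) h
  obtain ⟨k, hk⟩ := this
  exact ⟨k, by rw [← hk]; ring⟩

theorem exists_eq_X_pow_mul_of_order {p : PowerSeries ℂ} {A : ℕ} (h : p.order = A) :
    ∃ w, p = PowerSeries.X ^ A * w ∧ PowerSeries.constantCoeff w ≠ 0 := by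
  have h0 : p ≠ 0 := by rintro rfl; simp at h
  have h1 : p.order.toNat = A := by rw [h]; rfl
  refine ⟨p.divXPowOrder, ?_, ?_⟩
  · rw [← h1]; exact (PowerSeries.X_pow_order_mul_divXPowOrder).symm
  · rwa [Ne, PowerSeries.constantCoeff_divXPowOrder_eq_zero_iff]

/-- Modulo x this is division of power series in y by K(0, y) = y^A · unit; the error is divisible
by x, and its cofactor H' is the input of the next step. -/
theorem exists_division_step {K : Series} {A : ℕ} (hA : (yAxis.eval K).order = A) (H : Series) :
    ∃ (q : PowerSeries ℂ) (p : ℕ → ℂ) (H' : Series),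
      H = inY q * K + ∑ j ∈ Finset.range A, MvPowerSeries.C (p j) * MvPowerSeries.X 1 ^ j +
        MvPowerSeries.X 0 * H' := by
  obtain ⟨w, hw, hw0⟩ := exists_eq_X_pow_mul_of_order hA
  obtain ⟨k, hk⟩ := powerSeries_eq_sum_add (yAxis.eval H) A
  have hdvd : MvPowerSeries.X 0 ∣ H - inY (k * w⁻¹) * K -
      ∑ j ∈ Finset.range A, MvPowerSeries.C (PowerSeries.coeff j (yAxis.eval H)) *
        MvPowerSeries.X 1 ^ j := by
    rw [X_zero_dvd_iff]
    simp only [map_sub, map_mul, map_sum, map_pow, yAxis_eval_inY, Param.eval_C,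
      Param.eval_X_one]
    rw [sub_sub, sub_eq_zero]
    nth_rw 1 [hk]
    rw [hw, add_comm]
    have : k * w⁻¹ * (PowerSeries.X ^ A * w) = PowerSeries.X ^ A * k := by
      calc _ = PowerSeries.X ^ A * k * (w * w⁻¹) := by ring
        _ = _ := by rw [PowerSeries.mul_inv_cancel _ hw0, mul_one]
    rw [this]; rfl
  obtain ⟨H', hH'⟩ := hdvd
  exact ⟨_, _, H', by rw [← hH']; ring⟩

/-- Weierstrass division by `K`, where `K (0, y)` has order `A`. -/
theorem weierstrass_division {K : Series} {A : ℕ} (hA : (yAxis.eval K).order = A) (H : Series) :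
    ∃ (Q : Series) (r : ℕ → PowerSeries ℂ),
      H = Q * K + ∑ j ∈ Finset.range A, inX (r j) * MvPowerSeries.X 1 ^ j := by
  choose q p T hT using exists_division_step hA
  -- The coefficients of x^a in the quotient and the remainder are those produced at the a-th
  -- iterate `T^[a] H`. Hence Q H = q H + x Q (T H), and similarly for r.
  let Q : Series → Series := fun H α => PowerSeries.coeff (α 1) (q (T^[α 0] H))
  let r : Series → ℕ → PowerSeries ℂ := fun H j => PowerSeries.mk fun n => p (T^[n] H) j
  have hQc : ∀ H a b, MvPowerSeries.coeff (mon a b) (Q H) =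
      PowerSeries.coeff b (q (T^[a] H)) := by
    intro H a b
    change PowerSeries.coeff (mon a b 1) (q (T^[mon a b 0] H)) = _
    simp
  have hQ : ∀ H, Q H = inY (q H) + MvPowerSeries.X 0 * Q (T H) := by
    intro H
    refine series_ext fun a b => ?_
    rw [map_add, hQc, coeff_inY]
    cases a with
    | zero => rw [coeff_X_zero_mul_zero]; simp
    | succ a => rw [coeff_X_zero_mul, hQc]; simp
  have hr : ∀ H j, r H j = PowerSeries.C (p H j) + PowerSeries.X * r (T H) j := by
    intro H j
    ext n
    cases n with
    | zero => simp [r]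
    | succ n => simp [r, PowerSeries.coeff_succ_X_mul]
  -- The defect of the division formula satisfies E H = x E (T H); it is divisible by all powers of
  -- x and vanishes.
  let E : Series → Series := fun H =>
    H - Q H * K - ∑ j ∈ Finset.range A, inX (r H j) * MvPowerSeries.X 1 ^ j
  have hE : ∀ H, E H = MvPowerSeries.X 0 * E (T H) := by
    intro H
    have h1 : ∑ j ∈ Finset.range A, inX (r H j) * MvPowerSeries.X 1 ^ j =
        ∑ j ∈ Finset.range A, MvPowerSeries.C (p H j) * MvPowerSeries.X 1 ^ j +
        MvPowerSeries.X 0 * ∑ j ∈ Finset.range A, inX (r (T H) j) * MvPowerSeries.X 1 ^ j := by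
      rw [Finset.mul_sum, ← Finset.sum_add_distrib]
      refine Finset.sum_congr rfl fun j _ => ?_
      have h3 : inX (PowerSeries.C (p H j)) = MvPowerSeries.C (p H j) := inX.commutes _
      rw [hr H j, map_add, map_mul, inX_X, h3]
      ring
    simp only [E]
    rw [h1]
    nth_rw 1 [hT H]
    rw [hQ H]
    ring
  have hE0 : ∀ N H, MvPowerSeries.X 0 ^ N ∣ E H := by
    intro N
    induction N with
    | zero => intro H; simp
    | succ N ih =>
      intro H
      rw [hE H, pow_succ']
      exact mul_dvd_mul_left _ (ih _)
  have := eq_zero_of_X_pow_dvd fun N => hE0 N H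
  refine ⟨Q H, r H, ?_⟩
  simp only [E] at this
  linear_combination this

theorem order_ge_of_dvd {K R : Series} (φ : Param) (h : K ∣ R) :
    (φ.eval K).order ≤ (φ.eval R).order := by
  obtain ⟨L, rfl⟩ := h
  rw [map_mul, PowerSeries.order_mul]
  exact le_self_add

/-- Uniqueness in Weierstrass division. At x = 0 the sum is a polynomial in y of degree below A and
of order at least A, hence zero; so all r_j are divisible by x. As x is prime and does not divide K,
one factor x cancels and the argument repeats. -/
theorem sum_eq_zero_of_dvd {K : Series} {A : ℕ} (hA : (A : ℕ∞) ≤ (yAxis.eval K).order)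
    (hK : ¬ MvPowerSeries.X 0 ∣ K)
    (r : ℕ → PowerSeries ℂ)
    (h : K ∣ ∑ j ∈ Finset.range A, inX (r j) * MvPowerSeries.X 1 ^ j) :
    ∑ j ∈ Finset.range A, inX (r j) * MvPowerSeries.X 1 ^ j = 0 := by
  have hp : Prime (MvPowerSeries.X 0 : Series) := by
    refine ⟨X_ne_zero 0, fun hu => ?_, fun a b hab => ?_⟩
    · rw [isUnit_iff_constantCoeff] at hu; simp at hu
    · rw [X_zero_dvd_iff, map_mul, mul_eq_zero] at hab
      rwa [X_zero_dvd_iff, X_zero_dvd_iff]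
  refine eq_zero_of_X_pow_dvd (e := 0) fun N => ?_
  induction N generalizing r with
  | zero => simp
  | succ N ih =>
    have h1 := hA.trans (order_ge_of_dvd yAxis h)
    have h2 : yAxis.eval (∑ j ∈ Finset.range A, inX (r j) * MvPowerSeries.X 1 ^ j) =
        ∑ j ∈ Finset.range A, PowerSeries.C (PowerSeries.constantCoeff (r j)) *
          PowerSeries.X ^ j := by
      simp only [map_sum, map_mul, map_pow, yAxis_eval_inX, Param.eval_X_one]
      rfl
    have h3 : ∀ j < A, PowerSeries.constantCoeff (r j) = 0 := by
      intro j hj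
      have := PowerSeries.coeff_of_lt_order j (lt_of_lt_of_le (by exact_mod_cast hj) h1)
      rw [h2, map_sum, Finset.sum_eq_single j] at this
      · simpa using this
      · intro b _ hb
        simp [PowerSeries.coeff_C_mul, PowerSeries.coeff_X_pow, hb.symm]
      · intro h; exact absurd (Finset.mem_range.2 hj) h
    have h4 : ∀ j, ∃ s, j < A → r j = PowerSeries.X * s := by
      intro j
      by_cases hj : j < A
      · obtain ⟨s, hs⟩ := PowerSeries.X_dvd_iff.2 (h3 j hj)
        exact ⟨s, fun _ => hs⟩
      · exact ⟨0, fun h => absurd h hj⟩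
    choose s hs using h4
    have h5 : ∑ j ∈ Finset.range A, inX (r j) * MvPowerSeries.X 1 ^ j =
        MvPowerSeries.X 0 * ∑ j ∈ Finset.range A, inX (s j) * MvPowerSeries.X 1 ^ j := by
      rw [Finset.mul_sum]
      refine Finset.sum_congr rfl fun j hj => ?_
      rw [hs j (Finset.mem_range.1 hj), map_mul, inX_X, mul_assoc]
    have h6 : K ∣ ∑ j ∈ Finset.range A, inX (s j) * MvPowerSeries.X 1 ^ j := by
      rw [h5] at h
      obtain ⟨L, hL⟩ := h
      have : MvPowerSeries.X 0 ∣ K * L := ⟨_, hL.symm⟩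
      obtain ⟨M, rfl⟩ := (hp.dvd_or_dvd this).resolve_left hK
      refine ⟨M, mul_left_cancel₀ (X_ne_zero 0) ?_⟩
      rw [hL]; ring
    rw [h5, pow_succ']
    exact mul_dvd_mul_left _ (ih s h6)

/-! ### Multiplicity and initial forms -/

theorem order_eq_mult {G : Series} (hG : G ≠ 0) : MvPowerSeries.order G = mult G :=
  (MvPowerSeries.ne_zero_iff_order_finite.1 hG).symm

theorem coeff_eq_zero_of_lt_mult {G : Series} {a b : ℕ} (h : a + b < mult G) :
    MvPowerSeries.coeff (mon a b) G = 0 := by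
  by_cases hG : G = 0
  · rw [hG, map_zero]
  · refine MvPowerSeries.coeff_of_lt_order ?_
    rw [order_eq_mult hG, mon_degree]
    exact_mod_cast h

theorem exists_coeff_ne_zero_of_mult {G : Series} (hG : G ≠ 0) :
    ∃ a b, a + b = mult G ∧ MvPowerSeries.coeff (mon a b) G ≠ 0 := by
  obtain ⟨d, hd, h⟩ := MvPowerSeries.exists_coeff_ne_zero_and_order
    (MvPowerSeries.ne_zero_iff_order_finite.1 hG)
  rw [eq_mon d] at hd h
  rw [mon_degree, order_eq_mult hG] at h
  exact ⟨_, _, by exact_mod_cast h, hd⟩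

theorem mult_le {G : Series} {a b : ℕ} (h : MvPowerSeries.coeff (mon a b) G ≠ 0) :
    mult G ≤ a + b := by
  by_contra hlt
  exact h (coeff_eq_zero_of_lt_mult (not_le.1 hlt))

theorem le_mult {G : Series} (hG : G ≠ 0) {N : ℕ}
    (h : ∀ a b, a + b < N → MvPowerSeries.coeff (mon a b) G = 0) : N ≤ mult G := by
  obtain ⟨a, b, hab, hc⟩ := exists_coeff_ne_zero_of_mult hG
  by_contra hlt
  exact hc (h a b (by omega))

theorem mult_eq_zero_of_constantCoeff {G : Series} (h : MvPowerSeries.constantCoeff G ≠ 0) :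
    mult G = 0 := by
  have := mult_le (G := G) (a := 0) (b := 0) (by rwa [coeff_mon_zero_zero])
  omega

theorem mult_mul {G H : Series} (hG : G ≠ 0) (hH : H ≠ 0) : mult (G * H) = mult G + mult H := by
  have h := MvPowerSeries.order_mul G H
  rw [order_eq_mult hG, order_eq_mult hH, order_eq_mult (mul_ne_zero hG hH)] at h
  exact_mod_cast h

theorem mult_X (e : Fin 2) : mult (MvPowerSeries.X e) = 1 := by
  have h1 : mult (MvPowerSeries.X e) ≤ 1 := by
    have : MvPowerSeries.coeff (Finsupp.single e 1) (MvPowerSeries.X e : Series) ≠ 0 := by simp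
    rw [eq_mon (Finsupp.single e 1)] at this
    refine (mult_le this).trans ?_
    fin_cases e <;> simp
  have h2 : 1 ≤ mult (MvPowerSeries.X e) := by
    refine le_mult (X_ne_zero e) fun a b hab => ?_
    obtain ⟨rfl, rfl⟩ : a = 0 ∧ b = 0 := by omega
    rw [coeff_mon_zero_zero]; simp
  omega

/-- The part of degree `N` of `G`, dehomogenized by `x = 1`. -/
def iniPoly (N : ℕ) (G : Series) : Polynomial ℂ :=
  ∑ j ∈ Finset.range (N + 1),
    Polynomial.C (MvPowerSeries.coeff (mon (N - j) j) G) * Polynomial.X ^ j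

theorem coeff_iniPoly (N : ℕ) (G : Series) (j : ℕ) (hj : j ≤ N) :
    (iniPoly N G).coeff j = MvPowerSeries.coeff (mon (N - j) j) G := by
  rw [iniPoly, Polynomial.finsetSum_coeff, Finset.sum_eq_single j]
  · simp
  · intro b _ hb
    rw [Polynomial.coeff_C_mul, Polynomial.coeff_X_pow, if_neg hb.symm, mul_zero]
  · intro h; exact absurd (Finset.mem_range.2 (by omega)) h

theorem natDegree_iniPoly_le (N : ℕ) (G : Series) : (iniPoly N G).natDegree ≤ N := by
  refine Polynomial.natDegree_sum_le_of_forall_le _ _ fun j hj => ?_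
  refine (Polynomial.natDegree_C_mul_X_pow_le _ _).trans ?_
  have := Finset.mem_range.1 hj
  omega

theorem iniPoly_mult_ne_zero {G : Series} (hG : G ≠ 0) : iniPoly (mult G) G ≠ 0 := by
  obtain ⟨a, b, hab, hc⟩ := exists_coeff_ne_zero_of_mult hG
  intro h
  have := coeff_iniPoly (mult G) G b (by omega)
  rw [h, show mult G - b = a by omega] at this
  exact hc this.symm

theorem eval_eq_C (φ : Param) (hx : φ.x = 0) (hy : φ.y = 0) (G : Series) :
    φ.eval G = PowerSeries.C (MvPowerSeries.constantCoeff G) := by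
  obtain ⟨K, L, h, -⟩ := exists_eq_C_add G
  rw [h]
  simp [hx, hy]

theorem constantCoeff_eval (φ : Param) (G : Series) :
    PowerSeries.constantCoeff (φ.eval G) = MvPowerSeries.constantCoeff G := by
  obtain ⟨K, L, h, -⟩ := exists_eq_C_add G
  rw [h]
  simp [φ.x_zero, φ.y_zero]

/-- Induction on N through G = x K + y L with L a series in y: the pull-back is x times (pull-back
of K) + (y + c) (pull-back of L), and the initial forms obey the same relation. So the exceptional
line sees the initial form, in the affine coordinate y + c. -/
theorem exists_pull_slope (c : ℂ) (N : ℕ) (G : Series)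
    (hG : ∀ a b, a + b < N → MvPowerSeries.coeff (mon a b) G = 0) :
    ∃ K, (Direction.slope c).pull G = MvPowerSeries.X 0 ^ N * K ∧
      yAxis.eval K =
        ((iniPoly N G).comp (Polynomial.X + Polynomial.C c) : Polynomial ℂ) := by
  induction N generalizing G with
  | zero =>
    refine ⟨_, by rw [pow_zero, one_mul], ?_⟩
    have hl : IsLift (.slope c) ⟨0, 0, by simp, by simp⟩ yAxis := by
      refine ⟨rfl, ?_⟩
      change (0 : PowerSeries ℂ) = 0 * _
      rw [zero_mul]
    rw [hl.eval_pull, eval_eq_C _ rfl rfl, iniPoly]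
    simp [coeff_mon_zero_zero]
  | succ N ih =>
    obtain ⟨K, L, h, hL⟩ := exists_eq_C_add G
    have h0 : MvPowerSeries.constantCoeff G = 0 := by
      rw [← coeff_mon_zero_zero]; exact hG 0 0 (by omega)
    rw [h0, map_zero, zero_add] at h
    have hKc : ∀ a b, MvPowerSeries.coeff (mon a b) K =
        MvPowerSeries.coeff (mon (a + 1) b) G := by
      intro a b
      rw [h, map_add, coeff_X_zero_mul]
      cases b with
      | zero => rw [coeff_X_one_mul_zero, add_zero]
      | succ b => rw [coeff_X_one_mul, hL, add_zero]
    have hLc : ∀ b, MvPowerSeries.coeff (mon 0 b) L =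
        MvPowerSeries.coeff (mon 0 (b + 1)) G := by
      intro b
      rw [h, map_add, coeff_X_zero_mul_zero, coeff_X_one_mul, zero_add]
    obtain ⟨K', hK', hK2⟩ := ih K fun a b hab => by rw [hKc]; exact hG _ _ (by omega)
    obtain ⟨L', hL', hL2⟩ := ih L fun a b hab => by
      cases a with
      | zero => rw [hLc]; exact hG _ _ (by omega)
      | succ a => exact hL a b
    refine ⟨K' + (MvPowerSeries.X 1 + MvPowerSeries.C c) * L', ?_, ?_⟩
    · rw [h, map_add, map_mul, map_mul, hK', hL', Direction.pull_X, Direction.pull_X]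
      simp only [Direction.chart, Matrix.cons_val_zero, Matrix.cons_val_one]
      ring
    · have hini : iniPoly (N + 1) G = iniPoly N K + Polynomial.X * iniPoly N L := by
        have hLp : iniPoly N L =
            Polynomial.C (MvPowerSeries.coeff (mon 0 N) L) * Polynomial.X ^ N := by
          rw [iniPoly, Finset.sum_range_succ, Nat.sub_self, Finset.sum_eq_zero, zero_add]
          intro j hj
          have := Finset.mem_range.1 hj
          rw [show N - j = (N - j - 1) + 1 by omega, hL, map_zero, zero_mul]
        rw [hLp, iniPoly, Finset.sum_range_succ, iniPoly, Nat.sub_self, hLc]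
        congr 1
        · refine Finset.sum_congr rfl fun j hj => ?_
          have := Finset.mem_range.1 hj
          rw [hKc, show N - j + 1 = N + 1 - j by omega]
        · ring
      rw [hini, map_add, map_mul, map_add, hK2, hL2, Param.eval_X_one, Param.eval_C]
      simp [yAxis]

end PlaneCurve

end

noncomputable section

namespace PlaneCurve

/-! ### Exchanging the coordinates -/

/-- The exchange of the coordinates. -/
def swap : Series ≃ₐ[ℂ] Series := MvPowerSeries.renameEquiv ℂ (Equiv.swap (0 : Fin 2) 1)

theorem swap_eq_rename (G : Series) :
    swap G = MvPowerSeries.rename (Equiv.swap (0 : Fin 2) 1) G := rfl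

theorem swap_X_zero : swap (MvPowerSeries.X 0) = MvPowerSeries.X 1 := by
  rw [swap_eq_rename, MvPowerSeries.rename_X]; rfl

theorem swap_X_one : swap (MvPowerSeries.X 1) = MvPowerSeries.X 0 := by
  rw [swap_eq_rename, MvPowerSeries.rename_X]; rfl

theorem coeff_swap (G : Series) (a b : ℕ) :
    MvPowerSeries.coeff (mon a b) (swap G) = MvPowerSeries.coeff (mon b a) G := by
  have h : mon a b = (mon b a).embDomain (Equiv.swap (0 : Fin 2) 1).toEmbedding := by
    ext i
    fin_cases i
    · change _ = (mon b a).embDomain _ ((Equiv.swap (0 : Fin 2) 1).toEmbedding 1)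
      rw [Finsupp.embDomain_apply_self]; simp
    · change _ = (mon b a).embDomain _ ((Equiv.swap (0 : Fin 2) 1).toEmbedding 0)
      rw [Finsupp.embDomain_apply_self]; simp
  rw [h]
  exact MvPowerSeries.coeff_embDomain_rename (Equiv.swap (0 : Fin 2) 1).toEmbedding G (mon b a)

@[simp] theorem swap_swap (G : Series) : swap (swap G) = G :=
  series_ext fun a b => by rw [coeff_swap, coeff_swap]

theorem swap_ne_zero {G : Series} (hG : G ≠ 0) : swap G ≠ 0 :=
  (map_ne_zero_iff _ swap.injective).2 hG

theorem mult_swap (G : Series) : mult (swap G) = mult G := by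
  by_cases hG : G = 0
  · rw [hG, map_zero]
  · refine le_antisymm ?_ ?_
    · obtain ⟨a, b, hab, h⟩ := exists_coeff_ne_zero_of_mult hG
      rw [← coeff_swap] at h
      have := mult_le h
      omega
    · obtain ⟨a, b, hab, h⟩ := exists_coeff_ne_zero_of_mult (swap_ne_zero hG)
      rw [coeff_swap] at h
      have := mult_le h
      omega

theorem constantCoeff_swap (G : Series) :
    MvPowerSeries.constantCoeff (swap G) = MvPowerSeries.constantCoeff G := by
  rw [← coeff_mon_zero_zero, coeff_swap, coeff_mon_zero_zero]

/-- The parametrized curve in exchanged coordinates. -/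
def Param.swap (φ : Param) : Param := ⟨φ.y, φ.x, φ.y_zero, φ.x_zero⟩

theorem Param.eval_swap (φ : Param) (G : Series) : φ.eval (PlaneCurve.swap G) = φ.swap.eval G := by
  rw [swap_eq_rename, MvPowerSeries.rename_eq_subst, φ.eval_apply,
    MvPowerSeries.subst_comp_subst_apply _ φ.hasSubst, φ.swap.eval_apply]
  · congr 1
    funext s
    rw [← φ.eval_apply]
    fin_cases s
    · exact φ.eval_X_one
    · exact φ.eval_X_zero
  · exact MvPowerSeries.HasSubst.X_comp _

theorem Param.swap_eval_swap (φ : Param) (G : Series) : φ.swap.eval (PlaneCurve.swap G) = φ.eval G :=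
  φ.swap.eval_swap G

theorem IsLift.swap {φ φ' : Param} (h : IsLift .vertical φ φ') :
    IsLift (.slope 0) φ.swap φ'.swap := by
  obtain ⟨h1, h2⟩ := h
  refine ⟨h2, ?_⟩
  change φ.x = φ'.y * (φ'.x + _)
  rw [h1, map_zero, add_zero, mul_comm]

/-- Reduces the vertical chart to the chart of slope 0, so that facts on strict transforms need a
proof in the slope charts only. -/
theorem pull_vertical (G : Series) :
    Direction.vertical.pull G = swap ((Direction.slope 0).pull (swap G)) := by
  have hc : MvPowerSeries.HasSubst
      (MvPowerSeries.X ∘ (Equiv.swap (0 : Fin 2) 1) : Fin 2 → Series) :=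
    MvPowerSeries.HasSubst.X_comp _
  have hcomp := hc.comp (Direction.hasSubst (.slope 0))
  simp only [MvPowerSeries.coe_substAlgHom] at hcomp
  rw [← pullback_eq, ← pullback_eq, pullback, pullback, swap_eq_rename, swap_eq_rename,
    MvPowerSeries.rename_eq_subst, MvPowerSeries.rename_eq_subst,
    MvPowerSeries.subst_comp_subst_apply hc (Direction.hasSubst _),
    MvPowerSeries.subst_comp_subst_apply hcomp hc]
  congr 1
  funext s
  have h0 : ∀ s : Fin 2, MvPowerSeries.subst (Direction.slope 0).chart
      ((MvPowerSeries.X ∘ (Equiv.swap (0 : Fin 2) 1)) s : Series) =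
      (Direction.slope 0).chart (Equiv.swap (0 : Fin 2) 1 s) := fun s =>
    MvPowerSeries.subst_X (Direction.hasSubst _) _
  rw [h0]
  fin_cases s
  · change MvPowerSeries.X 0 * MvPowerSeries.X 1 = MvPowerSeries.subst _
      (MvPowerSeries.X 0 * (MvPowerSeries.X 1 + MvPowerSeries.C 0) : Series)
    rw [map_zero, add_zero, MvPowerSeries.subst_mul hc, MvPowerSeries.subst_X hc,
      MvPowerSeries.subst_X hc, mul_comm]
    rfl
  · change MvPowerSeries.X 1 = MvPowerSeries.subst _ (MvPowerSeries.X 0 : Series)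
    rw [MvPowerSeries.subst_X hc]
    rfl

/-! ### The strict transform after one blow-up -/

/-- The strict transform at the point `d` of the exceptional line. -/
def strictStep (d : Direction) (G : Series) : Series := divX d.exc (mult G) (pullback d G)

theorem pull_slope_eq (c : ℂ) (G : Series) :
    (Direction.slope c).pull G = MvPowerSeries.X 0 ^ mult G * strictStep (.slope c) G ∧
      yAxis.eval (strictStep (.slope c) G) =
        ((iniPoly (mult G) G).comp (Polynomial.X + Polynomial.C c) : Polynomial ℂ) := by
  obtain ⟨K, hK, hK2⟩ := exists_pull_slope c (mult G) G fun a b => coeff_eq_zero_of_lt_mult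
  have : strictStep (.slope c) G = K := by
    rw [strictStep, pullback_eq, hK]; exact divX_X_pow_mul _ _ _
  rw [this]
  exact ⟨hK, hK2⟩

theorem strictStep_vertical (G : Series) :
    strictStep .vertical G = swap (strictStep (.slope 0) (swap G)) := by
  have h := (pull_slope_eq 0 (swap G)).1
  rw [strictStep, pullback_eq, pull_vertical, h, map_mul, map_pow, swap_X_zero, mult_swap]
  exact divX_X_pow_mul _ _ _

theorem pull_eq (d : Direction) (G : Series) :
    d.pull G = MvPowerSeries.X d.exc ^ mult G * strictStep d G := by
  cases d with
  | slope c => exact (pull_slope_eq c G).1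
  | vertical =>
    rw [strictStep_vertical, pull_vertical, (pull_slope_eq 0 (swap G)).1, map_mul, map_pow,
      swap_X_zero, mult_swap]
    rfl

theorem comp_X_add_C_ne_zero {p : Polynomial ℂ} (hp : p ≠ 0) (c : ℂ) :
    p.comp (Polynomial.X + Polynomial.C c) ≠ 0 := by
  intro h
  have h2 := congrArg (fun q => q.comp (Polynomial.X - Polynomial.C c)) h
  simp only [Polynomial.comp_assoc] at h2
  simp at h2
  exact hp h2

theorem not_X_zero_dvd_strictStep_slope (c : ℂ) {G : Series} (hG : G ≠ 0) :
    ¬ MvPowerSeries.X 0 ∣ strictStep (.slope c) G := by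
  rw [X_zero_dvd_iff, (pull_slope_eq c G).2, Polynomial.coe_eq_zero_iff]
  exact comp_X_add_C_ne_zero (iniPoly_mult_ne_zero hG) c

theorem strictStep_ne_zero (d : Direction) {G : Series} (hG : G ≠ 0) : strictStep d G ≠ 0 := by
  have key : ∀ c (H : Series), H ≠ 0 → strictStep (.slope c) H ≠ 0 := by
    intro c H hH h
    apply not_X_zero_dvd_strictStep_slope c hH
    rw [h]; exact dvd_zero _
  cases d with
  | slope c => exact key c G hG
  | vertical => rw [strictStep_vertical]; exact swap_ne_zero (key 0 _ (swap_ne_zero hG))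

theorem pull_ne_zero (d : Direction) {G : Series} (hG : G ≠ 0) : d.pull G ≠ 0 := by
  rw [pull_eq]
  exact mul_ne_zero (pow_ne_zero _ (X_ne_zero _)) (strictStep_ne_zero d hG)

theorem constantCoeff_strictStep_slope (c : ℂ) (G : Series) :
    MvPowerSeries.constantCoeff (strictStep (.slope c) G) = (iniPoly (mult G) G).eval c := by
  rw [← constantCoeff_yAxis_eval, (pull_slope_eq c G).2, Polynomial.constantCoeff_coe,
    Polynomial.coeff_zero_eq_eval_zero, Polynomial.eval_comp]
  simp

theorem constantCoeff_strictStep_vertical (G : Series) :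
    MvPowerSeries.constantCoeff (strictStep .vertical G) =
      (iniPoly (mult G) G).coeff (mult G) := by
  rw [strictStep_vertical, constantCoeff_swap, constantCoeff_strictStep_slope,
    ← Polynomial.coeff_zero_eq_eval_zero, coeff_iniPoly _ _ _ (Nat.zero_le _),
    coeff_iniPoly _ _ _ le_rfl, coeff_swap, mult_swap]
  simp

theorem constantCoeff_pull (d : Direction) (G : Series) :
    MvPowerSeries.constantCoeff (d.pull G) = MvPowerSeries.constantCoeff G := by
  obtain ⟨K, L, h, -⟩ := exists_eq_C_add G
  rw [h]
  cases d <;> simp [Direction.pull_X, Direction.chart]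

theorem strictStep_unit (d : Direction) {G : Series}
    (hG : MvPowerSeries.constantCoeff G ≠ 0) :
    MvPowerSeries.constantCoeff (strictStep d G) ≠ 0 := by
  have h := pull_eq d G
  rw [mult_eq_zero_of_constantCoeff hG, pow_zero, one_mul] at h
  rwa [← h, constantCoeff_pull]

/-! ### Equations of branches -/

/-- `G = 0` is an equation of the branch parametrized by `φ`. -/
structure IsEquation (G : Series) (φ : Param) : Prop where
  ne_zero : G ≠ 0
  eval_eq_zero : φ.eval G = 0
  dvd_of_eval : ∀ H, φ.eval H = 0 → G ∣ H

theorem IsEquation.swap {G : Series} {φ : Param} (h : IsEquation G φ) :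
    IsEquation (PlaneCurve.swap G) φ.swap := by
  refine ⟨swap_ne_zero h.ne_zero, by rw [φ.swap_eval_swap, h.eval_eq_zero], fun H hH => ?_⟩
  rw [← φ.eval_swap] at hH
  have := map_dvd PlaneCurve.swap (h.dvd_of_eval _ hH)
  rwa [swap_swap] at this

theorem IsEquation.constantCoeff {G : Series} {φ : Param} (h : IsEquation G φ) :
    MvPowerSeries.constantCoeff G = 0 := by
  rw [← constantCoeff_eval φ, h.eval_eq_zero, map_zero]

theorem mult_le_order_yAxis (G : Series) : (mult G : ℕ∞) ≤ (yAxis.eval G).order := by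
  refine PowerSeries.nat_le_order _ _ fun i hi => ?_
  rw [coeff_yAxis_eval]
  exact coeff_eq_zero_of_lt_mult (by omega)

theorem pull_slope_inX (c : ℂ) (p : PowerSeries ℂ) :
    (Direction.slope c).pull (inX p) = inX p := by
  rw [inX, PowerSeries.coe_substAlgHom, PowerSeries.subst, Direction.pull,
    MvPowerSeries.coe_substAlgHom, MvPowerSeries.subst_comp_subst_apply _ (Direction.hasSubst _)]
  · congr 1
    funext s
    rw [MvPowerSeries.subst_X (Direction.hasSubst _)]
    rfl
  · exact (PowerSeries.HasSubst.X (0 : Fin 2)).const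

/-- Homogenization of `∑ w_j (x) y ^ j` with respect to the slope `c`. -/
theorem exists_homogenization (c : ℂ) (A : ℕ) (w : ℕ → PowerSeries ℂ) :
    ∃ H, (Direction.slope c).pull H = MvPowerSeries.X 0 ^ A *
        ∑ j ∈ Finset.range (A + 1), inX (w j) * MvPowerSeries.X 1 ^ j ∧
      yAxis.eval H = PowerSeries.C (PowerSeries.constantCoeff (w A)) * PowerSeries.X ^ A := by
  refine ⟨∑ j ∈ Finset.range (A + 1), inX (w j) * MvPowerSeries.X 0 ^ (A - j) *
    (MvPowerSeries.X 1 - MvPowerSeries.C c * MvPowerSeries.X 0) ^ j, ?_, ?_⟩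
  · rw [map_sum, Finset.mul_sum]
    refine Finset.sum_congr rfl fun j hj => ?_
    have hj' : A = (A - j) + j := by have := Finset.mem_range.1 hj; omega
    simp only [map_mul, map_pow, map_sub, pull_slope_inX, Direction.pull_X, Direction.pull_C,
      Direction.chart, Matrix.cons_val_zero, Matrix.cons_val_one]
    have h1 : (MvPowerSeries.X 0 * (MvPowerSeries.X 1 + MvPowerSeries.C c) -
      MvPowerSeries.C c * MvPowerSeries.X 0 : Series) =
        MvPowerSeries.X 0 * MvPowerSeries.X 1 := by ring
    rw [h1, mul_pow]
    nth_rw 2 [hj']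
    rw [pow_add]
    ring
  · rw [map_sum, Finset.sum_range_succ, Finset.sum_eq_zero, zero_add]
    · rw [map_mul, map_mul, yAxis_eval_inX]
      simp [yAxis]
    · intro j hj
      have := Finset.mem_range.1 hj
      simp [yAxis, show A - j ≠ 0 by omega]

theorem order_C_mul_X_pow {c : ℂ} (hc : c ≠ 0) (A : ℕ) :
    (PowerSeries.C c * PowerSeries.X ^ A : PowerSeries ℂ).order = A := by
  rw [PowerSeries.order_mul, PowerSeries.order_X_pow, PowerSeries.order_zero_of_unit, zero_add]
  rw [isUnit_powerSeries_iff]; simpa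

/-- Let A be the order of K(0, y), K the strict transform. A polynomial of degree at most A in y
that vanishes on the lift becomes, homogenized, a series vanishing on φ, hence a multiple of G.
Applied to the Weierstrass polynomial of K this gives A = mult G; applied to the remainder of an
arbitrary H vanishing on the lift it shows that K divides the remainder, which is then 0, so K
divides H. -/
theorem step_slope {G : Series} {φ φ' : Param} {c : ℂ} (hG : IsEquation G φ)
    (hl : IsLift (.slope c) φ φ') (hx : φ.x ≠ 0) :
    IsEquation (strictStep (.slope c) G) φ' ∧ (yAxis.eval G).order = mult G ∧
      (yAxis.eval (strictStep (.slope c) G)).order = mult G := by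
  obtain ⟨hpull, hini⟩ := pull_slope_eq c G
  set K := strictStep (.slope c) G with hKdef
  have hK0 : K ≠ 0 := strictStep_ne_zero _ hG.ne_zero
  have hKdvd : ¬ MvPowerSeries.X 0 ∣ K := not_X_zero_dvd_strictStep_slope c hG.ne_zero
  have hx' : φ'.x ≠ 0 := by rw [← hl.1]; exact hx
  have hKe : φ'.eval K = 0 := by
    have h1 : φ'.eval ((Direction.slope c).pull G) = 0 := by
      rw [hl.eval_pull, hG.eval_eq_zero]
    rw [hpull, map_mul, map_pow, Param.eval_X_zero] at h1
    exact (mul_eq_zero.1 h1).resolve_left (pow_ne_zero _ hx')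
  have hA0 : yAxis.eval K ≠ 0 := fun h => hKdvd (X_zero_dvd_iff.2 h)
  obtain ⟨A, hA⟩ : ∃ A : ℕ, (yAxis.eval K).order = A :=
    ⟨_, (PowerSeries.coe_toNat_order hA0).symm⟩
  -- K(0, y) is a nonzero polynomial of degree at most mult G, which bounds its order.
  have hAle : A ≤ mult G := by
    have hp := comp_X_add_C_ne_zero (iniPoly_mult_ne_zero hG.ne_zero) c
    have hc : PowerSeries.coeff (((iniPoly (mult G) G).comp
        (Polynomial.X + Polynomial.C c)).natDegree) (yAxis.eval K) ≠ 0 := by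
      rw [hini, Polynomial.coeff_coe]
      exact Polynomial.leadingCoeff_ne_zero.2 hp
    have h1 := PowerSeries.order_le _ hc
    rw [hA] at h1
    have h2 : ((iniPoly (mult G) G).comp (Polynomial.X + Polynomial.C c)).natDegree ≤ mult G := by
      rw [Polynomial.natDegree_comp, Polynomial.natDegree_X_add_C, mul_one]
      exact natDegree_iniPoly_le _ _
    exact le_trans (by exact_mod_cast h1) h2
  -- polynomials in `y` that vanish on the lift come from multiples of `G`
  have key : ∀ w : ℕ → PowerSeries ℂ,
      φ'.eval (∑ j ∈ Finset.range (A + 1), inX (w j) * MvPowerSeries.X 1 ^ j) = 0 →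
      ∃ H, G ∣ H ∧ (Direction.slope c).pull H = MvPowerSeries.X 0 ^ A *
        ∑ j ∈ Finset.range (A + 1), inX (w j) * MvPowerSeries.X 1 ^ j ∧
      yAxis.eval H = PowerSeries.C (PowerSeries.constantCoeff (w A)) * PowerSeries.X ^ A := by
    intro w hw
    obtain ⟨H, hH, hH2⟩ := exists_homogenization c A w
    refine ⟨H, hG.dvd_of_eval H ?_, hH, hH2⟩
    rw [← hl.eval_pull, hH, map_mul, hw, mul_zero]
  have hAG : (yAxis.eval G).order ≤ A := by
    -- The monic polynomial y^A - r = Q K vanishes on the lift; its homogenization is a multiple of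
    -- G that restricts to y^A on x = 0.
    obtain ⟨Q, r, hQ⟩ := weierstrass_division hA (MvPowerSeries.X 1 ^ A)
    obtain ⟨H, hGH, -, hH⟩ := key (fun j => if j = A then 1 else - r j) (by
      rw [Finset.sum_range_succ, if_pos rfl, map_one, one_mul]
      have h1 : ∑ j ∈ Finset.range A, inX (if j = A then 1 else -r j) * MvPowerSeries.X 1 ^ j =
          - ∑ j ∈ Finset.range A, inX (r j) * MvPowerSeries.X 1 ^ j := by
        rw [← Finset.sum_neg_distrib]
        refine Finset.sum_congr rfl fun j hj => ?_
        rw [if_neg (Finset.mem_range.1 hj).ne, map_neg, neg_mul]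
      rw [h1]
      rw [show -∑ j ∈ Finset.range A, inX (r j) * MvPowerSeries.X 1 ^ j +
        MvPowerSeries.X 1 ^ A = Q * K by linear_combination hQ, map_mul, hKe, mul_zero])
    refine (order_ge_of_dvd yAxis hGH).trans (le_of_eq ?_)
    rw [hH]
    refine order_C_mul_X_pow ?_ A
    simp
  have hμ := mult_le_order_yAxis G
  have hAμ : A = mult G := by
    refine le_antisymm hAle ?_
    have := hμ.trans hAG
    exact_mod_cast this
  refine ⟨⟨hK0, hKe, fun H hH => ?_⟩, ?_, by rw [hA, hAμ]⟩
  · obtain ⟨Q, r, hQ⟩ := weierstrass_division hA H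
    have hr : φ'.eval (∑ j ∈ Finset.range A, inX (r j) * MvPowerSeries.X 1 ^ j) = 0 := by
      have := hH
      rw [hQ, map_add, map_mul, hKe, mul_zero, zero_add] at this
      exact this
    have hsum : ∑ j ∈ Finset.range (A + 1),
        inX (if j = A then 0 else r j) * MvPowerSeries.X 1 ^ j =
        ∑ j ∈ Finset.range A, inX (r j) * MvPowerSeries.X 1 ^ j := by
      rw [Finset.sum_range_succ, if_pos rfl, map_zero, zero_mul, add_zero]
      refine Finset.sum_congr rfl fun j hj => ?_
      rw [if_neg (Finset.mem_range.1 hj).ne]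
    obtain ⟨H0, ⟨L, hL⟩, hH0, -⟩ := key (fun j => if j = A then 0 else r j)
      (by rw [hsum, hr])
    rw [hsum] at hH0
    -- Since A = mult G, the powers of x in the pull-backs of H0 and of G agree and cancel.
    have hdvd : K ∣ ∑ j ∈ Finset.range A, inX (r j) * MvPowerSeries.X 1 ^ j := by
      refine ⟨(Direction.slope c).pull L, mul_left_cancel₀
        (pow_ne_zero A (X_ne_zero 0)) ?_⟩
      rw [← hH0, hL, map_mul, hpull, hAμ]; ring
    have h0 := sum_eq_zero_of_dvd hA.ge hKdvd r hdvd
    rw [hQ, h0, add_zero]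
    exact dvd_mul_left _ _
  · refine le_antisymm (by rw [← hAμ]; exact hAG) hμ

end PlaneCurve

end

/-! ### Lifts of a branch and its strict transforms -/

noncomputable section

namespace PlaneCurve

/-- The coordinates of a parametrized curve, indexed by `Fin 2`. -/
def Param.coord (φ : Param) : Fin 2 → PowerSeries ℂ := ![φ.x, φ.y]

@[simp] theorem Param.coord_zero (φ : Param) : φ.coord 0 = φ.x := rfl
@[simp] theorem Param.coord_one (φ : Param) : φ.coord 1 = φ.y := rfl

theorem Param.eval_X (φ : Param) (e : Fin 2) : φ.eval (MvPowerSeries.X e) = φ.coord e := by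
  fin_cases e
  · exact φ.eval_X_zero
  · exact φ.eval_X_one

theorem IsLift.coord_exc {d : Direction} {φ φ' : Param} (h : IsLift d φ φ') :
    φ'.coord d.exc = φ.coord d.exc := by
  cases d with
  | slope c => exact h.1.symm
  | vertical => exact h.2.symm

theorem IsLift.eval_eq {d : Direction} {φ φ' : Param} (h : IsLift d φ φ') (G : Series) :
    φ.eval G = φ.coord d.exc ^ mult G * φ'.eval (strictStep d G) := by
  rw [← h.eval_pull, pull_eq, map_mul, map_pow, Param.eval_X, h.coord_exc]

theorem IsLift.x_ne_zero {d : Direction} {φ φ' : Param} (h : IsLift d φ φ') (hx : φ.x ≠ 0) :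
    φ'.x ≠ 0 := by
  cases d with
  | slope c => rw [← h.1]; exact hx
  | vertical => intro h0; apply hx; rw [h.1, h0, zero_mul]

theorem IsLift.coord_exc_ne_zero {d : Direction} {φ φ' : Param} (h : IsLift d φ φ')
    (hx : φ.x ≠ 0) : φ.coord d.exc ≠ 0 := by
  cases d with
  | slope c => exact hx
  | vertical =>
    intro h0
    apply hx
    rw [h.1, ← h.2]
    change φ.y = 0 at h0
    rw [h0, mul_zero]

theorem IsEquation.step {G : Series} {φ φ' : Param} {d : Direction} (hG : IsEquation G φ)
    (hl : IsLift d φ φ') (hx : φ.x ≠ 0) : IsEquation (strictStep d G) φ' := by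
  cases d with
  | slope c => exact (step_slope hG hl hx).1
  | vertical =>
    rw [strictStep_vertical]
    have h := (step_slope hG.swap hl.swap (hl.coord_exc_ne_zero hx)).1
    exact h.swap

/-- A branch has a single tangent: translated by c, the initial polynomial has degree at most mult G
and, by `step_slope`, order exactly mult G, so it is a monomial. -/
theorem iniPoly_eq {G : Series} {φ φ' : Param} {c : ℂ} (hG : IsEquation G φ)
    (hl : IsLift (.slope c) φ φ') (hx : φ.x ≠ 0) :
    ∃ a, a ≠ 0 ∧ iniPoly (mult G) G =
      Polynomial.C a * (Polynomial.X - Polynomial.C c) ^ mult G := by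
  have h1 := (step_slope hG hl hx).2.2
  rw [(pull_slope_eq c G).2] at h1
  set p := (iniPoly (mult G) G).comp (Polynomial.X + Polynomial.C c) with hp
  have hp0 : p ≠ 0 := comp_X_add_C_ne_zero (iniPoly_mult_ne_zero hG.ne_zero) c
  have hdeg : p.natDegree ≤ mult G := by
    rw [hp, Polynomial.natDegree_comp, Polynomial.natDegree_X_add_C, mul_one]
    exact natDegree_iniPoly_le _ _
  have hpe : p = Polynomial.C (p.coeff (mult G)) * Polynomial.X ^ mult G := by
    ext j
    rw [Polynomial.coeff_C_mul, Polynomial.coeff_X_pow]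
    rcases lt_trichotomy j (mult G) with h | h | h
    · rw [if_neg h.ne, mul_zero, ← Polynomial.coeff_coe]
      refine PowerSeries.coeff_of_lt_order _ ?_
      rw [h1]; exact_mod_cast h
    · rw [if_pos h, mul_one, h]
    · rw [if_neg h.ne', mul_zero]
      exact Polynomial.coeff_eq_zero_of_natDegree_lt (by omega)
  refine ⟨p.coeff (mult G), ?_, ?_⟩
  · intro h0
    rw [h0, map_zero, zero_mul] at hpe
    exact hp0 hpe
  · have h2 : iniPoly (mult G) G = p.comp (Polynomial.X - Polynomial.C c) := by
      rw [hp, Polynomial.comp_assoc]; simp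
    rw [h2]
    nth_rw 1 [hpe]
    simp

/-- A branch does not pass through the other points of the first neighbourhood. -/
theorem constantCoeff_strictStep_ne_zero {G : Series} {φ φ' : Param} {d d' : Direction}
    (hG : IsEquation G φ) (hl : IsLift d φ φ') (hx : φ.x ≠ 0) (hd : d' ≠ d) :
    MvPowerSeries.constantCoeff (strictStep d' G) ≠ 0 := by
  cases d with
  | slope c =>
    obtain ⟨a, ha, hini⟩ := iniPoly_eq hG hl hx
    cases d' with
    | slope c' =>
      rw [constantCoeff_strictStep_slope, hini]
      have : c' - c ≠ 0 := by
        intro h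
        exact hd (by rw [sub_eq_zero.1 h])
      simp [ha, this]
    | vertical =>
      rw [constantCoeff_strictStep_vertical, hini, Polynomial.coeff_C_mul]
      have h1 : ((Polynomial.X - Polynomial.C c) ^ mult G).coeff (mult G) = 1 := by
        have h2 := (Polynomial.monic_X_sub_C c).pow (mult G)
        rw [Polynomial.Monic, Polynomial.leadingCoeff, Polynomial.natDegree_pow,
          Polynomial.natDegree_X_sub_C, mul_one] at h2
        exact h2
      rw [h1, mul_one]; exact ha
  | vertical =>
    obtain ⟨a, ha, hini⟩ := iniPoly_eq hG.swap hl.swap (hl.coord_exc_ne_zero hx)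
    rw [map_zero, sub_zero, mult_swap] at hini
    cases d' with
    | slope c' =>
      -- Exchanging the coordinates reverses the coefficients of the initial polynomial, so the
      -- monomial of top degree becomes a constant.
      have hcoeff : ∀ j ≤ mult G, (iniPoly (mult G) G).coeff j =
          if j = 0 then a else 0 := by
        intro j hj
        have h1 := coeff_iniPoly (mult G) (swap G) (mult G - j) (by omega)
        rw [coeff_swap, hini, Polynomial.coeff_C_mul, Polynomial.coeff_X_pow,
          show mult G - (mult G - j) = j by omega] at h1
        rw [coeff_iniPoly _ _ _ hj, ← h1]
        by_cases h0 : j = 0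
        · simp [h0]
        · rw [if_neg h0, if_neg (by omega), mul_zero]
      have hC : iniPoly (mult G) G = Polynomial.C a := by
        ext j
        rw [Polynomial.coeff_C]
        by_cases hj : j ≤ mult G
        · exact hcoeff j hj
        · rw [if_neg (by omega)]
          exact Polynomial.coeff_eq_zero_of_natDegree_lt
            (lt_of_le_of_lt (natDegree_iniPoly_le _ _) (not_le.1 hj))
      rw [constantCoeff_strictStep_slope, hC, Polynomial.eval_C]
      exact ha
    | vertical => exact absurd rfl hd

theorem isLift_xAxis : IsLift (.slope 0) xAxis xAxis := by
  refine ⟨rfl, ?_⟩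
  change (0 : PowerSeries ℂ) = PowerSeries.X * (0 + _)
  simp

theorem isLift_yAxis : IsLift .vertical yAxis yAxis := by
  refine ⟨?_, rfl⟩
  change (0 : PowerSeries ℂ) = 0 * _
  simp

theorem order_xAxis_eval_slope_zero (G : Series) : (xAxis.eval G).order =
    mult G + (xAxis.eval (strictStep (.slope 0) G)).order := by
  rw [isLift_xAxis.eval_eq, PowerSeries.order_mul]
  congr 1
  exact PowerSeries.order_X_pow _

theorem order_yAxis_eval_vertical (G : Series) : (yAxis.eval G).order =
    mult G + (yAxis.eval (strictStep .vertical G)).order := by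
  rw [isLift_yAxis.eval_eq, PowerSeries.order_mul]
  congr 1
  exact PowerSeries.order_X_pow _

theorem order_eq_zero_of_constantCoeff {p : PowerSeries ℂ}
    (h : PowerSeries.constantCoeff p ≠ 0) : p.order = 0 :=
  PowerSeries.order_zero_of_unit (isUnit_powerSeries_iff.2 h)

theorem order_xAxis_eval_slope {G : Series} {φ φ' : Param} {c : ℂ} (hG : IsEquation G φ)
    (hl : IsLift (.slope c) φ φ') (hx : φ.x ≠ 0) (hc : c ≠ 0) :
    (xAxis.eval G).order = mult G := by
  rw [order_xAxis_eval_slope_zero, order_eq_zero_of_constantCoeff, add_zero]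
  rw [constantCoeff_xAxis_eval]
  refine constantCoeff_strictStep_ne_zero hG hl hx ?_
  intro h
  injection h with h
  exact hc h.symm

theorem order_xAxis_eval_vertical {G : Series} {φ φ' : Param} (hG : IsEquation G φ)
    (hl : IsLift .vertical φ φ') (hx : φ.x ≠ 0) :
    (xAxis.eval G).order = mult G ∧ (xAxis.eval (strictStep .vertical G)).order = mult G := by
  obtain ⟨-, h1, h2⟩ := step_slope hG.swap hl.swap (hl.coord_exc_ne_zero hx)
  rw [Param.eval_swap, mult_swap] at h1
  rw [mult_swap] at h2
  refine ⟨h1, ?_⟩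
  rw [strictStep_vertical, Param.eval_swap]
  exact h2

/-! ### Existence and uniqueness of lifts -/

theorem dvd_of_order_le {p q : PowerSeries ℂ} (hp : p ≠ 0) (h : p.order ≤ q.order) : p ∣ q := by
  obtain ⟨w, hw, hw0⟩ := exists_eq_X_pow_mul_of_order (PowerSeries.coe_toNat_order hp).symm
  have hq : PowerSeries.X ^ p.order.toNat ∣ q := by
    rw [PowerSeries.X_pow_dvd_iff]
    intro m hm
    refine PowerSeries.coeff_of_lt_order _ (lt_of_lt_of_le ?_ h)
    rw [← PowerSeries.coe_toNat_order hp]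
    exact_mod_cast hm
  have hu := isUnit_powerSeries_iff.2 hw0
  rw [hw]
  exact (hu.mul_right_dvd).2 hq

theorem one_le_order {p : PowerSeries ℂ} (h : PowerSeries.constantCoeff p = 0) :
    1 ≤ p.order := PowerSeries.one_le_order_iff_constCoeff_eq_zero.2 h

theorem order_eq_coe {p : PowerSeries ℂ} (h : p ≠ 0) : p.order = (p.order.toNat : ℕ∞) :=
  (PowerSeries.coe_toNat_order h).symm

theorem exists_lift (φ : Param) (hx : φ.x ≠ 0) : ∃ d φ', IsLift d φ φ' := by
  by_cases h : φ.x.order ≤ φ.y.order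
  · obtain ⟨q, hq⟩ := dvd_of_order_le hx h
    refine ⟨.slope (PowerSeries.constantCoeff q),
      ⟨φ.x, q - PowerSeries.C (PowerSeries.constantCoeff q), φ.x_zero, by simp⟩, rfl, ?_⟩
    simpa using hq
  · have hy : φ.y ≠ 0 := by
      intro hy
      rw [hy, PowerSeries.order_zero] at h
      exact h le_top
    obtain ⟨q, hq⟩ := dvd_of_order_le hy (not_le.1 h).le
    refine ⟨.vertical, ⟨q, φ.y, ?_, φ.y_zero⟩, by rw [hq]; exact mul_comm _ _, rfl⟩
    by_contra h0
    apply h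
    rw [hq, PowerSeries.order_mul, order_eq_zero_of_constantCoeff h0, add_zero]

theorem IsLift.order_slope_le {φ φ' : Param} {c : ℂ} (h : IsLift (.slope c) φ φ') :
    φ.x.order ≤ φ.y.order := by
  rw [h.2, PowerSeries.order_mul, ← h.1]
  exact le_self_add

theorem IsLift.order_vertical_lt {φ φ' : Param} (h : IsLift .vertical φ φ') (hx : φ.x ≠ 0) :
    φ.y.order < φ.x.order := by
  have hy : φ.y ≠ 0 := h.coord_exc_ne_zero hx
  have hx' := h.x_ne_zero hx
  have h1 := one_le_order φ'.x_zero
  rw [h.1, ← h.2, PowerSeries.order_mul]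
  rw [order_eq_coe hy, order_eq_coe hx'] at *
  norm_cast at *
  omega

theorem order_slope_ne_zero {φ φ' : Param} {c : ℂ} (h : IsLift (.slope c) φ φ') (hc : c ≠ 0) :
    φ.y.order = φ.x.order := by
  have h0 : (φ'.y + PowerSeries.C c).order = 0 :=
    order_eq_zero_of_constantCoeff (by simp [φ'.y_zero, hc])
  rw [h.2, PowerSeries.order_mul, ← h.1, h0, add_zero]

theorem order_slope_zero {φ φ' : Param} (h : IsLift (.slope 0) φ φ') :
    φ.y.order = φ.x.order + φ'.y.order := by
  rw [h.2, PowerSeries.order_mul, ← h.1, map_zero, add_zero]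

theorem order_vertical {φ φ' : Param} (h : IsLift .vertical φ φ') :
    φ.x.order = φ'.x.order + φ.y.order := by
  rw [h.1, PowerSeries.order_mul, ← h.2]

/-- The Newton polygon of an equation of a branch is a segment with the slope given by the
orders of the parametrization. -/
theorem IsEquation.order_relation {G : Series} {φ : Param} (hG : IsEquation G φ)
    (hx : φ.x ≠ 0) (hy : φ.y ≠ 0) :
    ∃ A B : ℕ, (yAxis.eval G).order = A ∧ (xAxis.eval G).order = B ∧
      A * φ.y.order.toNat = B * φ.x.order.toNat := by
  -- The sum of the two orders drops at every blow-up with direction `slope 0` or `vertical`; any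
  -- other direction means that the orders are equal.
  induction hn : φ.x.order.toNat + φ.y.order.toNat using Nat.strong_induction_on
    generalizing G φ with
  | _ n ih =>
    obtain ⟨d, φ', hl⟩ := exists_lift φ hx
    have hx' := hl.x_ne_zero hx
    have hG' := hG.step hl hx
    have hx1 := one_le_order φ.x_zero
    have hy1 := one_le_order φ.y_zero
    have hX := order_eq_coe hx
    have hY := order_eq_coe hy
    rw [hX] at hx1
    rw [hY] at hy1
    have hx1 : 1 ≤ φ.x.order.toNat := by exact_mod_cast hx1
    have hy1 : 1 ≤ φ.y.order.toNat := by exact_mod_cast hy1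
    cases d with
    | slope c =>
      obtain ⟨-, hA, hA'⟩ := step_slope hG hl hx
      by_cases hc : c = 0
      · subst hc
        have hy' : φ'.y ≠ 0 := by
          intro h0; apply hy; rw [hl.2, h0]; simp
        have ho := order_slope_zero hl
        have hY' := order_eq_coe hy'
        rw [hX, hY, hY'] at ho
        have ho : φ.y.order.toNat = φ.x.order.toNat + φ'.y.order.toNat := by exact_mod_cast ho
        obtain ⟨A, B, h1, h2, h3⟩ := ih _ (by rw [← hl.1]; omega) hG' hx' hy' rfl
        have hAe : A = mult G := by rw [hA'] at h1; exact_mod_cast h1.symm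
        refine ⟨mult G, mult G + B, hA, ?_, ?_⟩
        · rw [order_xAxis_eval_slope_zero, h2]; push_cast; rfl
        · rw [ho, ← hAe, mul_add, h3, ← hl.1]; ring
      · refine ⟨mult G, mult G, hA, order_xAxis_eval_slope hG hl hx hc, ?_⟩
        rw [order_slope_ne_zero hl hc]
    | vertical =>
      obtain ⟨hB, hB'⟩ := order_xAxis_eval_vertical hG hl hx
      have hy' : φ'.y ≠ 0 := by rw [← hl.2]; exact hy
      have ho := order_vertical hl
      have hX' := order_eq_coe hx'
      rw [hX, hY, hX'] at ho
      have ho : φ.x.order.toNat = φ'.x.order.toNat + φ.y.order.toNat := by exact_mod_cast ho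
      obtain ⟨A, B, h1, h2, h3⟩ := ih _ (by rw [← hl.2]; omega) hG' hx' hy' rfl
      have hBe : B = mult G := by rw [hB'] at h2; exact_mod_cast h2.symm
      refine ⟨mult G + A, mult G, ?_, hB, ?_⟩
      · rw [order_yAxis_eval_vertical, h1]; push_cast; rfl
      · rw [ho, ← hBe, mul_add, ← h3, ← hl.2]; ring

/-- The hypothesis on G(0, y) says that φ runs through the branch once: its order in x is the
intersection number with the y-axis. Orders along φ are then multiplicities rather than multiples of
them. In the vertical direction the relation `IsEquation.order_relation` turns this into the same
statement for y, and the property passes to the lift. -/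
theorem IsEquation.mult_eq {G : Series} {φ φ' : Param} {d : Direction} (hG : IsEquation G φ)
    (hx : φ.x ≠ 0) (hA : (yAxis.eval G).order = φ.x.order) (hl : IsLift d φ φ') :
    (mult G : ℕ∞) = (φ.coord d.exc).order ∧
      (yAxis.eval (strictStep d G)).order = φ'.x.order := by
  cases d with
  | slope c =>
    obtain ⟨-, h1, h2⟩ := step_slope hG hl hx
    refine ⟨by rw [← h1, hA]; rfl, ?_⟩
    rw [h2, ← h1, hA, hl.1]
  | vertical =>
    have hy : φ.y ≠ 0 := hl.coord_exc_ne_zero hx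
    obtain ⟨A, B, h1, h2, h3⟩ := hG.order_relation hx hy
    obtain ⟨hB, hB'⟩ := order_xAxis_eval_vertical hG hl hx
    have hX := order_eq_coe hx
    have hY := order_eq_coe hy
    have hX' := order_eq_coe (hl.x_ne_zero hx)
    have hx1 := one_le_order φ.x_zero
    rw [hX] at hx1
    have hx1 : 1 ≤ φ.x.order.toNat := by exact_mod_cast hx1
    have hAe : A = φ.x.order.toNat := by
      rw [h1, hX] at hA; exact_mod_cast hA
    have hBe : B = φ.y.order.toNat := by
      rw [hAe, mul_comm] at h3
      exact (Nat.eq_of_mul_eq_mul_right hx1 h3).symm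
    have hm : mult G = φ.y.order.toNat := by
      rw [← hBe]; rw [hB] at h2; exact_mod_cast h2
    refine ⟨by rw [hm]; exact hY.symm, ?_⟩
    have ho := order_vertical hl
    have hv := order_yAxis_eval_vertical G
    rw [hA, ho, hm, hY, add_comm] at hv
    exact (WithTop.add_left_cancel (ENat.natCast_ne_top _) hv).symm

/-! ### The infinitely near points of a branch -/

/-- The infinitely near points of a branch, with the lifts of a parametrization. -/
structure Chain where
  d : ℕ → Direction
  φ : ℕ → Param
  lift : ∀ s, IsLift (d s) (φ s) (φ (s + 1))
  x_ne : ∀ s, (φ s).x ≠ 0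

theorem exists_chain (φ : Param) (hx : φ.x ≠ 0) : ∃ c : Chain, c.φ 0 = φ := by
  choose d T hT using fun p : {φ : Param // φ.x ≠ 0} => exists_lift p.1 p.2
  let st : ℕ → {φ : Param // φ.x ≠ 0} := fun s =>
    (fun p => ⟨T p, (hT p).x_ne_zero p.2⟩)^[s] ⟨φ, hx⟩
  refine ⟨⟨fun s => d (st s), fun s => (st s).1, fun s => ?_, fun s => (st s).2⟩, rfl⟩
  have : st (s + 1) = ⟨T (st s), (hT (st s)).x_ne_zero (st s).2⟩ :=
    Function.iterate_succ_apply' _ _ _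
  rw [this]
  exact hT (st s)

/-- The `s`-th infinitely near point of a branch. -/
def Chain.pt (c : Chain) (s : ℕ) : InfNear := (List.range s).map c.d

theorem Chain.pt_succ (c : Chain) (s : ℕ) : c.pt (s + 1) = c.pt s ++ [c.d s] := by
  rw [Chain.pt, Chain.pt, List.range_succ, List.map_append]; rfl

@[simp] theorem Chain.pt_zero (c : Chain) : c.pt 0 = [] := rfl

@[simp] theorem Chain.length_pt (c : Chain) (s : ℕ) : (c.pt s).length = s := by
  simp [Chain.pt]

/-- The multiplicity of the branch at its `s`-th infinitely near point. -/
def Chain.mul (c : Chain) (s : ℕ) : ℕ := ((c.φ s).coord (c.d s).exc).order.toNat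

theorem Chain.order_coord_exc (c : Chain) (s : ℕ) :
    ((c.φ s).coord (c.d s).exc).order = c.mul s :=
  order_eq_coe ((c.lift s).coord_exc_ne_zero (c.x_ne s))

theorem strict_append (p t : InfNear) (G : Series) :
    strict (p ++ t) G = strict t (strict p G) := by
  induction p generalizing G with
  | nil => rfl
  | cons d p ih => exact ih _

theorem strict_snoc (p : InfNear) (d : Direction) (G : Series) :
    strict (p ++ [d]) G = strictStep d (strict p G) := strict_append p [d] G

theorem total_append (p t : InfNear) (G : Series) :
    total (p ++ t) G = total t (total p G) := by
  induction p generalizing G with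
  | nil => rfl
  | cons d p ih => exact ih _

theorem total_snoc (p : InfNear) (d : Direction) (G : Series) :
    total (p ++ [d]) G = d.pull (total p G) := by
  rw [total_append, ← pullback_eq]; rfl

theorem strict_ne_zero (p : InfNear) {G : Series} (hG : G ≠ 0) : strict p G ≠ 0 := by
  induction p generalizing G with
  | nil => exact hG
  | cons d p ih => exact ih (strictStep_ne_zero d hG)

theorem Chain.isEquation_strict (c : Chain) {G : Series} (hG : IsEquation G (c.φ 0))
    (hA : (yAxis.eval G).order = (c.φ 0).x.order) (s : ℕ) :
    IsEquation (strict (c.pt s) G) (c.φ s) ∧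
      (yAxis.eval (strict (c.pt s) G)).order = (c.φ s).x.order := by
  induction s with
  | zero => exact ⟨hG, hA⟩
  | succ s ih =>
    rw [c.pt_succ, strict_snoc]
    exact ⟨ih.1.step (c.lift s) (c.x_ne s), (ih.1.mult_eq (c.x_ne s) ih.2 (c.lift s)).2⟩

theorem Chain.mult_strict (c : Chain) {G : Series} (hG : IsEquation G (c.φ 0))
    (hA : (yAxis.eval G).order = (c.φ 0).x.order) (s : ℕ) :
    mult (strict (c.pt s) G) = c.mul s := by
  have h := c.isEquation_strict hG hA s
  have := (h.1.mult_eq (c.x_ne s) h.2 (c.lift s)).1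
  rw [c.order_coord_exc] at this
  exact_mod_cast this

/-- The strict transform of a branch is a unit outside of its infinitely near points. -/
theorem Chain.strict_unit_of_ne (c : Chain) {G : Series} (hG : IsEquation G (c.φ 0))
    (hA : (yAxis.eval G).order = (c.φ 0).x.order) (p : InfNear)
    (hp : p ≠ c.pt p.length) : MvPowerSeries.constantCoeff (strict p G) ≠ 0 := by
  induction p using List.reverseRecOn with
  | nil => exact absurd rfl hp
  | append_singleton p d ih =>
    rw [strict_snoc]
    by_cases h : p = c.pt p.length
    · rw [List.length_append, List.length_singleton, c.pt_succ, ← h] at hp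
      have hd : d ≠ c.d p.length := by rintro rfl; exact hp rfl
      rw [h]
      exact constantCoeff_strictStep_ne_zero (c.isEquation_strict hG hA _).1 (c.lift _)
        (c.x_ne _) hd
    · exact strictStep_unit d (ih h)

end PlaneCurve

end

noncomputable section

namespace PlaneCurve

open scoped NNReal ENNReal

/-! ### Convergence and substitution -/

/-- The weighted `ℓ¹` norm of a series on the polydisc of radius `r`. -/
def nrm (r : ℝ≥0) (G : Series) : ℝ≥0∞ :=
  ∑' α : Fin 2 →₀ ℕ, ((‖MvPowerSeries.coeff α G‖₊ * r ^ α.degree : ℝ≥0) : ℝ≥0∞)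

theorem isConvergent_iff {G : Series} : IsConvergent G ↔ ∃ r : ℝ≥0, 0 < r ∧ nrm r G ≠ ⊤ := by
  constructor
  · rintro ⟨r, hr, h⟩
    lift r to ℝ≥0 using hr.le
    refine ⟨r, by exact_mod_cast hr, ?_⟩
    rw [nrm, ENNReal.tsum_coe_ne_top_iff_summable, ← NNReal.summable_coe]
    simpa using h
  · rintro ⟨r, hr, h⟩
    refine ⟨r, hr, ?_⟩
    rw [nrm, ENNReal.tsum_coe_ne_top_iff_summable, ← NNReal.summable_coe] at h
    simpa using h

theorem nrm_mono {r s : ℝ≥0} (h : r ≤ s) (G : Series) : nrm r G ≤ nrm s G := by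
  refine ENNReal.tsum_le_tsum fun α => ?_
  gcongr

theorem nrm_mul_le (r : ℝ≥0) (G H : Series) : nrm r (G * H) ≤ nrm r G * nrm r H := by
  classical
  have h1 : nrm r (G * H) ≤ ∑' α : Fin 2 →₀ ℕ,
      ∑ p ∈ Finset.HasAntidiagonal.antidiagonal α,
        ((‖MvPowerSeries.coeff p.1 G‖₊ * r ^ p.1.degree : ℝ≥0) : ℝ≥0∞) *
        ((‖MvPowerSeries.coeff p.2 H‖₊ * r ^ p.2.degree : ℝ≥0) : ℝ≥0∞) := by
    refine ENNReal.tsum_le_tsum fun α => ?_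
    rw [MvPowerSeries.coeff_mul]
    norm_cast
    refine (mul_le_mul_left (nnnorm_sum_le _ _) _).trans ?_
    rw [Finset.sum_mul]
    refine Finset.sum_le_sum fun p hp => ?_
    have hd : α.degree = p.1.degree + p.2.degree := by
      rw [← Finset.HasAntidiagonal.mem_antidiagonal.mp hp, map_add]
    rw [hd, pow_add, nnnorm_mul]
    refine le_of_eq ?_
    ring
  refine h1.trans (le_of_eq ?_)
  rw [nrm, nrm, ← ENNReal.tsum_mul_right]
  simp_rw [← ENNReal.tsum_mul_left]
  rw [← ENNReal.tsum_prod (f := fun a b =>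
      ((‖MvPowerSeries.coeff a G‖₊ * r ^ a.degree : ℝ≥0) : ℝ≥0∞) *
        ((‖MvPowerSeries.coeff b H‖₊ * r ^ b.degree : ℝ≥0) : ℝ≥0∞)),
    ← (Finset.HasAntidiagonal.sigmaAntidiagonalEquivProd (A := Fin 2 →₀ ℕ)).tsum_eq, ENNReal.tsum_sigma']
  refine tsum_congr fun α => ?_
  rw [tsum_fintype, ← Finset.sum_coe_sort]
  rfl

theorem nrm_one (r : ℝ≥0) : nrm r 1 = 1 := by
  classical
  rw [nrm, tsum_eq_single 0]
  · simp
  · intro α hα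
    rw [MvPowerSeries.coeff_one, if_neg hα]
    simp

theorem nrm_pow_le (r : ℝ≥0) (G : Series) (N : ℕ) : nrm r (G ^ N) ≤ nrm r G ^ N := by
  induction N with
  | zero => rw [pow_zero, pow_zero, nrm_one]
  | succ N ih =>
    rw [pow_succ, pow_succ]
    exact (nrm_mul_le _ _ _).trans (mul_le_mul_left ih _)

theorem nrm_subst_le (r : ℝ≥0) {a : Fin 2 → Series} (ha : MvPowerSeries.HasSubst a)
    (G : Series) : nrm r (MvPowerSeries.subst a G) ≤
      ∑' α : Fin 2 →₀ ℕ, (‖MvPowerSeries.coeff α G‖₊ : ℝ≥0∞) *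
        (nrm r (a 0) ^ α 0 * nrm r (a 1) ^ α 1) := by
  have h1 : ∀ β : Fin 2 →₀ ℕ,
      ((‖MvPowerSeries.coeff β (MvPowerSeries.subst a G)‖₊ * r ^ β.degree : ℝ≥0) : ℝ≥0∞) ≤
      ∑' α : Fin 2 →₀ ℕ, (‖MvPowerSeries.coeff α G‖₊ : ℝ≥0∞) *
        ((‖MvPowerSeries.coeff β (a 0 ^ α 0 * a 1 ^ α 1)‖₊ * r ^ β.degree : ℝ≥0) : ℝ≥0∞) := by
    intro β
    have hp : ∀ α : Fin 2 →₀ ℕ, α.prod (fun s e => a s ^ e) = a 0 ^ α 0 * a 1 ^ α 1 := by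
      intro α
      rw [Finsupp.prod_fintype _ _ (by simp), Fin.prod_univ_two]
    rw [MvPowerSeries.coeff_subst ha,
      finsum_eq_sum _ (MvPowerSeries.coeff_subst_finite ha G β)]
    push_cast
    refine (mul_le_mul_left (ENNReal.coe_le_coe.2 (nnnorm_sum_le _ _)) _).trans ?_
    rw [ENNReal.ofNNReal_finsetSum, Finset.sum_mul]
    refine le_trans (Finset.sum_le_sum fun α _ => ?_) (ENNReal.sum_le_tsum _)
    rw [hp, smul_eq_mul, nnnorm_mul]
    push_cast
    rw [mul_assoc]
  refine (ENNReal.tsum_le_tsum h1).trans ?_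
  rw [ENNReal.tsum_comm]
  refine ENNReal.tsum_le_tsum fun α => ?_
  rw [ENNReal.tsum_mul_left]
  refine mul_le_mul_right ?_ _
  refine (nrm_mul_le _ _ _).trans ?_
  exact mul_le_mul' (nrm_pow_le _ _ _) (nrm_pow_le _ _ _)

/-- Without constant term every monomial gains at least one factor θ. This makes the norm of a
convergent series arbitrarily small on small polydiscs, as is needed to substitute it into another
one. -/
theorem nrm_mul_radius_le {G : Series} (hG : MvPowerSeries.constantCoeff G = 0) {θ : ℝ≥0}
    (hθ : θ ≤ 1) (r : ℝ≥0) : nrm (θ * r) G ≤ θ * nrm r G := by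
  rw [nrm, nrm, ← ENNReal.tsum_mul_left]
  refine ENNReal.tsum_le_tsum fun α => ?_
  norm_cast
  by_cases hα : α = 0
  · rw [hα, MvPowerSeries.coeff_zero_eq_constantCoeff_apply, hG]; simp
  · have h1 : α.degree ≠ 0 := by rwa [Ne, Finsupp.degree_eq_zero_iff]
    rw [mul_pow]
    have h2 : θ ^ α.degree ≤ θ := by
      have := pow_le_pow_of_le_one zero_le hθ (Nat.one_le_iff_ne_zero.2 h1)
      simpa using this
    calc ‖MvPowerSeries.coeff α G‖₊ * (θ ^ α.degree * r ^ α.degree)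
        = θ ^ α.degree * (‖MvPowerSeries.coeff α G‖₊ * r ^ α.degree) := by ring
      _ ≤ θ * (‖MvPowerSeries.coeff α G‖₊ * r ^ α.degree) := mul_le_mul_left h2 _

theorem exists_nrm_le {G : Series} (hG : IsConvergent G)
    (h0 : MvPowerSeries.constantCoeff G = 0) {ρ : ℝ≥0} (hρ : 0 < ρ) :
    ∃ r : ℝ≥0, 0 < r ∧ nrm r G ≤ ρ := by
  obtain ⟨r, hr, h⟩ := isConvergent_iff.1 hG
  lift nrm r G to ℝ≥0 using h with C hC
  have hCC : 0 < C + 1 + ρ := by positivity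
  refine ⟨(ρ / (C + 1 + ρ)) * r, by positivity, ?_⟩
  have h1 : ρ / (C + 1 + ρ) ≤ 1 := by
    rw [div_le_one hCC]; exact le_add_self
  refine (nrm_mul_radius_le h0 h1 r).trans ?_
  rw [← hC]
  norm_cast
  rw [div_mul_eq_mul_div, div_le_iff₀ hCC]
  refine mul_le_mul_right ?_ _
  rw [add_assoc]; exact le_self_add

theorem nrm_subst_le_nrm {r ρ : ℝ≥0} {a : Fin 2 → Series} (ha : MvPowerSeries.HasSubst a)
    (h0 : nrm r (a 0) ≤ ρ) (h1 : nrm r (a 1) ≤ ρ) (G : Series) :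
    nrm r (MvPowerSeries.subst a G) ≤ nrm ρ G := by
  refine (nrm_subst_le r ha G).trans (ENNReal.tsum_le_tsum fun α => ?_)
  have hd : α.degree = α 0 + α 1 := by
    rw [Finsupp.degree_eq_sum, Fin.sum_univ_two]
  rw [hd, pow_add]
  push_cast
  gcongr

theorem IsConvergent.subst {G : Series} (hG : IsConvergent G) {a : Fin 2 → Series}
    (ha : ∀ s, IsConvergent (a s)) (h0 : ∀ s, MvPowerSeries.constantCoeff (a s) = 0) :
    IsConvergent (MvPowerSeries.subst a G) := by
  obtain ⟨ρ, hρ, h⟩ := isConvergent_iff.1 hG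
  obtain ⟨r0, hr0, h00⟩ := exists_nrm_le (ha 0) (h0 0) hρ
  obtain ⟨r1, hr1, h11⟩ := exists_nrm_le (ha 1) (h0 1) hρ
  refine isConvergent_iff.2 ⟨min r0 r1, lt_min hr0 hr1, ?_⟩
  refine ne_top_of_le_ne_top h (nrm_subst_le_nrm
    (MvPowerSeries.hasSubst_of_constantCoeff_zero h0) ?_ ?_ G)
  · exact (nrm_mono (min_le_left _ _) _).trans h00
  · exact (nrm_mono (min_le_right _ _) _).trans h11

theorem isConvergent_X (e : Fin 2) : IsConvergent (MvPowerSeries.X e) := by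
  simpa using isConvergent_coe (MvPolynomial.X e)

theorem isConvergent_C (c : ℂ) : IsConvergent (MvPowerSeries.C c) := by
  simpa using isConvergent_coe (MvPolynomial.C c)

theorem IsConvergent.neg {G : Series} (hG : IsConvergent G) : IsConvergent (-G) :=
  ConvergentSeries.neg_mem hG

theorem IsConvergent.sub {G H : Series} (hG : IsConvergent G) (hH : IsConvergent H) :
    IsConvergent (G - H) := ConvergentSeries.sub_mem hG hH

theorem IsConvergent.pow {G : Series} (hG : IsConvergent G) (N : ℕ) : IsConvergent (G ^ N) :=
  ConvergentSeries.pow_mem hG N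

/-- Comparison of coefficients after an injective change of exponents. -/
theorem IsConvergent.of_coeff {G H : Series} (hG : IsConvergent G)
    (e : (Fin 2 →₀ ℕ) → (Fin 2 →₀ ℕ)) (he : Function.Injective e)
    (hH : ∀ α, MvPowerSeries.coeff α H = MvPowerSeries.coeff (e α) G) (k m : ℕ)
    (hd : ∀ α, (e α).degree ≤ k * α.degree + m) : IsConvergent H := by
  obtain ⟨r, hr, h⟩ := isConvergent_iff.1 hG
  have hs : 0 < min r 1 := lt_min hr one_pos
  have h' : nrm (min r 1) G ≠ ⊤ := ne_top_of_le_ne_top h (nrm_mono (min_le_left _ _) _)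
  set s := min r 1 with hsdef
  have hs1 : s ≤ 1 := min_le_right _ _
  have hle : nrm (s ^ k) H * (s ^ m : ℝ≥0) ≤ nrm s G := by
    rw [nrm, nrm, ← ENNReal.tsum_mul_right]
    refine le_trans (ENNReal.tsum_le_tsum fun α => ?_)
      (ENNReal.tsum_comp_le_tsum_of_injective he
        (fun α => ((‖MvPowerSeries.coeff α G‖₊ * s ^ α.degree : ℝ≥0) : ℝ≥0∞)))
    rw [hH]
    norm_cast
    rw [mul_assoc, ← pow_mul, ← pow_add]
    exact mul_le_mul_right (pow_le_pow_of_le_one zero_le hs1 (hd α)) _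
  refine isConvergent_iff.2 ⟨s ^ k, by positivity, fun htop => ?_⟩
  rw [htop, ENNReal.top_mul] at hle
  · exact h' (top_le_iff.1 hle)
  · have : 0 < s ^ m := by positivity
    exact_mod_cast this.ne'

theorem IsConvergent.divX {G : Series} (hG : IsConvergent G) (e : Fin 2) (N : ℕ) :
    IsConvergent (PlaneCurve.divX e N G) := by
  refine hG.of_coeff (fun α => α + Finsupp.single e N) (add_left_injective _)
    (fun α => rfl) 1 N fun α => ?_
  rw [map_add, Finsupp.degree_single, one_mul]

theorem IsConvergent.of_X_pow_mul {K : Series} {e : Fin 2} {N : ℕ}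
    (h : IsConvergent (MvPowerSeries.X e ^ N * K)) : IsConvergent K := by
  have := h.divX e N
  rwa [divX_X_pow_mul] at this

theorem IsConvergent.pderiv_one {G : Series} (hG : IsConvergent G) :
    IsConvergent (MvPowerSeries.pderiv ℂ 1 G) := by
  obtain ⟨r, hr, h⟩ := isConvergent_iff.1 hG
  refine isConvergent_iff.2 ⟨r / 2, by positivity, ?_⟩
  have hle : nrm (r / 2) (MvPowerSeries.pderiv ℂ 1 G) * r ≤ nrm r G := by
    rw [nrm, nrm, ← ENNReal.tsum_mul_right]
    refine le_trans (ENNReal.tsum_le_tsum fun α => ?_)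
      (ENNReal.tsum_comp_le_tsum_of_injective (f := fun α => α + Finsupp.single 1 1)
        (add_left_injective _)
        (fun α => ((‖MvPowerSeries.coeff α G‖₊ * r ^ α.degree : ℝ≥0) : ℝ≥0∞)))
    rw [MvPowerSeries.coeff_pderiv]
    norm_cast
    rw [map_add, Finsupp.degree_single, pow_succ, nnnorm_mul, div_pow]
    -- Halving the radius produces a factor 2^(-deg α), which absorbs the factor α 1 + 1 of the
    -- derivative.
    have h2 : ‖((α 1 + 1 : ℕ) : ℂ)‖₊ ≤ 2 ^ α.degree := by
      rw [show ‖((α 1 + 1 : ℕ) : ℂ)‖₊ = ((α 1 + 1 : ℕ) : ℝ≥0) from by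
        rw [← NNReal.coe_inj, coe_nnnorm, Complex.norm_natCast]; rfl]
      have h3 : α 1 ≤ α.degree := Finsupp.le_degree 1 α
      have h4 : α 1 + 1 ≤ 2 ^ α.degree := by
        have := Nat.lt_two_pow_self (n := α.degree)
        omega
      exact_mod_cast h4
    have h5 : (0 : ℝ≥0) < 2 ^ α.degree := by positivity
    calc _ = ‖MvPowerSeries.coeff (α + Finsupp.single 1 1) G‖₊ * (r ^ α.degree * r) *
          (‖((α 1 + 1 : ℕ) : ℂ)‖₊ / 2 ^ α.degree) := by
            push_cast; field_simp
      _ ≤ ‖MvPowerSeries.coeff (α + Finsupp.single 1 1) G‖₊ * (r ^ α.degree * r) * 1 := by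
            refine mul_le_mul_right ?_ _
            rwa [div_le_one h5]
      _ = _ := mul_one _
  intro htop
  rw [htop, ENNReal.top_mul (by exact_mod_cast hr.ne')] at hle
  exact h (top_le_iff.1 hle)

end PlaneCurve

end

noncomputable section

namespace PlaneCurve

open scoped NNReal ENNReal

/-! ### Substitutions -/

theorem hasSubst_pair {a b : Series} (ha : MvPowerSeries.constantCoeff a = 0)
    (hb : MvPowerSeries.constantCoeff b = 0) :
    MvPowerSeries.HasSubst (![a, b] : Fin 2 → Series) := by
  refine MvPowerSeries.hasSubst_of_constantCoeff_zero ?_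
  intro s
  fin_cases s
  · exact ha
  · exact hb

/-- Substitution of a pair of series. -/
def sub2 (a b : Series) (ha : MvPowerSeries.constantCoeff a = 0)
    (hb : MvPowerSeries.constantCoeff b = 0) : Series →ₐ[ℂ] Series :=
  MvPowerSeries.substAlgHom (hasSubst_pair ha hb)

section
variable {a b : Series} (ha : MvPowerSeries.constantCoeff a = 0)
    (hb : MvPowerSeries.constantCoeff b = 0)

theorem sub2_apply (G : Series) :
    sub2 a b ha hb G = MvPowerSeries.subst (![a, b] : Fin 2 → Series) G := by
  rw [sub2, MvPowerSeries.coe_substAlgHom]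

@[simp] theorem sub2_X_zero : sub2 a b ha hb (MvPowerSeries.X 0) = a := by
  rw [sub2, MvPowerSeries.substAlgHom_X]; rfl

@[simp] theorem sub2_X_one : sub2 a b ha hb (MvPowerSeries.X 1) = b := by
  rw [sub2, MvPowerSeries.substAlgHom_X]; rfl

@[simp] theorem sub2_C (c : ℂ) :
    sub2 a b ha hb (MvPowerSeries.C c) = MvPowerSeries.C c := (sub2 a b ha hb).commutes c

theorem isConvergent_sub2 (hac : IsConvergent a) (hbc : IsConvergent b) {G : Series}
    (hG : IsConvergent G) : IsConvergent (sub2 a b ha hb G) := by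
  rw [sub2_apply]
  refine hG.subst ?_ ?_
  · intro s; fin_cases s
    · exact hac
    · exact hbc
  · intro s; fin_cases s
    · exact ha
    · exact hb

theorem constantCoeff_sub2 (G : Series) : MvPowerSeries.constantCoeff (sub2 a b ha hb G) =
    MvPowerSeries.constantCoeff G := by
  obtain ⟨K, L, h, -⟩ := exists_eq_C_add G
  rw [h]
  simp [ha, hb]

theorem sub2_sub2 {a' b' : Series} (ha' : MvPowerSeries.constantCoeff a' = 0)
    (hb' : MvPowerSeries.constantCoeff b' = 0) (G : Series) :
    sub2 a b ha hb (sub2 a' b' ha' hb' G) =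
      sub2 (sub2 a b ha hb a') (sub2 a b ha hb b') (by rwa [constantCoeff_sub2])
        (by rwa [constantCoeff_sub2]) G := by
  rw [sub2_apply, sub2_apply, sub2_apply,
    MvPowerSeries.subst_comp_subst_apply (hasSubst_pair ha' hb') (hasSubst_pair ha hb)]
  congr 1
  funext s
  fin_cases s
  · exact (sub2_apply ha hb a').symm
  · exact (sub2_apply ha hb b').symm

theorem sub2_congr {a' b' : Series} (ha' : MvPowerSeries.constantCoeff a' = 0)
    (hb' : MvPowerSeries.constantCoeff b' = 0) (h1 : a = a') (h2 : b = b') (G : Series) :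
    sub2 a b ha hb G = sub2 a' b' ha' hb' G := by
  subst h1 h2; rfl

theorem eval_sub2 (φ : Param) (G : Series) :
    φ.eval (sub2 a b ha hb G) = Param.eval ⟨φ.eval a, φ.eval b,
      by rwa [constantCoeff_eval], by rwa [constantCoeff_eval]⟩ G := by
  rw [sub2_apply, φ.eval_apply, Param.eval_apply,
    MvPowerSeries.subst_comp_subst_apply (hasSubst_pair ha hb) φ.hasSubst]
  congr 1
  funext s
  fin_cases s
  · exact (φ.eval_apply a).symm
  · exact (φ.eval_apply b).symm
end

theorem sub2_X_X (h0 : MvPowerSeries.constantCoeff (MvPowerSeries.X 0 : Series) = 0)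
    (h1 : MvPowerSeries.constantCoeff (MvPowerSeries.X 1 : Series) = 0) (G : Series) :
    sub2 (MvPowerSeries.X 0) (MvPowerSeries.X 1) h0 h1 G = G := by
  rw [sub2_apply]
  have : (![MvPowerSeries.X 0, MvPowerSeries.X 1] : Fin 2 → Series) = MvPowerSeries.X := by
    funext s; fin_cases s <;> rfl
  rw [this, MvPowerSeries.subst_self]; rfl

theorem sub2_X_zero_inX {b : Series}
    (h0 : MvPowerSeries.constantCoeff (MvPowerSeries.X 0 : Series) = 0)
    (hb : MvPowerSeries.constantCoeff b = 0) (p : PowerSeries ℂ) :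
    sub2 (MvPowerSeries.X 0) b h0 hb (inX p) = inX p := by
  rw [inX, PowerSeries.coe_substAlgHom, PowerSeries.subst, sub2_apply,
    MvPowerSeries.subst_comp_subst_apply _ (hasSubst_pair h0 hb)]
  · congr 1
    funext s
    rw [MvPowerSeries.subst_X (hasSubst_pair h0 hb)]
    rfl
  · exact (PowerSeries.HasSubst.X (0 : Fin 2)).const

theorem constantCoeff_inX (p : PowerSeries ℂ) :
    MvPowerSeries.constantCoeff (inX p) = PowerSeries.constantCoeff p := by
  rw [← constantCoeff_xAxis_eval, xAxis_eval_inX]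

theorem inX_C (c : ℂ) : inX (PowerSeries.C c) = MvPowerSeries.C c := inX.commutes c

theorem inX_injective : Function.Injective inX := fun p q h => by
  rw [← xAxis_eval_inX p, h, xAxis_eval_inX]

/-- The graph `y = s (x)`. -/
def graph (s : PowerSeries ℂ) (hs : PowerSeries.constantCoeff s = 0) : Param :=
  ⟨PowerSeries.X, s, by simp, hs⟩

theorem inX_eval_graph (s : PowerSeries ℂ) (hs : PowerSeries.constantCoeff s = 0) (G : Series) :
    inX ((graph s hs).eval G) = sub2 (MvPowerSeries.X 0) (inX s) (by simp)
      (by rw [constantCoeff_inX, hs]) G := by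
  rw [sub2_apply, inX, PowerSeries.coe_substAlgHom, PowerSeries.subst, Param.eval_apply,
    MvPowerSeries.subst_comp_subst_apply (graph s hs).hasSubst]
  · congr 1
    funext t
    fin_cases t
    · change PowerSeries.subst (MvPowerSeries.X 0 : Series) (PowerSeries.X : PowerSeries ℂ) = _
      rw [PowerSeries.subst_X (PowerSeries.HasSubst.X (0 : Fin 2))]
      rfl
    · rfl
  · exact (PowerSeries.HasSubst.X (0 : Fin 2)).const

theorem eval_graph_inX (s : PowerSeries ℂ) (hs : PowerSeries.constantCoeff s = 0)
    (p : PowerSeries ℂ) : (graph s hs).eval (inX p) = p := by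
  have h := inX_eval_graph s hs (inX p)
  rw [sub2_X_zero_inX] at h
  exact inX_injective h

/-- The translation `y ↦ y + s (x)`. -/
def shift (s : PowerSeries ℂ) (hs : PowerSeries.constantCoeff s = 0) : Series →ₐ[ℂ] Series :=
  sub2 (MvPowerSeries.X 0) (MvPowerSeries.X 1 + inX s) (by simp)
    (by simp [constantCoeff_inX, hs])

theorem shift_neg_shift (s : PowerSeries ℂ) (hs : PowerSeries.constantCoeff s = 0)
    (G : Series) : shift (-s) (by simp [hs]) (shift s hs G) = G := by
  rw [shift, shift, sub2_sub2]
  rw [sub2_congr _ _ (a' := MvPowerSeries.X 0) (b' := MvPowerSeries.X 1) (by simp) (by simp)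
    (by simp), sub2_X_X]
  rw [map_add, sub2_X_zero_inX, sub2_X_one, map_neg]; ring

theorem isConvergent_shift {s : PowerSeries ℂ} {hs : PowerSeries.constantCoeff s = 0}
    (hsc : IsConvergent (inX s)) {G : Series} (hG : IsConvergent G) :
    IsConvergent (shift s hs G) :=
  isConvergent_sub2 _ _ (isConvergent_X 0) ((isConvergent_X 1).add hsc) hG

theorem xAxis_eval_shift (s : PowerSeries ℂ) (hs : PowerSeries.constantCoeff s = 0)
    (G : Series) : xAxis.eval (shift s hs G) = (graph s hs).eval G := by
  rw [shift, eval_sub2]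
  congr 2
  ext1
  · exact xAxis.eval_X_zero
  · change xAxis.eval _ = s
    rw [map_add, xAxis_eval_inX, Param.eval_X_one]; exact zero_add s

theorem X_one_dvd_iff {G : Series} : MvPowerSeries.X 1 ∣ G ↔ xAxis.eval G = 0 := by
  have h := X_zero_dvd_iff (G := swap G)
  rw [Param.eval_swap] at h
  change _ ↔ xAxis.eval G = 0 at h
  rw [← h, ← swap_X_one]
  refine ⟨fun h => map_dvd swap h, fun h => ?_⟩
  have := map_dvd swap h
  simpa using this

/-- A series vanishing on a graph is divisible by the equation of the graph. -/
theorem exists_mul_of_eval_graph {s : PowerSeries ℂ} {hs : PowerSeries.constantCoeff s = 0}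
    {G : Series} (h : (graph s hs).eval G = 0) :
    ∃ K, G = (MvPowerSeries.X 1 - inX s) * K ∧
      (IsConvergent (inX s) → IsConvergent G → IsConvergent K) := by
  have h1 : MvPowerSeries.X 1 ∣ shift s hs G := by
    rw [X_one_dvd_iff, xAxis_eval_shift, h]
  obtain ⟨L, hL⟩ := h1
  refine ⟨shift (-s) (by simp [hs]) L, ?_, fun hsc hG => ?_⟩
  · have h2 := shift_neg_shift s hs G
    rw [hL, map_mul] at h2
    rw [← h2]
    congr 1
    rw [shift, sub2_X_one, map_neg, sub_eq_add_neg]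
  · refine isConvergent_shift (by rw [map_neg]; exact hsc.neg) ?_
    refine IsConvergent.of_X_pow_mul (e := 1) (N := 1) ?_
    rw [pow_one, ← hL]
    exact isConvergent_shift hsc hG

/-! ### Convergence of solutions of analytic equations -/

theorem nrm_X_zero_le (r : ℝ≥0) : nrm r (MvPowerSeries.X 0) ≤ r := by
  classical
  rw [nrm, tsum_eq_single (Finsupp.single 0 1)]
  · simp
  · intro α hα
    rw [MvPowerSeries.coeff_X, if_neg hα]; simp

theorem constantCoeff_trunc_zero {z : PowerSeries ℂ} (hz : PowerSeries.constantCoeff z = 0)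
    (N : ℕ) : PowerSeries.constantCoeff (PowerSeries.trunc N z : PowerSeries ℂ) = 0 := by
  rw [← PowerSeries.coeff_zero_eq_constantCoeff_apply, Polynomial.coeff_coe,
    PowerSeries.coeff_trunc]
  split_ifs
  · simpa using hz
  · rfl

/-- A majorant argument on truncations: the coefficients of z up to degree N are those of x G(x, T),
where T is the truncation of z to degrees below N. So a bound on the norm of T propagates to the
next truncation, and all partial sums of the norm of z stay below ρ. -/
theorem isConvergent_of_eq_X_mul {G : Series} (hG : IsConvergent G) {z : PowerSeries ℂ}
    (hz : PowerSeries.constantCoeff z = 0)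
    (h : z = PowerSeries.X * (graph z hz).eval G) : IsConvergent (inX z) := by
  obtain ⟨ρ, hρ, hfin⟩ := isConvergent_iff.1 hG
  lift nrm ρ G to ℝ≥0 using hfin with C hC
  -- With C the norm of G at radius ρ, this choice gives r C ≤ ρ and r ≤ ρ, so the bound ρ is
  -- preserved by z ↦ x G(x, z).
  let r : ℝ≥0 := ρ / (C + 1 + ρ)
  have hCC : 0 < C + 1 + ρ := by positivity
  have hr : 0 < r := by positivity
  have hr1 : r * C ≤ ρ := by
    rw [div_mul_eq_mul_div, div_le_iff₀ hCC]
    refine mul_le_mul_right ?_ _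
    rw [add_assoc]; exact le_self_add
  have hr2 : r ≤ ρ := by
    refine div_le_self zero_le ?_
    rw [add_right_comm]; exact le_add_self
  let T : ℕ → PowerSeries ℂ := fun N => (PowerSeries.trunc N z : PowerSeries ℂ)
  have hT0 : ∀ N, PowerSeries.constantCoeff (T N) = 0 := constantCoeff_trunc_zero hz
  have hTc : ∀ N j, PowerSeries.coeff j (T N) = if j < N then PowerSeries.coeff j z else 0 := by
    intro N j
    rw [Polynomial.coeff_coe, PowerSeries.coeff_trunc]
  -- The difference of the two values of G is divisible by z - T N, hence by x^N.
  have hmod : ∀ N, PowerSeries.X ^ N ∣ (graph z hz).eval G - (graph (T N) (hT0 N)).eval G := by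
    intro N
    obtain ⟨L, hL, -⟩ := exists_mul_of_eval_graph (s := T N) (hs := hT0 N)
      (G := G - inX ((graph (T N) (hT0 N)).eval G)) (by
        rw [map_sub, eval_graph_inX, sub_self])
    have h1 := congrArg (graph z hz).eval hL
    rw [map_sub, eval_graph_inX, map_mul, map_sub, eval_graph_inX, Param.eval_X_one] at h1
    rw [h1]
    refine dvd_mul_of_dvd_left ?_ _
    rw [PowerSeries.X_pow_dvd_iff]
    intro m hm
    change PowerSeries.coeff m (z - T N) = 0
    rw [map_sub, hTc, if_pos hm, sub_self]
  have hbound : ∀ N, nrm r (inX (T N)) ≤ ρ := by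
    intro N
    induction N with
    | zero =>
      have : T 0 = 0 := by ext j; rw [hTc]; simp
      rw [this, map_zero, nrm]; simp
    | succ N ih =>
      have h1 : nrm r (inX (T (N + 1))) ≤
          nrm r (MvPowerSeries.X 0 * inX ((graph (T N) (hT0 N)).eval G)) := by
        refine ENNReal.tsum_le_tsum fun α => ?_
        norm_cast
        refine mul_le_mul_left ?_ _
        rw [eq_mon α, coeff_inX, ← inX_X, ← map_mul, coeff_inX]
        by_cases h1 : α 1 = 0
        · rw [if_pos h1, if_pos h1, hTc]
          by_cases h0 : α 0 < N + 1
          · rw [if_pos h0]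
            refine le_of_eq ?_
            congr 1
            rw [h]
            cases hα : α 0 with
            | zero => simp
            | succ j =>
              rw [PowerSeries.coeff_succ_X_mul, PowerSeries.coeff_succ_X_mul]
              have := PowerSeries.X_pow_dvd_iff.1 (hmod N) j (by omega)
              rw [map_sub, sub_eq_zero] at this
              exact this
          · rw [if_neg h0]; simp
        · rw [if_neg h1, if_neg h1]
      refine h1.trans ((nrm_mul_le _ _ _).trans ?_)
      have h2 : nrm r (inX ((graph (T N) (hT0 N)).eval G)) ≤ C := by
        rw [inX_eval_graph, sub2_apply, hC]
        refine nrm_subst_le_nrm (hasSubst_pair (by simp)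
          (by rw [constantCoeff_inX, hT0])) ?_ ih G
        exact (nrm_X_zero_le r).trans (by exact_mod_cast hr2)
      refine (mul_le_mul' (nrm_X_zero_le r) h2).trans ?_
      exact_mod_cast hr1
  refine isConvergent_iff.2 ⟨r, hr, ne_top_of_le_ne_top (ENNReal.coe_ne_top (r := ρ)) ?_⟩
  rw [nrm, ENNReal.tsum_eq_iSup_sum]
  refine iSup_le fun s => ?_
  obtain ⟨N, hN⟩ : ∃ N, ∀ α ∈ s, α 0 < N :=
    ⟨s.sup (fun α => α 0) + 1, fun α hα =>
      Nat.lt_succ_of_le (Finset.le_sup (f := fun α : Fin 2 →₀ ℕ => α 0) hα)⟩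
  refine le_trans (le_of_eq ?_) ((ENNReal.sum_le_tsum s).trans (hbound N))
  refine Finset.sum_congr rfl fun α hα => ?_
  congr 3
  rw [eq_mon α, coeff_inX, coeff_inX, hTc, if_pos (hN α hα)]

theorem pderiv_one_inX (p : PowerSeries ℂ) : MvPowerSeries.pderiv ℂ 1 (inX p) = 0 := by
  refine series_ext fun a b => ?_
  have : mon a b + Finsupp.single 1 1 = mon a (b + 1) := by
    ext i; fin_cases i <;> simp
  rw [MvPowerSeries.coeff_pderiv, this, coeff_inX, if_neg (by omega), map_zero, zero_mul]

/-- Lowering the multiplicity of a smooth factor by differentiation. -/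
theorem exists_simple_of_pow {z : PowerSeries ℂ} (e : ℕ)
    {u : ℂ} (hu : u ≠ 0) {U : Series}
    (h : IsConvergent ((MvPowerSeries.X 1 - inX z) ^ (e + 1) *
      (MvPowerSeries.C u + MvPowerSeries.X 0 * U))) :
    ∃ (u' : ℂ) (U' : Series), u' ≠ 0 ∧ IsConvergent ((MvPowerSeries.X 1 - inX z) *
      (MvPowerSeries.C u' + MvPowerSeries.X 0 * U')) := by
  induction e generalizing u U with
  | zero => exact ⟨u, U, hu, by simpa using h⟩
  | succ e ih =>
    have h1 := h.pderiv_one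
    refine ih (u := (e + 2 : ℕ) * u) (mul_ne_zero
      (Nat.cast_ne_zero.2 (Nat.succ_ne_zero (e + 1))) hu)
      (U := ((e + 2 : ℕ) : Series) * U + (MvPowerSeries.X 1 - inX z) *
        MvPowerSeries.pderiv ℂ 1 U) ?_
    convert h1 using 1
    have hX : MvPowerSeries.pderiv ℂ 1 (MvPowerSeries.X 1 : Series) = 1 :=
      MvPowerSeries.pderiv_X_self
    have hX0 : MvPowerSeries.pderiv ℂ 1 (MvPowerSeries.X 0 : Series) = 0 :=
      MvPowerSeries.pderiv_X_of_ne (by decide)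
    rw [Derivation.leibniz, Derivation.leibniz_pow, map_sub, hX, pderiv_one_inX, map_add,
      MvPowerSeries.pderiv_C, Derivation.leibniz, hX0, map_mul]
    simp only [smul_eq_mul, nsmul_eq_mul, map_natCast]
    rw [show e + 1 + 1 - 1 = e + 1 by omega]
    push_cast
    ring

/-- Subtracting u⁻¹ times the convergent series (y - z)(u + x U) from y leaves a series divisible by
x. On y = z this reads z = x Φ(x, z) with Φ convergent, the situation of `isConvergent_of_eq_X_mul`.
-/
theorem isConvergent_of_simple {z : PowerSeries ℂ} (hz : PowerSeries.constantCoeff z = 0)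
    {u : ℂ} (hu : u ≠ 0) {U : Series} (h : IsConvergent ((MvPowerSeries.X 1 - inX z) *
      (MvPowerSeries.C u + MvPowerSeries.X 0 * U))) : IsConvergent (inX z) := by
  obtain ⟨z1, hz1⟩ := PowerSeries.X_dvd_iff.2 hz
  have hC : (MvPowerSeries.C u⁻¹ * MvPowerSeries.C u : Series) = 1 := by
    rw [← map_mul, inv_mul_cancel₀ hu, map_one]
  have hΨ : MvPowerSeries.X 1 - MvPowerSeries.C u⁻¹ * ((MvPowerSeries.X 1 - inX z) *
      (MvPowerSeries.C u + MvPowerSeries.X 0 * U)) =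
      MvPowerSeries.X 0 * (inX z1 - MvPowerSeries.C u⁻¹ * ((MvPowerSeries.X 1 - inX z) * U)) := by
    have hz2 : inX z = MvPowerSeries.X 0 * inX z1 := by rw [hz1, map_mul, inX_X]
    linear_combination (-(MvPowerSeries.X 1 - inX z) : Series) * hC + hz2
  have hconv : IsConvergent
      (inX z1 - MvPowerSeries.C u⁻¹ * ((MvPowerSeries.X 1 - inX z) * U)) := by
    refine IsConvergent.of_X_pow_mul (e := 0) (N := 1) ?_
    rw [pow_one, ← hΨ]
    exact (isConvergent_X 1).sub ((isConvergent_C _).mul h)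
  refine isConvergent_of_eq_X_mul hconv hz ?_
  have := congrArg (graph z hz).eval hΨ
  simp only [map_sub, map_mul, eval_graph_inX, Param.eval_X_one, Param.eval_X_zero] at this
  simp only [map_sub, map_mul, eval_graph_inX, Param.eval_X_one]
  simpa [graph] using this

theorem exists_eq_X_pow_mul {G : Series} (hG : G ≠ 0) :
    ∃ e K, G = MvPowerSeries.X 1 ^ e * K ∧ xAxis.eval K ≠ 0 := by
  have hex : ∃ N, ¬ MvPowerSeries.X 1 ^ N ∣ G := by
    by_contra h
    push Not at h
    exact hG (eq_zero_of_X_pow_dvd h)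
  classical
  have hpos : Nat.find hex ≠ 0 := by
    intro h0
    have := Nat.find_spec hex
    rw [h0, pow_zero] at this
    exact this (one_dvd _)
  obtain ⟨e, he⟩ := Nat.exists_eq_succ_of_ne_zero hpos
  have h1 := Nat.find_min hex (m := e) (by omega)
  rw [not_not] at h1
  obtain ⟨K, hK⟩ := h1
  refine ⟨e, K, hK, fun h => ?_⟩
  obtain ⟨L, hL⟩ := X_one_dvd_iff.2 h
  have h2 := Nat.find_spec hex
  rw [he] at h2
  exact h2 ⟨L, by rw [hK, hL, Nat.succ_eq_add_one, pow_succ]; ring⟩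

theorem isConvergent_inX_sum (p : PowerSeries ℂ) (N : ℕ) : IsConvergent (inX
    (∑ j ∈ Finset.range N, PowerSeries.C (PowerSeries.coeff j p) * PowerSeries.X ^ j)) := by
  rw [map_sum]
  refine ConvergentSeries.sum_mem fun j _ => ?_
  rw [map_mul, map_pow, inX_X, inX_C]
  exact (isConvergent_C _).mul ((isConvergent_X 0).pow j)

theorem xAxis_exists_eq_inX_add (G : Series) :
    ∃ K, G = inX (xAxis.eval G) + MvPowerSeries.X 1 * K := by
  have : MvPowerSeries.X 1 ∣ G - inX (xAxis.eval G) := by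
    rw [X_one_dvd_iff, map_sub, xAxis_eval_inX, sub_self]
  obtain ⟨K, hK⟩ := this
  exact ⟨K, by rw [← hK]; ring⟩

/-- A formal root of a convergent series is convergent. -/
theorem isConvergent_of_eval_graph {g : Series} (hg : IsConvergent g) (hg0 : g ≠ 0)
    {s : PowerSeries ℂ} (hs : PowerSeries.constantCoeff s = 0) (h : (graph s hs).eval g = 0) :
    IsConvergent (inX s) := by
  have hsh : shift s hs g ≠ 0 := by
    intro h0
    have := shift_neg_shift s hs g
    rw [h0, map_zero] at this
    exact hg0 this.symm
  -- Here e is the multiplicity of the root s of g; μ below is the order in x of the remaining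
  -- factor along that root.
  obtain ⟨e, K, hK, hK0⟩ := exists_eq_X_pow_mul hsh
  have he : e ≠ 0 := by
    rintro rfl
    rw [pow_zero, one_mul] at hK
    rw [← hK, xAxis_eval_shift, h] at hK0
    exact hK0 rfl
  obtain ⟨e, rfl⟩ := Nat.exists_eq_add_one_of_ne_zero he
  obtain ⟨R, hR⟩ := xAxis_exists_eq_inX_add K
  obtain ⟨ε, hε, hε0⟩ := exists_eq_X_pow_mul_of_order (order_eq_coe hK0)
  set μ := (xAxis.eval K).order.toNat
  -- Substituting y = T + x^(μ+1) Y, with T a polynomial truncation of s, moves the remaining factor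
  -- to x^μ times a nonzero constant modulo x, which is the form required by `exists_simple_of_pow`.
  -- The truncation goes one degree further than the power of x taken out, so that z has no constant
  -- term.
  obtain ⟨T, z, hTconv, hz, hsz⟩ : ∃ T z : PowerSeries ℂ, IsConvergent (inX T) ∧
      PowerSeries.constantCoeff z = 0 ∧ s = T + PowerSeries.X ^ (μ + 1) * z := by
    obtain ⟨k, hk⟩ := powerSeries_eq_sum_add s (μ + 2)
    refine ⟨_, PowerSeries.X * k, isConvergent_inX_sum s (μ + 2), by simp, ?_⟩
    nth_rw 1 [hk]
    ring
  have hT0 : PowerSeries.constantCoeff T = 0 := by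
    have := congrArg PowerSeries.constantCoeff hsz
    simpa [hs] using this.symm
  have h1 : sub2 (MvPowerSeries.X 0) (inX T + MvPowerSeries.X 0 ^ (μ + 1) * MvPowerSeries.X 1)
      (by simp) (by simp [constantCoeff_inX, hT0]) g =
      sub2 (MvPowerSeries.X 0) (MvPowerSeries.X 0 ^ (μ + 1) * (MvPowerSeries.X 1 - inX z))
      (by simp) (by simp) (shift s hs g) := by
    rw [shift, sub2_sub2]
    refine sub2_congr _ _ _ _ (by simp) ?_ g
    rw [map_add, sub2_X_zero_inX, sub2_X_one, hsz, map_add, map_mul, map_pow, inX_X]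
    ring
  have h2 : IsConvergent (sub2 (MvPowerSeries.X 0)
      (inX T + MvPowerSeries.X 0 ^ (μ + 1) * MvPowerSeries.X 1)
      (by simp) (by simp [constantCoeff_inX, hT0]) g) :=
    isConvergent_sub2 _ _ (isConvergent_X 0)
      (hTconv.add (((isConvergent_X 0).pow _).mul (isConvergent_X 1))) hg
  obtain ⟨ε1, hε1⟩ : ∃ ε1, ε = PowerSeries.C (PowerSeries.constantCoeff ε) +
      PowerSeries.X * ε1 := by
    obtain ⟨ε1, h⟩ : PowerSeries.X ∣ ε - PowerSeries.C (PowerSeries.constantCoeff ε) := by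
      rw [PowerSeries.X_dvd_iff]; simp
    exact ⟨ε1, by rw [← h]; ring⟩
  obtain ⟨R', hR'⟩ : ∃ R', sub2 (MvPowerSeries.X 0)
    (MvPowerSeries.X 0 ^ (μ + 1) * (MvPowerSeries.X 1 - inX z)) (by simp) (by simp) R = R' :=
    ⟨_, rfl⟩
  have h3 : sub2 (MvPowerSeries.X 0)
      (inX T + MvPowerSeries.X 0 ^ (μ + 1) * MvPowerSeries.X 1)
      (by simp) (by simp [constantCoeff_inX, hT0]) g =
      MvPowerSeries.X 0 ^ ((μ + 1) * (e + 1) + μ) * ((MvPowerSeries.X 1 - inX z) ^ (e + 1) *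
        (MvPowerSeries.C (PowerSeries.constantCoeff ε) + MvPowerSeries.X 0 *
          (inX ε1 + (MvPowerSeries.X 1 - inX z) * R'))) := by
    rw [h1, hK, hR, map_mul, map_pow, sub2_X_one, map_add, sub2_X_zero_inX, map_mul, sub2_X_one,
      hε, map_mul, map_pow, inX_X, hR']
    have h4 : inX ε = MvPowerSeries.C (PowerSeries.constantCoeff ε) +
        MvPowerSeries.X 0 * inX ε1 := by
      rw [← inX_C, ← inX_X, ← map_mul, ← map_add, ← hε1]
    rw [h4]
    generalize (MvPowerSeries.X 1 - inX z : Series) = Y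
    ring
  rw [h3] at h2
  obtain ⟨u, U, hu, hU⟩ := exists_simple_of_pow e hε0 (h2.of_X_pow_mul)
  have hzc := isConvergent_of_simple hz hu hU
  rw [hsz, map_add, map_mul, map_pow, inX_X]
  exact hTconv.add (((isConvergent_X 0).pow _).mul hzc)

end PlaneCurve

end

noncomputable section

namespace PlaneCurve

/-! ### Equations of Puiseux series -/

theorem monomial_prod_ramify (n p q : ℕ) :
    (mon p q).prod (fun s e => (![MvPowerSeries.X 0 ^ n, MvPowerSeries.X 1] s : Series) ^ e) =
      MvPowerSeries.monomial (mon (n * p) q) 1 := by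
  rw [Finsupp.prod_fintype _ _ (by simp), Fin.prod_univ_two]
  simp only [mon_zero, mon_one, Matrix.cons_val_zero, Matrix.cons_val_one]
  rw [← pow_mul, MvPowerSeries.X_pow_eq, MvPowerSeries.X_pow_eq, MvPowerSeries.monomial_mul_monomial,
    one_mul]
  rfl

/-- The base change `x ↦ x ^ n`. -/
def ramify (n : ℕ) (hn : 0 < n) : Series →ₐ[ℂ] Series :=
  sub2 (MvPowerSeries.X 0 ^ n) (MvPowerSeries.X 1) (by simp [hn.ne']) (by simp)

section
variable {n : ℕ} (hn : 0 < n)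

theorem coeff_ramify (G : Series) (a b : ℕ) :
    MvPowerSeries.coeff (mon a b) (ramify n hn G) =
      if n ∣ a then MvPowerSeries.coeff (mon (a / n) b) G else 0 := by
  classical
  have key : ∀ d : Fin 2 →₀ ℕ, MvPowerSeries.coeff d G • MvPowerSeries.coeff (mon a b)
      (d.prod fun s e => (![MvPowerSeries.X 0 ^ n, MvPowerSeries.X 1] s : Series) ^ e) =
      if a = n * d 0 ∧ b = d 1 then MvPowerSeries.coeff d G else 0 := by
    intro d
    conv_lhs => rw [eq_mon d, monomial_prod_ramify, MvPowerSeries.coeff_monomial, ← eq_mon d]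
    simp only [mon_inj]
    split_ifs <;> simp
  rw [ramify, sub2_apply, MvPowerSeries.coeff_subst (hasSubst_pair (by simp [hn.ne']) (by simp))]
  simp only [key]
  split_ifs with h
  · obtain ⟨a, rfl⟩ := h
    rw [Nat.mul_div_cancel_left _ hn, finsum_eq_single _ (mon a b)]
    · simp
    · intro d hd
      rw [if_neg]
      rintro ⟨h1, h2⟩
      apply hd
      rw [eq_mon d, ← h2, Nat.eq_of_mul_eq_mul_left hn h1]
  · rw [finsum_eq_zero_of_forall_eq_zero]
    intro d
    rw [if_neg]
    rintro ⟨h1, -⟩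
    exact h ⟨_, h1⟩

theorem ramify_injective : Function.Injective (ramify n hn) := fun G H h => by
  refine series_ext fun a b => ?_
  have := congrArg (MvPowerSeries.coeff (mon (n * a) b)) h
  rw [coeff_ramify, coeff_ramify, if_pos (dvd_mul_right _ _), if_pos (dvd_mul_right _ _),
    Nat.mul_div_cancel_left _ hn] at this
  exact this

theorem exists_ramify_eq {Q : Series}
    (h : ∀ a b, ¬ n ∣ a → MvPowerSeries.coeff (mon a b) Q = 0) :
    ∃ G, ramify n hn G = Q ∧ (IsConvergent Q → IsConvergent G) := by
  refine ⟨(fun α => MvPowerSeries.coeff (mon (n * α 0) (α 1)) Q : Series), series_ext fun a b => ?_,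
    fun hQ => ?_⟩
  · refine (coeff_ramify hn _ a b).trans ?_
    split_ifs with hd
    · change MvPowerSeries.coeff (mon (n * (mon (a / n) b) 0) ((mon (a / n) b) 1)) Q = _
      rw [mon_zero, mon_one, Nat.mul_div_cancel' hd]
    · exact (h a b hd).symm
  · refine hQ.of_coeff (fun α => mon (n * α 0) (α 1)) (fun α β hαβ => ?_) (fun α => rfl) n 0
      fun α => ?_
    · obtain ⟨h1, h2⟩ := mon_inj.1 hαβ
      rw [eq_mon α, eq_mon β, h2, Nat.eq_of_mul_eq_mul_left hn h1]
    · have : α.degree = α 0 + α 1 := by conv_lhs => rw [eq_mon α, mon_degree]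
      rw [mon_degree, this]
      nlinarith

theorem isConvergent_ramify {G : Series} (hG : IsConvergent G) :
    IsConvergent (ramify n hn G) :=
  isConvergent_sub2 _ _ ((isConvergent_X 0).pow n) (isConvergent_X 1) hG

theorem yAxis_eval_ramify (G : Series) : yAxis.eval (ramify n hn G) = yAxis.eval G := by
  rw [ramify, eval_sub2]
  congr 2
  ext1
  · change yAxis.eval (MvPowerSeries.X 0 ^ n) = 0
    rw [map_pow, Param.eval_X_zero]; exact zero_pow hn.ne'
  · exact yAxis.eval_X_one
end

/-- The automorphism `x ↦ ζ x`. -/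
def rot (ζ : ℂ) : Series →+* Series := MvPowerSeries.rescale ![ζ, 1]

theorem coeff_rot (ζ : ℂ) (G : Series) (a b : ℕ) :
    MvPowerSeries.coeff (mon a b) (rot ζ G) = ζ ^ a * MvPowerSeries.coeff (mon a b) G := by
  rw [rot, MvPowerSeries.coeff_rescale, Finsupp.prod_fintype _ _ (by simp), Fin.prod_univ_two]
  simp

theorem rot_inX (ζ : ℂ) (p : PowerSeries ℂ) :
    rot ζ (inX p) = inX (PowerSeries.rescale ζ p) := by
  refine series_ext fun a b => ?_
  rw [coeff_rot, coeff_inX, coeff_inX, PowerSeries.coeff_rescale]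
  split_ifs <;> simp

theorem rot_X_one (ζ : ℂ) : rot ζ (MvPowerSeries.X 1) = MvPowerSeries.X 1 := by
  refine series_ext fun a b => ?_
  rw [coeff_rot]
  cases b with
  | zero =>
    have := coeff_X_one_mul_zero 1 a
    rw [mul_one] at this
    rw [this, mul_zero]
  | succ b =>
    have := coeff_X_one_mul 1 a b
    rw [mul_one] at this
    rw [this, eq_comm, MvPowerSeries.coeff_one]
    split_ifs with h
    · have : a = 0 := by simpa using DFunLike.congr_fun h 0
      rw [this]; simp
    · simp

theorem rot_ramify {n : ℕ} (hn : 0 < n) {ζ : ℂ} (hζ : ζ ^ n = 1) (G : Series) :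
    rot ζ (ramify n hn G) = ramify n hn G := by
  refine series_ext fun a b => ?_
  rw [coeff_rot, coeff_ramify]
  split_ifs with h
  · obtain ⟨a, rfl⟩ := h
    rw [pow_mul, hζ, one_pow, one_mul]
  · rw [mul_zero]

/-- Division by several distinct graphs. -/
theorem exists_mul_of_eval_graphs (s : ℕ → PowerSeries ℂ)
    (hs : ∀ i, PowerSeries.constantCoeff (s i) = 0) (N : ℕ)
    (hd : ∀ i j, i < j → j < N → s i ≠ s j) {G : Series}
    (h : ∀ i < N, (graph (s i) (hs i)).eval G = 0) :
    ∃ Q, G = (∏ i ∈ Finset.range N, (MvPowerSeries.X 1 - inX (s i))) * Q ∧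
      ((∀ i, IsConvergent (inX (s i))) → IsConvergent G → IsConvergent Q) := by
  induction N with
  | zero => exact ⟨G, by simp, fun _ h => h⟩
  | succ N ih =>
    obtain ⟨Q, hQ, hc⟩ := ih (fun i j hij hj => hd i j hij (by omega))
      (fun i hi => h i (by omega))
    have h1 := h N (by omega)
    rw [hQ, map_mul, map_prod, mul_eq_zero, Finset.prod_eq_zero_iff] at h1
    rcases h1 with ⟨i, hi, h1⟩ | h1
    · rw [map_sub, Param.eval_X_one, eval_graph_inX, sub_eq_zero] at h1
      exact absurd h1.symm (hd i N (Finset.mem_range.1 hi) (by omega))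
    · obtain ⟨K, hK, hKc⟩ := exists_mul_of_eval_graph h1
      refine ⟨K, ?_, fun h2 h3 => hKc (h2 N) (hc h2 h3)⟩
      rw [Finset.prod_range_succ, mul_assoc, ← hK, ← hQ]

/-- The parametrization `x = t ^ ν`, `y = S`. -/
def PuiseuxSeries.param (S : PuiseuxSeries) : Param :=
  ⟨PowerSeries.X ^ S.ν, S.ser, by simp [S.ν_pos.ne'], S.constantCoeff_ser⟩

theorem PuiseuxSeries.isRoot_iff (S : PuiseuxSeries) (G : Series) :
    S.IsRoot G ↔ S.param.eval G = 0 := by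
  rw [Param.eval_apply]; rfl

theorem PuiseuxSeries.eval_eq (S : PuiseuxSeries) (G : Series) :
    S.param.eval G = (graph S.ser S.constantCoeff_ser).eval (ramify S.ν S.ν_pos G) := by
  rw [ramify, eval_sub2]
  congr 2
  ext1
  · change _ = (graph S.ser _).eval (MvPowerSeries.X 0 ^ S.ν)
    rw [map_pow, Param.eval_X_zero]; rfl
  · change _ = (graph S.ser _).eval (MvPowerSeries.X 1)
    rw [Param.eval_X_one]; rfl

/-- The conjugates of a Puiseux series. -/
def PuiseuxSeries.conj (S : PuiseuxSeries) (i : ℕ) : PowerSeries ℂ :=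
  PowerSeries.rescale (Complex.exp (2 * Real.pi * Complex.I / S.ν) ^ i) S.ser

theorem PuiseuxSeries.conj_zero (S : PuiseuxSeries) : S.conj 0 = S.ser := by
  rw [conj, pow_zero, PowerSeries.rescale_one]; rfl

theorem PuiseuxSeries.constantCoeff_conj (S : PuiseuxSeries) (i : ℕ) :
    PowerSeries.constantCoeff (S.conj i) = 0 := by
  rw [conj, ← PowerSeries.coeff_zero_eq_constantCoeff_apply, PowerSeries.coeff_rescale,
    PowerSeries.coeff_zero_eq_constantCoeff_apply, S.constantCoeff_ser, mul_zero]

theorem PuiseuxSeries.isPrimitiveRoot (S : PuiseuxSeries) :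
    IsPrimitiveRoot (Complex.exp (2 * Real.pi * Complex.I / S.ν)) S.ν :=
  Complex.isPrimitiveRoot_exp _ S.ν_pos.ne'

/-- If two conjugates agree, every exponent k of S satisfies ν ∣ (j - i) k, hence is a multiple of ν
/ gcd(ν, j - i). As S is reduced, this number is 1, so ν ∣ j - i. -/
theorem PuiseuxSeries.conj_ne (S : PuiseuxSeries) {i j : ℕ} (hij : i < j) (hj : j < S.ν) :
    S.conj i ≠ S.conj j := by
  intro h
  have hζ := S.isPrimitiveRoot
  set ζ := Complex.exp (2 * Real.pi * Complex.I / S.ν)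
  have hζ0 : ζ ≠ 0 := hζ.ne_zero S.ν_pos.ne'
  have h1 : ∀ k, PowerSeries.coeff k S.ser ≠ 0 → S.ν ∣ (j - i) * k := by
    intro k hk
    have h2 := congrArg (PowerSeries.coeff k) h
    rw [conj, conj, PowerSeries.coeff_rescale, PowerSeries.coeff_rescale] at h2
    have h3 := mul_right_cancel₀ hk h2
    change (ζ ^ i) ^ k = (ζ ^ j) ^ k at h3
    rw [← hζ.pow_eq_one_iff_dvd, pow_mul]
    rw [show j = i + (j - i) by omega, pow_add, mul_pow] at h3
    exact (mul_left_cancel₀ (pow_ne_zero k (pow_ne_zero i hζ0)) (by rw [← h3, mul_one])).symm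
  set c := Nat.gcd S.ν (j - i)
  have hc : 0 < c := Nat.gcd_pos_of_pos_left _ S.ν_pos
  have h2 := S.reduced (S.ν / c) (Nat.div_dvd_of_dvd (Nat.gcd_dvd_left _ _)) fun k hk => by
    have h3 := h1 k hk
    have hcop : Nat.Coprime (S.ν / c) ((j - i) / c) := Nat.coprime_div_gcd_div_gcd hc
    refine hcop.dvd_of_dvd_mul_left ?_
    rw [← Nat.mul_div_right_comm (Nat.gcd_dvd_right _ _)]
    exact Nat.div_dvd_div (Nat.gcd_dvd_left _ _) h3
  have h3 : S.ν = c := by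
    have := Nat.div_mul_cancel (Nat.gcd_dvd_left S.ν (j - i))
    change S.ν / c * c = S.ν at this
    rw [h2, one_mul] at this
    exact this.symm
  have h4 : S.ν ∣ j - i := by
    rw [h3]; exact Nat.gcd_dvd_right _ _
  have := Nat.le_of_dvd (by omega) h4
  omega

theorem isConvergent_rescale {p : PowerSeries ℂ} {ζ : ℂ} (hζ : ‖ζ‖ = 1)
    (h : IsConvergent (inX p)) : IsConvergent (inX (PowerSeries.rescale ζ p)) := by
  obtain ⟨r, hr, hs⟩ := h
  refine ⟨r, hr, ?_⟩
  convert hs using 3 with α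
  rw [eq_mon α, ← rot_inX, coeff_rot, norm_mul, norm_pow, hζ, one_pow, one_mul]

theorem PuiseuxSeries.isConvergent_conj {S : PuiseuxSeries} (h : IsConvergent (inX S.ser))
    (i : ℕ) : IsConvergent (inX (S.conj i)) := by
  refine isConvergent_rescale ?_ h
  rw [norm_pow, S.isPrimitiveRoot.norm'_eq_one S.ν_pos.ne', one_pow]

/-- The minimal polynomial of a Puiseux series. -/
theorem PuiseuxSeries.exists_isEquation (S : PuiseuxSeries) :
    ∃ f₁, IsEquation f₁ S.param ∧ (yAxis.eval f₁).order = S.ν ∧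
      (IsConvergent (inX S.ser) → IsConvergent f₁ ∧
        ∀ H, IsConvergent H → S.param.eval H = 0 → ∃ h, IsConvergent h ∧ H = f₁ * h) := by
  have hζ := S.isPrimitiveRoot
  set ζ := Complex.exp (2 * Real.pi * Complex.I / S.ν) with hζdef
  set P : Series := ∏ i ∈ Finset.range S.ν, (MvPowerSeries.X 1 - inX (S.conj i)) with hP
  have hrotX : ∀ i, rot ζ (MvPowerSeries.X 1 - inX (S.conj i)) =
      MvPowerSeries.X 1 - inX (S.conj (i + 1)) := by
    intro i
    rw [map_sub, rot_X_one, rot_inX, conj, conj, ← hζdef, PowerSeries.rescale_rescale, ← pow_succ]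
  have hlast : S.conj S.ν = S.conj 0 := by
    rw [conj, conj, ← hζdef, hζ.pow_eq_one, pow_zero]
  -- The rotation permutes the conjugates cyclically. An invariant series involves only powers of
  -- x^ν, so P is the base change of a series f₁.
  have hrotP : rot ζ P = P := by
    rw [hP, map_prod]
    simp only [hrotX]
    obtain ⟨n', hn'⟩ := Nat.exists_eq_add_one_of_ne_zero S.ν_pos.ne'
    rw [hn', Finset.prod_range_succ, Finset.prod_range_succ', ← hn', hlast]
  have hrot_ne : ∀ i, (MvPowerSeries.X 1 - inX (S.conj i) : Series) ≠ 0 := by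
    intro i h0
    have := congrArg yAxis.eval h0
    rw [map_sub, Param.eval_X_one, yAxis_eval_inX, S.constantCoeff_conj, map_zero, sub_zero,
      map_zero] at this
    exact PowerSeries.X_ne_zero this
  have hP0 : P ≠ 0 := Finset.prod_ne_zero_iff.2 fun i _ => hrot_ne i
  have hsupp : ∀ Q, rot ζ Q = Q → ∀ a b, ¬ S.ν ∣ a → MvPowerSeries.coeff (mon a b) Q = 0 := by
    intro Q hQ a b ha
    have h1 := congrArg (MvPowerSeries.coeff (mon a b)) hQ
    rw [coeff_rot] at h1
    by_contra h0
    exact ha ((hζ.pow_eq_one_iff_dvd a).1 (mul_right_cancel₀ h0 (by rw [h1, one_mul])))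
  obtain ⟨f₁, hf₁, hf₁c⟩ := exists_ramify_eq S.ν_pos (hsupp P hrotP)
  have hPS : (graph S.ser S.constantCoeff_ser).eval P = 0 := by
    rw [hP, map_prod]
    refine Finset.prod_eq_zero (Finset.mem_range.2 S.ν_pos) ?_
    rw [map_sub, Param.eval_X_one, eval_graph_inX, S.conj_zero]
    exact sub_self _
  -- After base change, H vanishes on one conjugate, hence by invariance on all of them; they are
  -- distinct, so P divides H. The quotient is again invariant and descends.
  have hdiv : ∀ H, S.param.eval H = 0 → ∃ h, H = f₁ * h ∧
      (IsConvergent (inX S.ser) → IsConvergent H → IsConvergent h) := by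
    intro H hH
    rw [S.eval_eq] at hH
    have hroots : ∀ i, ∃ K, ramify S.ν S.ν_pos H = (MvPowerSeries.X 1 - inX (S.conj i)) * K := by
      intro i
      induction i with
      | zero =>
        obtain ⟨K, hK, -⟩ := exists_mul_of_eval_graph hH
        exact ⟨K, by rw [S.conj_zero]; exact hK⟩
      | succ i ih =>
        obtain ⟨K, hK⟩ := ih
        refine ⟨rot ζ K, ?_⟩
        rw [← hrotX, ← map_mul, ← hK, rot_ramify _ hζ.pow_eq_one]
    obtain ⟨Q, hQ, hQc⟩ := exists_mul_of_eval_graphs S.conj S.constantCoeff_conj S.ν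
      (fun i j hij hj => S.conj_ne hij hj) (G := ramify S.ν S.ν_pos H) (fun i _ => by
        obtain ⟨K, hK⟩ := hroots i
        rw [hK, map_mul, map_sub, Param.eval_X_one, eval_graph_inX]
        change (S.conj i - S.conj i) * _ = 0
        rw [sub_self, zero_mul])
    have hrotQ : rot ζ Q = Q := by
      refine mul_left_cancel₀ hP0 ?_
      rw [← hQ]
      conv_lhs => rw [← hrotP]
      rw [← map_mul, ← hQ, rot_ramify _ hζ.pow_eq_one]
    obtain ⟨h, hh, hhc⟩ := exists_ramify_eq S.ν_pos (hsupp Q hrotQ)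
    refine ⟨h, ramify_injective S.ν_pos ?_, fun hS hHc =>
      hhc (hQc (fun i => S.isConvergent_conj hS i) (isConvergent_ramify _ hHc))⟩
    rw [map_mul, hf₁, hh, hQ]
  refine ⟨f₁, ⟨fun h0 => ?_, ?_, fun H hH => ?_⟩, ?_, fun hS => ⟨hf₁c ?_, fun H hHc hH => ?_⟩⟩
  · rw [h0, map_zero] at hf₁
    exact hP0 hf₁.symm
  · rw [S.eval_eq, hf₁, hPS]
  · obtain ⟨h, hh, -⟩ := hdiv H hH
    exact ⟨h, hh⟩
  · rw [← yAxis_eval_ramify S.ν_pos, hf₁, hP, map_prod]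
    have : ∀ i ∈ Finset.range S.ν, yAxis.eval (MvPowerSeries.X 1 - inX (S.conj i)) =
        PowerSeries.X := by
      intro i _
      rw [map_sub, Param.eval_X_one, yAxis_eval_inX, S.constantCoeff_conj, map_zero, sub_zero]
      rfl
    rw [Finset.prod_congr rfl this, Finset.prod_const, Finset.card_range,
      PowerSeries.order_X_pow]
  · exact ConvergentSeries.prod_mem fun i _ =>
      (isConvergent_X 1).sub (S.isConvergent_conj hS i)
  · obtain ⟨h, hh, hhc⟩ := hdiv H hH
    exact ⟨h, hhc hS hHc, hh⟩

theorem IsEquation.mul_unit {G h : Series} {φ : Param} (hG : IsEquation G φ)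
    (hh : MvPowerSeries.constantCoeff h ≠ 0) :
    IsEquation (G * h) φ ∧ (yAxis.eval (G * h)).order = (yAxis.eval G).order := by
  have hu : IsUnit h := isUnit_iff_constantCoeff.2 hh
  refine ⟨⟨mul_ne_zero hG.ne_zero hu.ne_zero, by rw [map_mul, hG.eval_eq_zero, zero_mul],
    fun H hH => hu.mul_right_dvd.2 (hG.dvd_of_eval H hH)⟩, ?_⟩
  rw [map_mul, PowerSeries.order_mul, order_eq_zero_of_constantCoeff (p := yAxis.eval h), add_zero]
  rwa [constantCoeff_yAxis_eval]

/-- An irreducible convergent series generates the ideal of the branch of any of its roots. -/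
theorem PuiseuxSeries.isEquation_of_irreducible (S : PuiseuxSeries) {f : ConvergentSeries}
    (hf : Irreducible f) (hS : S.IsRoot (f : Series)) :
    IsEquation (f : Series) S.param ∧ (yAxis.eval (f : Series)).order = S.ν := by
  have hf0 : (f : Series) ≠ 0 := fun h => hf.ne_zero (Subtype.ext h)
  have hS' := (S.isRoot_iff _).1 hS
  -- Irreducibility refers to ℂ{x,y}, so the factorization by the minimal polynomial must take place
  -- there; convergence of the root ensures it.
  have hconv : IsConvergent (inX S.ser) := by
    refine isConvergent_of_eval_graph (isConvergent_ramify S.ν_pos f.2) (fun h => hf0 ?_)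
      S.constantCoeff_ser (by rw [← S.eval_eq, hS'])
    exact ramify_injective S.ν_pos (by rw [h, map_zero])
  obtain ⟨f₁, h1, h2, h3⟩ := S.exists_isEquation
  obtain ⟨hf₁c, h4⟩ := h3 hconv
  obtain ⟨h, hc, hfh⟩ := h4 _ f.2 hS'
  have hmul : f = (⟨f₁, hf₁c⟩ : ConvergentSeries) * ⟨h, hc⟩ := Subtype.ext hfh
  have hu : IsUnit (⟨h, hc⟩ : ConvergentSeries) := by
    refine (hf.isUnit_or_isUnit hmul).resolve_left fun hu => ?_
    have := isUnit_iff_constantCoeff.1 (hu.map ConvergentSeries.subtype)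
    exact this h1.constantCoeff
  have h5 := isUnit_iff_constantCoeff.1 (hu.map ConvergentSeries.subtype)
  obtain ⟨h6, h7⟩ := h1.mul_unit h5
  rw [hfh]
  exact ⟨h6, h7.trans h2⟩

end PlaneCurve

end

noncomputable section

namespace PlaneCurve

/-! ### Contact of two parametrized curves under blow-ups -/

theorem X_pow_dvd_iff_le_order {p : PowerSeries ℂ} {n : ℕ} :
    PowerSeries.X ^ n ∣ p ↔ (n : ℕ∞) ≤ p.order := by
  rw [PowerSeries.order_eq_emultiplicity_X, pow_dvd_iff_le_emultiplicity]

theorem order_congr {p q : PowerSeries ℂ} {D : ℕ} (h : p.order = D)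
    (hd : PowerSeries.X ^ (D + 1) ∣ q - p) : q.order = D := by
  rw [PowerSeries.order_eq_nat] at h ⊢
  rw [PowerSeries.X_pow_dvd_iff] at hd
  have key : ∀ i < D + 1, PowerSeries.coeff i q = PowerSeries.coeff i p := fun i hi => by
    have := hd i hi
    rwa [map_sub, sub_eq_zero] at this
  refine ⟨by rw [key D (by omega)]; exact h.1, fun i hi => ?_⟩
  rw [key i (by omega)]; exact h.2 i hi

theorem X_pow_dvd_mul_iff {p q : PowerSeries ℂ} {D e : ℕ} (h : p.order = D) :
    PowerSeries.X ^ (e + D) ∣ p * q ↔ PowerSeries.X ^ e ∣ q := by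
  rw [X_pow_dvd_iff_le_order, X_pow_dvd_iff_le_order, PowerSeries.order_mul, h, add_comm,
    Nat.cast_add, ENat.add_le_add_iff_left (ENat.natCast_ne_top D)]

theorem constantCoeff_eq_zero_of_dvd {p : PowerSeries ℂ} {e : ℕ} (he : 0 < e)
    (h : PowerSeries.X ^ e ∣ p) : PowerSeries.constantCoeff p = 0 := by
  rw [← PowerSeries.X_dvd_iff]
  exact (dvd_pow_self _ he.ne').trans h

/-- The parametrizations `φ` and `ψ` agree up to terms of order `e + D` in `x` and `e` in `y`,
where `D` is the order of `x`. -/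
structure Close (φ ψ : Param) (D e : ℕ) : Prop where
  order_x : φ.x.order = D
  dvd_x : PowerSeries.X ^ (e + D) ∣ ψ.x - φ.x
  dvd_y : PowerSeries.X ^ e ∣ ψ.y - φ.y

theorem Close.order_x' {φ ψ : Param} {D e : ℕ} (h : Close φ ψ D e) (he : 0 < e) :
    ψ.x.order = D :=
  order_congr h.order_x ((pow_dvd_pow _ (by omega)).trans h.dvd_x)

/-- From y = x (y' + c), the difference of the y-coordinates is divided by x, of order D, so the
contact drops by exactly D. The surplus D in the contact of the x-coordinates makes the term (ψ.x -
φ.x)(y' + c) negligible. The last clause records that an exact contact remains exact. -/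
theorem Close.slope_step {φ ψ φ' ψ' : Param} {d d' : Direction} {D e : ℕ} (h : Close φ ψ D e)
    (he : D < e) (hy : (D : ℕ∞) ≤ φ.y.order) (hl : IsLift d φ φ') (hl' : IsLift d' ψ ψ') :
    d' = d ∧ (∃ c, d = .slope c) ∧ Close φ' ψ' D (e - D) ∧
      (¬ PowerSeries.X ^ (e + 1) ∣ ψ.y - φ.y →
        ¬ PowerSeries.X ^ (e - D + 1) ∣ ψ'.y - φ'.y) := by
  have hx' := h.order_x' (by omega)
  have hφ0 : φ.x ≠ 0 := fun h0 => by
    have := h.order_x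
    rw [h0, PowerSeries.order_zero] at this
    exact ENat.top_ne_natCast D this
  have hψ0 : ψ.x ≠ 0 := fun h0 => by
    rw [h0, PowerSeries.order_zero] at hx'
    exact ENat.top_ne_natCast D hx'
  have hD : D ≠ 0 := fun h0 => by
    have := one_le_order φ.x_zero
    rw [h.order_x, h0] at this
    exact absurd this (by decide)
  cases d with
  | vertical =>
    have := hl.order_vertical_lt hφ0
    rw [h.order_x] at this
    exact absurd this (not_lt.2 hy)
  | slope c =>
    cases d' with
    | vertical =>
      have h1 := hl'.order_vertical_lt hψ0
      rw [hx'] at h1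
      refine absurd h1 (not_lt.2 ?_)
      rw [← X_pow_dvd_iff_le_order] at hy ⊢
      have := dvd_add ((pow_dvd_pow _ he.le).trans h.dvd_y) hy
      rwa [sub_add_cancel] at this
    | slope c' =>
      obtain ⟨h1, h2⟩ := hl
      obtain ⟨h1', h2'⟩ := hl'
      have hid : ψ.y - φ.y = ψ.x * ((ψ'.y - φ'.y) + (PowerSeries.C c' - PowerSeries.C c)) +
          (ψ.x - φ.x) * (φ'.y + PowerSeries.C c) := by
        rw [h2, h2', ← h1, ← h1']; ring
      have h3 : PowerSeries.X ^ (e + 1) ∣ (ψ.x - φ.x) * (φ'.y + PowerSeries.C c) :=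
        dvd_mul_of_dvd_left ((pow_dvd_pow _ (by omega)).trans h.dvd_x) _
      have h4 : PowerSeries.X ^ (e - D) ∣
          (ψ'.y - φ'.y) + (PowerSeries.C c' - PowerSeries.C c) := by
        rw [← X_pow_dvd_mul_iff hx', Nat.sub_add_cancel he.le]
        have := dvd_sub h.dvd_y ((pow_dvd_pow PowerSeries.X (Nat.le_succ e)).trans h3)
        rwa [hid, add_sub_cancel_right] at this
      have hc : c' = c := by
        have := constantCoeff_eq_zero_of_dvd (by omega) h4
        simpa [ψ'.y_zero, φ'.y_zero, sub_eq_zero] using this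
      subst hc
      rw [sub_self, add_zero] at h4 hid
      refine ⟨rfl, ⟨_, rfl⟩, ⟨h1 ▸ h.order_x, ?_, h4⟩, fun hex hd => hex ?_⟩
      · rw [← h1, ← h1']
        exact (pow_dvd_pow _ (by omega)).trans h.dvd_x
      · rw [← X_pow_dvd_mul_iff hx', show e - D + 1 + D = e + 1 by omega] at hd
        rw [hid]
        exact dvd_add hd h3

/-- `U` is `1 + A t ^ ε` up to higher order. -/
def LeadsWith (U : PowerSeries ℂ) (A : ℂ) (ε : ℕ) : Prop :=
  PowerSeries.X ^ (ε + 1) ∣ U - 1 - PowerSeries.C A * PowerSeries.X ^ ε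

theorem LeadsWith.exists_eq {U : PowerSeries ℂ} {A : ℂ} {ε : ℕ} (h : LeadsWith U A ε) :
    ∃ R, U = 1 + PowerSeries.C A * PowerSeries.X ^ ε + PowerSeries.X ^ (ε + 1) * R := by
  obtain ⟨R, hR⟩ := h
  exact ⟨R, by rw [← hR]; ring⟩

theorem LeadsWith.constantCoeff {U : PowerSeries ℂ} {A : ℂ} {ε : ℕ} (h : LeadsWith U A ε)
    (hε : 0 < ε) : PowerSeries.constantCoeff U = 1 := by
  obtain ⟨R, rfl⟩ := h.exists_eq
  simp [hε.ne']

/-- Modulo t^(ε+1) one has (1 + B t^ε) / (1 + A t^ε) = 1 + (B - A) t^ε, because ε > 0 makes t^(2ε)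
negligible. -/
theorem LeadsWith.div {U V W : PowerSeries ℂ} {A B : ℂ} {ε : ℕ} (hU : LeadsWith U A ε)
    (hV : LeadsWith V B ε) (hε : 0 < ε) (h : V = U * W) : LeadsWith W (B - A) ε := by
  have hu : IsUnit U := isUnit_powerSeries_iff.2 (by rw [hU.constantCoeff hε]; exact one_ne_zero)
  obtain ⟨R, hR⟩ := hU.exists_eq
  obtain ⟨R', hR'⟩ := hV.exists_eq
  obtain ⟨m, rfl⟩ := Nat.exists_eq_add_one_of_ne_zero hε.ne'
  rw [LeadsWith, ← hu.dvd_mul_left, mul_sub, mul_sub, ← h, mul_one]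
  refine ⟨R' - R - (PowerSeries.C (B - A)) * PowerSeries.X ^ m *
    (PowerSeries.C A + PowerSeries.X * R), ?_⟩
  rw [hR', hR, map_sub]
  ring

theorem LeadsWith.dvd {W : PowerSeries ℂ} {A : ℂ} {ε : ℕ} (h : LeadsWith W A ε) :
    PowerSeries.X ^ ε ∣ W - 1 := by
  obtain ⟨R, rfl⟩ := h.exists_eq
  exact ⟨PowerSeries.C A + PowerSeries.X * R, by ring⟩

theorem LeadsWith.not_dvd {W : PowerSeries ℂ} {A : ℂ} {ε : ℕ} (h : LeadsWith W A ε)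
    (hA : A ≠ 0) : ¬ PowerSeries.X ^ (ε + 1) ∣ W - 1 := by
  intro hd
  have h1 := dvd_sub hd h
  rw [sub_sub_cancel, PowerSeries.X_pow_dvd_iff] at h1
  have := h1 ε (Nat.lt_succ_self ε)
  rw [PowerSeries.coeff_C_mul, PowerSeries.coeff_X_pow, if_pos rfl, mul_one] at this
  exact hA this

/-- The coordinates of `ψ` are `1 + A t ^ ε + ⋯` and `1 + B t ^ ε + ⋯` times those of `φ`. -/
def TorusClose (φ ψ : Param) (A B : ℂ) (ε : ℕ) : Prop :=
  ∃ U V, LeadsWith U A ε ∧ LeadsWith V B ε ∧ ψ.x = φ.x * U ∧ ψ.y = φ.y * V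

theorem TorusClose.swap {φ ψ : Param} {A B : ℂ} {ε : ℕ} (h : TorusClose φ ψ A B ε) :
    TorusClose φ.swap ψ.swap B A ε := by
  obtain ⟨U, V, hU, hV, h1, h2⟩ := h
  exact ⟨V, U, hV, hU, h2, h1⟩

theorem order_mul_leadsWith {p U : PowerSeries ℂ} {A : ℂ} {ε : ℕ} (hε : 0 < ε)
    (hU : LeadsWith U A ε) : (p * U).order = p.order := by
  rw [PowerSeries.order_mul, order_eq_zero_of_constantCoeff (p := U), add_zero]
  rw [hU.constantCoeff hε]; exact one_ne_zero

theorem TorusClose.order {φ ψ : Param} {A B : ℂ} {ε : ℕ} (hε : 0 < ε)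
    (h : TorusClose φ ψ A B ε) (e : Fin 2) : (ψ.coord e).order = (φ.coord e).order := by
  obtain ⟨U, V, hU, hV, h1, h2⟩ := h
  fin_cases e
  · change ψ.x.order = φ.x.order
    rw [h1, order_mul_leadsWith hε hU]
  · change ψ.y.order = φ.y.order
    rw [h2, order_mul_leadsWith hε hV]

/-- Blow-ups act on the coordinates by division, hence on the leading deviations by subtraction: (A,
B) becomes (A, B - A), just as the orders (a, b) become (a, b - a) for c = 0. -/
theorem TorusClose.slope_step {φ ψ φ' ψ' : Param} {c : ℂ} {d' : Direction} {A B : ℂ} {ε : ℕ}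
    (hε : 0 < ε) (hx : φ.x ≠ 0) (h : TorusClose φ ψ A B ε) (hl : IsLift (.slope c) φ φ')
    (hl' : IsLift d' ψ ψ') : d' = .slope c ∧ ∃ U W, LeadsWith U A ε ∧ LeadsWith W (B - A) ε ∧
      ψ'.x = φ'.x * U ∧ ψ'.y + PowerSeries.C c = (φ'.y + PowerSeries.C c) * W := by
  have hox := h.order hε 0
  have hoy := h.order hε 1
  obtain ⟨U, V, hU, hV, h1, h2⟩ := h
  have hu : IsUnit U := isUnit_powerSeries_iff.2 (by rw [hU.constantCoeff hε]; exact one_ne_zero)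
  have hψ0 : ψ.x ≠ 0 := by rw [h1]; exact mul_ne_zero hx hu.ne_zero
  obtain ⟨W, hW⟩ : U ∣ V := hu.dvd
  have hWl := hU.div hV hε hW
  cases d' with
  | vertical =>
    have h3 := hl'.order_vertical_lt hψ0
    have h4 := hl.order_slope_le
    change ψ.x.order = φ.x.order at hox
    change ψ.y.order = φ.y.order at hoy
    rw [hox, hoy] at h3
    exact absurd h3 (not_lt.2 h4)
  | slope c' =>
    obtain ⟨h3, h4⟩ := hl
    obtain ⟨h3', h4'⟩ := hl'
    have h5 : ψ'.y + PowerSeries.C c' = (φ'.y + PowerSeries.C c) * W := by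
      refine mul_left_cancel₀ hψ0 ?_
      rw [h3', ← h4', h2, h4, hW, ← h3', h1, h3]; ring
    have hc : c' = c := by
      have := congrArg PowerSeries.constantCoeff h5
      simpa [ψ'.y_zero, φ'.y_zero, hWl.constantCoeff hε] using this
    subst hc
    exact ⟨rfl, U, W, hU, hWl, by rw [← h3, ← h3', h1], h5⟩

theorem TorusClose.slope_zero_step {φ ψ φ' ψ' : Param} {d' : Direction} {A B : ℂ} {ε : ℕ}
    (hε : 0 < ε) (hx : φ.x ≠ 0) (h : TorusClose φ ψ A B ε) (hl : IsLift (.slope 0) φ φ')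
    (hl' : IsLift d' ψ ψ') : d' = .slope 0 ∧ TorusClose φ' ψ' A (B - A) ε := by
  obtain ⟨h0, U, W, hU, hW, h1, h2⟩ := h.slope_step hε hx hl hl'
  rw [map_zero, add_zero, add_zero] at h2
  exact ⟨h0, U, W, hU, hW, h1, h2⟩

theorem TorusClose.vertical_step {φ ψ φ' ψ' : Param} {d' : Direction} {A B : ℂ} {ε : ℕ}
    (hε : 0 < ε) (hx : φ.x ≠ 0) (h : TorusClose φ ψ A B ε) (hl : IsLift .vertical φ φ')
    (hl' : IsLift d' ψ ψ') : d' = .vertical ∧ TorusClose φ' ψ' (A - B) B ε := by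
  have hy : φ.swap.x ≠ 0 := hl.coord_exc_ne_zero hx
  have hox : ψ.x.order = φ.x.order := h.order hε 0
  have hoy : ψ.y.order = φ.y.order := h.order hε 1
  have hlt := hl.order_vertical_lt hx
  have hd : d' = .vertical := by
    cases d' with
    | vertical => rfl
    | slope c' =>
      have := hl'.order_slope_le
      rw [hox, hoy] at this
      exact absurd hlt (not_lt.2 this)
  subst hd
  exact ⟨rfl, (h.swap.slope_zero_step hε hy hl.swap hl'.swap).2.swap⟩

/-- At a free point y' + c is a unit, so the multiplicative deviation W = 1 + (B - A) t^ε + ⋯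
becomes an additive one of the same order. It is exact when A ≠ B. -/
theorem TorusClose.slope_ne_zero_step {φ ψ φ' ψ' : Param} {c : ℂ} {d' : Direction} {A B : ℂ}
    {ε a : ℕ} (hε : 0 < ε) (ha : φ.x.order = a) (hc : c ≠ 0) (h : TorusClose φ ψ A B ε)
    (hl : IsLift (.slope c) φ φ') (hl' : IsLift d' ψ ψ') :
    d' = .slope c ∧ Close φ' ψ' a ε ∧ (A ≠ B → ¬ PowerSeries.X ^ (ε + 1) ∣ ψ'.y - φ'.y) := by
  have hx : φ.x ≠ 0 := fun h0 => by
    rw [h0, PowerSeries.order_zero] at ha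
    exact ENat.top_ne_natCast a ha
  obtain ⟨h0, U, W, hU, hW, h1, h2⟩ := h.slope_step hε hx hl hl'
  have hid : ψ'.y - φ'.y = (φ'.y + PowerSeries.C c) * (W - 1) := by
    linear_combination h2
  have hu : IsUnit (φ'.y + PowerSeries.C c) := isUnit_powerSeries_iff.2 (by
    simp [φ'.y_zero, hc])
  have ha' : φ'.x.order = a := by rw [← hl.1]; exact ha
  refine ⟨h0, ⟨ha', ?_, ?_⟩, fun hAB => ?_⟩
  · have : ψ'.x - φ'.x = φ'.x * (U - 1) := by rw [h1]; ring
    rw [this, X_pow_dvd_mul_iff ha']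
    exact hU.dvd
  · rw [hid, hu.dvd_mul_left]
    exact hW.dvd
  · rw [hid, hu.dvd_mul_left]
    exact hW.not_dvd (sub_ne_zero.2 hAB.symm)

/-- A contact that exceeds the order of `y` is a contact in the torus. -/
theorem Close.torusClose {φ ψ : Param} {D E r : ℕ} (h : Close φ ψ D E) (hr : φ.y.order = r)
    (hr0 : 0 < r) (hrE : r ≤ E) :
    ∃ B, TorusClose φ ψ 0 B (E - r) ∧ (¬ PowerSeries.X ^ (E + 1) ∣ ψ.y - φ.y → B ≠ 0) := by
  have hx : φ.x ∣ ψ.x - φ.x := dvd_of_order_le (fun h0 => by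
    have := h.order_x
    rw [h0, PowerSeries.order_zero] at this
    exact ENat.top_ne_natCast _ this) (by
    rw [h.order_x, ← X_pow_dvd_iff_le_order]
    exact (pow_dvd_pow _ (by omega)).trans h.dvd_x)
  have hy : φ.y ∣ ψ.y - φ.y := dvd_of_order_le (fun h0 => by
    rw [h0, PowerSeries.order_zero] at hr
    exact ENat.top_ne_natCast _ hr) (by
    rw [hr, ← X_pow_dvd_iff_le_order]
    exact (pow_dvd_pow _ hrE).trans h.dvd_y)
  obtain ⟨u, hu⟩ := hx
  obtain ⟨v, hv⟩ := hy
  have hu' : PowerSeries.X ^ E ∣ u := by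
    rw [← X_pow_dvd_mul_iff h.order_x, ← hu]; exact h.dvd_x
  have hv' : PowerSeries.X ^ (E - r) ∣ v := by
    rw [← X_pow_dvd_mul_iff hr, ← hv, Nat.sub_add_cancel hrE]; exact h.dvd_y
  obtain ⟨w, hw⟩ := hv'
  -- The deviation u of x is divisible by t^E, and r > 0, so it does not appear at order E - r: the
  -- first parameter is 0.
  refine ⟨PowerSeries.constantCoeff w, ⟨1 + u, 1 + v, ?_, ?_, ?_, ?_⟩, fun hex hB => hex ?_⟩
  · rw [LeadsWith, add_sub_cancel_left, map_zero, zero_mul, sub_zero]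
    exact (pow_dvd_pow _ (by omega)).trans hu'
  · rw [LeadsWith, add_sub_cancel_left, hw, mul_comm, ← sub_mul, pow_succ']
    refine mul_dvd_mul ?_ dvd_rfl
    rw [PowerSeries.X_dvd_iff]; simp
  · rw [mul_add, mul_one, ← hu]; ring
  · rw [mul_add, mul_one, ← hv]; ring
  · rw [hv, show E + 1 = (E - r + 1) + r by omega, X_pow_dvd_mul_iff hr, hw, pow_succ]
    exact mul_dvd_mul dvd_rfl (PowerSeries.X_dvd_iff.2 hB)

end PlaneCurve

end

noncomputable section

namespace PlaneCurve

/-! ### Reparametrization -/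

/-- An injective local endomorphism of `ℂ⟦t⟧`. -/
structure Reparam where
  hom : PowerSeries ℂ →ₐ[ℂ] PowerSeries ℂ
  constantCoeff_hom : ∀ p, PowerSeries.constantCoeff (hom p) = PowerSeries.constantCoeff p
  injective : Function.Injective hom

/-- `t ↦ ζ t`. -/
def Reparam.rescale (ζ : ℂ) (hζ : ζ ≠ 0) : Reparam where
  hom := PowerSeries.rescaleAlgHom ζ
  constantCoeff_hom p := by
    have : PowerSeries.rescaleAlgHom ζ p = PowerSeries.rescale ζ p :=
      congrFun (congrArg DFunLike.coe (PowerSeries.coe_rescaleAlgHom ζ)) p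
    rw [this, ← PowerSeries.coeff_zero_eq_constantCoeff_apply, PowerSeries.coeff_rescale, pow_zero,
      one_mul, PowerSeries.coeff_zero_eq_constantCoeff_apply]
  injective p q h := by
    have key : ∀ p, PowerSeries.rescaleAlgHom ζ p = PowerSeries.rescale ζ p :=
      congrFun (congrArg DFunLike.coe (PowerSeries.coe_rescaleAlgHom ζ))
    ext k
    have := congrArg (PowerSeries.coeff k) h
    rw [key, key, PowerSeries.coeff_rescale, PowerSeries.coeff_rescale] at this
    exact mul_left_cancel₀ (pow_ne_zero k hζ) this

theorem Reparam.rescale_hom (ζ : ℂ) (hζ : ζ ≠ 0) (p : PowerSeries ℂ) :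
    (Reparam.rescale ζ hζ).hom p = PowerSeries.rescale ζ p :=
  congrFun (congrArg DFunLike.coe (PowerSeries.coe_rescaleAlgHom ζ)) p

/-- `t ↦ t ^ k`. -/
def Reparam.expand (k : ℕ) (hk : k ≠ 0) : Reparam where
  hom := PowerSeries.expand k hk
  constantCoeff_hom p := PowerSeries.constantCoeff_expand k hk p
  injective p q h := by
    ext j
    rw [← PowerSeries.coeff_expand_mul k hk p, ← PowerSeries.coeff_expand_mul k hk q]
    exact congrArg _ h

def Param.reparam (φ : Param) (h : Reparam) : Param :=
  ⟨h.hom φ.x, h.hom φ.y, by rw [h.constantCoeff_hom, φ.x_zero],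
    by rw [h.constantCoeff_hom, φ.y_zero]⟩

theorem IsLift.reparam {d : Direction} {φ φ' : Param} (hl : IsLift d φ φ') (h : Reparam) :
    IsLift d (φ.reparam h) (φ'.reparam h) := by
  cases d with
  | slope c =>
    refine ⟨congrArg h.hom hl.1, ?_⟩
    have h1 := congrArg h.hom hl.2
    have h2 : h.hom (PowerSeries.C c) = PowerSeries.C c := h.hom.commutes c
    rw [map_mul, map_add, h2] at h1
    exact h1
  | vertical =>
    refine ⟨?_, congrArg h.hom hl.2⟩
    have h1 := congrArg h.hom hl.1
    rw [map_mul] at h1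
    exact h1

/-- The chain of a reparametrized curve. -/
def Chain.reparam (c : Chain) (h : Reparam) : Chain where
  d := c.d
  φ s := (c.φ s).reparam h
  lift s := (c.lift s).reparam h
  x_ne s := (map_ne_zero_iff _ h.injective).2 (c.x_ne s)

/-! ### The subtractive Euclidean algorithm -/

/-- The sum of the quotients of the Euclidean algorithm. -/
def euclidSum (a b : ℕ) : ℕ := (euclidQuotients a b).sum

theorem euclidSum_zero {b : ℕ} (hb : 0 < b) : euclidSum 0 b = 0 := by
  rw [euclidSum, euclidQuotients, if_neg hb.ne', Nat.zero_mod, Nat.zero_div, euclidQuotients,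
    if_pos rfl]
  rfl

theorem euclidSum_add (a : ℕ) {b : ℕ} (hb : 0 < b) :
    euclidSum (a + b) b = euclidSum a b + 1 := by
  have h : ∀ a, euclidSum a b = a / b + (euclidQuotients b (a % b)).sum := by
    intro a
    rw [euclidSum, euclidQuotients, if_neg hb.ne', List.sum_cons]
  rw [h, h, Nat.add_mod_right, Nat.add_div_right _ hb]
  omega

/-- When a < b the first quotient is 0 and the algorithm continues with (b, a). -/
theorem euclidSum_comm {a b : ℕ} (ha : 0 < a) (hb : 0 < b) : euclidSum a b = euclidSum b a := by
  have key : ∀ a b : ℕ, 0 < a → a < b → euclidSum a b = euclidSum b a := by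
    intro a b ha h
    rw [euclidSum, euclidQuotients, if_neg (by omega), Nat.div_eq_of_lt h, Nat.mod_eq_of_lt h]
    simp [euclidSum]
  rcases lt_trichotomy a b with h | h | h
  · exact key a b ha h
  · rw [h]
  · exact (key b a hb h).symm

/-! ### Blocks of a chain -/

/-- The chains `c` and `c'` run through the same points, with the same multiplicities, for `N`
steps from the index `s` on. -/
def Chain.Follows (c c' : Chain) (s N : ℕ) : Prop :=
  ∀ t < N, c'.d (s + t) = c.d (s + t) ∧ c'.mul (s + t) = c.mul (s + t)

theorem Chain.Follows.cons {c c' : Chain} {s N : ℕ}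
    (h0 : c'.d s = c.d s ∧ c'.mul s = c.mul s) (h : c.Follows c' (s + 1) N) :
    c.Follows c' s (N + 1) := by
  intro t ht
  cases t with
  | zero => exact h0
  | succ t =>
    have := h t (by omega)
    rwa [show s + (t + 1) = s + 1 + t by omega]

theorem Chain.Follows.append {c c' : Chain} {s N N' : ℕ} (h : c.Follows c' s N)
    (h' : c.Follows c' (s + N) N') : c.Follows c' s (N + N') := by
  intro t ht
  by_cases h1 : t < N
  · exact h t h1
  · have := h' (t - N) (by omega)
    rwa [show s + N + (t - N) = s + t by omega] at this

theorem Chain.mul_eq_of_d {c : Chain} {s : ℕ} {d : Direction} (h : c.d s = d) {a : ℕ}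
    (ha : ((c.φ s).coord d.exc).order = a) : c.mul s = a := by
  rw [Chain.mul, h, ha]; rfl

theorem Chain.mul_congr_torus {c c' : Chain} {s : ℕ} {A B : ℂ} {ε : ℕ} (hε : 0 < ε)
    (h : TorusClose (c.φ s) (c'.φ s) A B ε) (hd : c'.d s = c.d s) : c'.mul s = c.mul s := by
  rw [Chain.mul, Chain.mul, hd, h.order hε]

/-- Each blow-up replaces (a, b) by (a, b - a) or (a - b, b) and has the subtracted number as
multiplicity, so a rectangle of sides a and b is cut into squares: this gives a b for the sum of
squares. The run ends when both orders equal the gcd, at a nonzero slope, where the last blow-up has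
multiplicity gcd. For a nearby curve, A b - B a is invariant along the run; in the end it is (A - B)
gcd, which decides whether the contact is exact. -/
theorem Chain.toric (c : Chain) (s : ℕ) {a b : ℕ} (ha : 0 < a) (hb : 0 < b)
    (hx : (c.φ s).x.order = a) (hy : (c.φ s).y.order = b) :
    ∃ N, N + 1 = euclidSum a b ∧
      (∀ t < N, c.d (s + t) = .slope 0 ∨ c.d (s + t) = .vertical) ∧
      (∃ γ, γ ≠ 0 ∧ c.d (s + N) = .slope γ) ∧
      (c.φ (s + N + 1)).x.order = (Nat.gcd a b : ℕ) ∧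
      ∑ t ∈ Finset.range (N + 1), c.mul (s + t) + Nat.gcd a b = a + b ∧
      ∑ t ∈ Finset.range (N + 1), c.mul (s + t) ^ 2 = a * b ∧
      ∀ (c' : Chain) (A B : ℂ) (ε : ℕ), 0 < ε → TorusClose (c.φ s) (c'.φ s) A B ε →
        c.Follows c' s (N + 1) ∧
        Close (c.φ (s + N + 1)) (c'.φ (s + N + 1)) (Nat.gcd a b) ε ∧
        (A * b ≠ B * a → ¬ PowerSeries.X ^ (ε + 1) ∣
          (c'.φ (s + N + 1)).y - (c.φ (s + N + 1)).y) := by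
  induction hn : a + b using Nat.strong_induction_on generalizing s a b with
  | _ n ih =>
    have hl := c.lift s
    have hx0 := c.x_ne s
    cases hd : c.d s with
    | slope γ =>
      rw [hd] at hl
      have hle := hl.order_slope_le
      rw [hx, hy, Nat.cast_le] at hle
      have hmul : c.mul s = a := Chain.mul_eq_of_d hd hx
      by_cases hγ : γ = 0
      · subst hγ
        have h1 := order_slope_zero hl
        have hy' : (c.φ (s + 1)).y.order = (b - a : ℕ) := by
          have hne : (c.φ (s + 1)).y ≠ 0 := fun h0 => by
            rw [h0, PowerSeries.order_zero, hy, add_top] at h1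
            exact ENat.natCast_ne_top _ h1
          rw [order_eq_coe hne, hx, hy] at h1
          rw [order_eq_coe hne]
          norm_cast at h1 ⊢
          omega
        have hx' : (c.φ (s + 1)).x.order = a := by rw [← hl.1]; exact hx
        have hb' : 0 < b - a := by
          have := one_le_order (c.φ (s + 1)).y_zero
          rw [hy'] at this
          exact_mod_cast this
        obtain ⟨N, h2, h3, h4, h5, h6, h7, h8⟩ := ih (a + (b - a)) (by omega) (s + 1) ha hb' hx' hy'
          rfl
        have hg : Nat.gcd a (b - a) = Nat.gcd a b := Nat.gcd_sub_self_right hle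
        rw [hg] at h5 h6 h8
        have hs : ∀ t, s + (t + 1) = s + 1 + t := fun t => by omega
        refine ⟨N + 1, ?_, ?_, ?_, ?_, ?_, ?_, ?_⟩
        · rw [h2, euclidSum_comm ha hb, euclidSum_comm ha hb', ← euclidSum_add _ ha,
            Nat.sub_add_cancel hle]
        · intro t ht
          cases t with
          | zero => exact Or.inl hd
          | succ t => rw [hs]; exact h3 t (by omega)
        · rw [hs]; exact h4
        · rw [hs]; exact h5
        · rw [Finset.sum_range_succ', Finset.sum_congr rfl fun t _ => congrArg c.mul (hs t)]
          rw [add_zero, hmul]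
          omega
        · rw [Finset.sum_range_succ', Finset.sum_congr rfl fun t _ => congrArg (fun k => c.mul k ^ 2) (hs t)]
          rw [add_zero, hmul, h7, sq, ← mul_add, Nat.sub_add_cancel hle]
        · intro c' A B ε hε hT
          obtain ⟨h9, h10⟩ := hT.slope_zero_step hε hx0 hl (c'.lift s)
          obtain ⟨h11, h12, h13⟩ := h8 c' A (B - A) ε hε h10
          have hd' : c'.d s = c.d s := by rw [hd, h9]
          refine ⟨Chain.Follows.cons ⟨hd', Chain.mul_congr_torus hε hT hd'⟩ h11, ?_, ?_⟩
          · rw [hs]; exact h12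
          · rw [hs]
            intro hAB
            refine h13 fun h => hAB ?_
            rw [Nat.cast_sub hle] at h
            linear_combination h
      -- A nonzero slope forces a = b: the algorithm stops with a single quotient 1.
      · have h1 := order_slope_ne_zero hl hγ
        rw [hx, hy, Nat.cast_inj] at h1
        subst h1
        refine ⟨0, ?_, fun t ht => absurd ht (Nat.not_lt_zero t), ⟨γ, hγ, hd⟩, ?_, ?_, ?_, ?_⟩
        · have := euclidSum_add 0 ha
          rw [zero_add, euclidSum_zero ha] at this
          exact this.symm
        · rw [Nat.gcd_self, add_zero, ← hl.1]; exact hx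
        · simpa [hmul] using hn
        · simp [hmul, sq]
        · intro c' A B ε hε hT
          obtain ⟨h2, h3, h4⟩ := hT.slope_ne_zero_step hε hx hγ hl (c'.lift s)
          have hd' : c'.d s = c.d s := by rw [hd, h2]
          refine ⟨Chain.Follows.cons ⟨hd', Chain.mul_congr_torus hε hT hd'⟩
            (fun t ht => absurd ht (Nat.not_lt_zero t)), ?_, ?_⟩
          · rw [Nat.gcd_self]; exact h3
          · exact fun h => h4 fun hAB => h (by rw [hAB])
    | vertical =>
      rw [hd] at hl
      have hlt := hl.order_vertical_lt hx0
      rw [hx, hy, Nat.cast_lt] at hlt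
      have hmul : c.mul s = b := Chain.mul_eq_of_d hd hy
      have h1 := order_vertical hl
      have hx' : (c.φ (s + 1)).x.order = (a - b : ℕ) := by
        rw [order_eq_coe (c.x_ne (s + 1)), hx, hy] at h1
        rw [order_eq_coe (c.x_ne (s + 1))]
        norm_cast at h1 ⊢
        omega
      have hy' : (c.φ (s + 1)).y.order = b := by rw [← hl.2]; exact hy
      have ha' : 0 < a - b := by omega
      obtain ⟨N, h2, h3, h4, h5, h6, h7, h8⟩ := ih (a - b + b) (by omega) (s + 1) ha' hb hx' hy' rfl
      have hg : Nat.gcd (a - b) b = Nat.gcd a b := Nat.gcd_sub_self_left hlt.le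
      rw [hg] at h5 h6 h8
      have hs : ∀ t, s + (t + 1) = s + 1 + t := fun t => by omega
      refine ⟨N + 1, ?_, ?_, ?_, ?_, ?_, ?_, ?_⟩
      · rw [h2, ← euclidSum_add _ hb, Nat.sub_add_cancel hlt.le]
      · intro t ht
        cases t with
        | zero => exact Or.inr hd
        | succ t => rw [hs]; exact h3 t (by omega)
      · rw [hs]; exact h4
      · rw [hs]; exact h5
      · rw [Finset.sum_range_succ', Finset.sum_congr rfl fun t _ => congrArg c.mul (hs t)]
        rw [add_zero, hmul]
        omega
      · rw [Finset.sum_range_succ', Finset.sum_congr rfl fun t _ => congrArg (fun k => c.mul k ^ 2) (hs t)]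
        rw [add_zero, hmul, h7, sq, ← add_mul, Nat.sub_add_cancel hlt.le]
      · intro c' A B ε hε hT
        obtain ⟨h9, h10⟩ := hT.vertical_step hε hx0 hl (c'.lift s)
        obtain ⟨h11, h12, h13⟩ := h8 c' (A - B) B ε hε h10
        have hd' : c'.d s = c.d s := by rw [hd, h9]
        refine ⟨Chain.Follows.cons ⟨hd', Chain.mul_congr_torus hε hT hd'⟩ h11, ?_, ?_⟩
        · rw [hs]; exact h12
        · rw [hs]
          intro hAB
          refine h13 fun h => hAB ?_
          rw [Nat.cast_sub hlt.le] at h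
          linear_combination h

/-- The part of a chain that corresponds to one Euclidean algorithm, for the pair `(e, D)`. -/
structure Chain.IsBlock (c : Chain) (s D e N : ℕ) : Prop where
  length : N + 1 = euclidSum e D
  turn_lt : e / D < N
  slope : ∀ t < e / D, (∃ γ, c.d (s + t) = .slope γ) ∧ c.mul (s + t) = D
  turn : c.d (s + e / D) = .vertical ∧ (c.φ (s + e / D)).x.order = D ∧
    c.mul (s + e / D) = e % D
  corner : ∀ t, e / D < t → t < N → c.d (s + t) = .slope 0 ∨ c.d (s + t) = .vertical
  last : ∃ γ, γ ≠ 0 ∧ c.d (s + N) = .slope γ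
  order_x : (c.φ (s + N + 1)).x.order = (Nat.gcd e D : ℕ)
  sum_mul : ∑ t ∈ Finset.range (N + 1), c.mul (s + t) + Nat.gcd e D = e + D
  sum_sq : ∑ t ∈ Finset.range (N + 1), c.mul (s + t) ^ 2 = e * D
  contact : ∀ (c' : Chain) (E : ℕ), e < E → Close (c.φ s) (c'.φ s) D E →
    c.Follows c' s (N + 1) ∧
      Close (c.φ (s + N + 1)) (c'.φ (s + N + 1)) (Nat.gcd e D) (E - e) ∧
      (¬ PowerSeries.X ^ (E + 1) ∣ (c'.φ s).y - (c.φ s).y →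
        ¬ PowerSeries.X ^ (E - e + 1) ∣ (c'.φ (s + N + 1)).y - (c.φ (s + N + 1)).y)

/-- The contact with the conjugate t ↦ ζ t is the first exponent k occurring in p with ζ^k ≠ 1. For
ζ a primitive D-th root of unity it is the first exponent not divisible by D. -/
theorem X_pow_dvd_rescale_sub {p : PowerSeries ℂ} {ζ : ℂ} {e : ℕ} :
    PowerSeries.X ^ e ∣ PowerSeries.rescale ζ p - p ↔
      ∀ k < e, PowerSeries.coeff k p ≠ 0 → ζ ^ k = 1 := by
  rw [PowerSeries.X_pow_dvd_iff]
  refine forall_congr' fun k => forall_congr' fun _ => ?_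
  rw [map_sub, PowerSeries.coeff_rescale, ← sub_one_mul, mul_eq_zero, sub_eq_zero, or_iff_not_imp_right]

/-- The hypotheses say that x has order D and that e is the first exponent of y not divisible by D,
expressed through the contact with a conjugate because this is what survives lifting. While D < e
the next point is free, with multiplicity D, and the contact drops to e - D. Once e < D, the order
of y is e itself and `Chain.toric` applies. -/
theorem Chain.block (c : Chain) (s : ℕ) {D e : ℕ} (hD : 0 < D) (hDe : ¬ D ∣ e) {ζ : ℂ}
    (hζ : IsPrimitiveRoot ζ D) (hζ0 : ζ ≠ 0)
    (hcl : Close (c.φ s) ((c.reparam (.rescale ζ hζ0)).φ s) D e)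
    (hex : ¬ PowerSeries.X ^ (e + 1) ∣ ((c.reparam (.rescale ζ hζ0)).φ s).y - (c.φ s).y) :
    ∃ N, c.IsBlock s D e N := by
  have hy_eq : ∀ s, ((c.reparam (.rescale ζ hζ0)).φ s).y =
      PowerSeries.rescale ζ (c.φ s).y := fun s => Reparam.rescale_hom ζ hζ0 _
  induction hn : e using Nat.strong_induction_on generalizing s e with
  | _ n ih =>
    subst hn
    have hdvd := hcl.dvd_y
    rw [hy_eq, X_pow_dvd_rescale_sub] at hdvd
    simp only [hζ.pow_eq_one_iff_dvd] at hdvd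
    have hc0 : PowerSeries.coeff 0 (c.φ s).y = 0 := by simpa using (c.φ s).y_zero
    -- Exponents of y below e are positive multiples of D, so none is below D as well.
    have hsmall : ∀ k < e, k < D → PowerSeries.coeff k (c.φ s).y = 0 := by
      intro k hk hkD
      by_contra h0
      have hk0 : k = 0 := Nat.eq_zero_of_dvd_of_lt (hdvd k hk h0) hkD
      subst hk0
      exact h0 hc0
    have he0 : e ≠ 0 := fun h => hDe (h ▸ dvd_zero D)
    by_cases heD : e < D
    -- The contact being exactly e, the coefficient of t^e in y does not vanish.
    · have hy : (c.φ s).y.order = e := by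
        rw [PowerSeries.order_eq_nat]
        refine ⟨fun h0 => hex ?_, fun i hi => hsmall i hi (by omega)⟩
        rw [hy_eq, X_pow_dvd_rescale_sub]
        intro k hk hk0
        rw [hζ.pow_eq_one_iff_dvd]
        rcases Nat.lt_succ_iff_lt_or_eq.1 hk with h | h
        · exact hdvd k h hk0
        · exact absurd (h ▸ h0) hk0
      have hdiv : e / D = 0 := Nat.div_eq_of_lt heD
      have hvert : c.d s = .vertical := by
        cases hd : c.d s with
        | vertical => rfl
        | slope γ =>
          have hl := c.lift s
          rw [hd] at hl
          have := hl.order_slope_le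
          rw [hcl.order_x, hy, Nat.cast_le] at this
          omega
      obtain ⟨N, h1, h2, h3, h4, h5, h6, h7⟩ := c.toric s hD (by omega) hcl.order_x hy
      rw [Nat.gcd_comm] at h4 h5 h7
      refine ⟨N, ?_, ?_, ?_, ?_, ?_, h3, h4, ?_, ?_, ?_⟩
      · rw [h1, euclidSum_comm hD (by omega)]
      · rw [hdiv]
        rcases Nat.eq_zero_or_pos N with h0 | h0
        · obtain ⟨γ, -, h⟩ := h3
          rw [h0, add_zero, hvert] at h
          exact absurd h (by simp)
        · exact h0
      · rw [hdiv]; exact fun t ht => absurd ht (Nat.not_lt_zero t)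
      · rw [hdiv, Nat.mod_eq_of_lt heD]
        exact ⟨hvert, hcl.order_x, Chain.mul_eq_of_d hvert hy⟩
      · exact fun t _ ht => h2 t ht
      · rw [h5, add_comm]
      · rw [h6, mul_comm]
      · intro c' E hE hc'
        obtain ⟨B, hT, hB⟩ := hc'.torusClose hy (by omega) hE.le
        obtain ⟨h8, h9, h10⟩ := h7 c' 0 B (E - e) (by omega) hT
        -- The deviation has first parameter 0 and second parameter B ≠ 0, so the condition for
        -- exact contact in `Chain.toric` reads 0 ≠ B D.
        refine ⟨h8, h9, fun hex' => h10 ?_⟩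
        rw [zero_mul]
        exact (mul_ne_zero (hB hex') (Nat.cast_ne_zero.2 hD.ne')).symm
    · have heD' : D < e := by
        rcases lt_or_eq_of_le (not_lt.1 heD) with h | h
        · exact h
        · exact absurd (h ▸ dvd_rfl) hDe
      have hy : (D : ℕ∞) ≤ (c.φ s).y.order := by
        refine PowerSeries.nat_le_order _ _ fun i hi => hsmall i (by omega) hi
      obtain ⟨-, ⟨γ, hγ⟩, h1, h2⟩ := hcl.slope_step heD' hy (c.lift s)
        ((c.reparam (.rescale ζ hζ0)).lift s)
      obtain ⟨N, hN⟩ := ih (e - D) (by omega) (s + 1)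
        (fun h => hDe ((Nat.dvd_sub_self_right.1 h).resolve_right (by omega))) h1 (h2 hex) rfl
      have hs : ∀ t, s + (t + 1) = s + 1 + t := fun t => by omega
      have hdiv : e / D = (e - D) / D + 1 := by
        conv_lhs => rw [← Nat.sub_add_cancel heD'.le, Nat.add_div_right _ hD]
      have hmod : e % D = (e - D) % D := by
        conv_lhs => rw [← Nat.sub_add_cancel heD'.le, Nat.add_mod_right]
      have hg : Nat.gcd (e - D) D = Nat.gcd e D := Nat.gcd_sub_self_left heD'.le
      have hmul : c.mul s = D := Chain.mul_eq_of_d hγ hcl.order_x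
      refine ⟨N + 1, ?_, ?_, ?_, ?_, ?_, ?_, ?_, ?_, ?_, ?_⟩
      · rw [hN.length, ← euclidSum_add _ hD, Nat.sub_add_cancel heD'.le]
      · rw [hdiv]; exact Nat.succ_lt_succ hN.turn_lt
      · rw [hdiv]
        intro t ht
        cases t with
        | zero => exact ⟨⟨γ, hγ⟩, hmul⟩
        | succ t => rw [hs]; exact hN.slope t (Nat.lt_of_succ_lt_succ ht)
      · rw [hdiv, hs, hmod]; exact hN.turn
      · rw [hdiv]
        intro t ht ht'
        cases t with
        | zero => exact absurd ht (Nat.not_lt_zero _)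
        | succ t => rw [hs]; exact hN.corner t (Nat.lt_of_succ_lt_succ ht) (by omega)
      · rw [hs]; exact hN.last
      · rw [hs, ← hg]; exact hN.order_x
      · have := hN.sum_mul
        rw [Finset.sum_range_succ', Finset.sum_congr rfl fun t _ => congrArg c.mul (hs t)]
        rw [add_zero, hmul, ← hg]
        omega
      · rw [Finset.sum_range_succ', Finset.sum_congr rfl fun t _ => congrArg (fun k => c.mul k ^ 2) (hs t)]
        rw [add_zero, hmul, hN.sum_sq, sq, ← add_mul, Nat.sub_add_cancel heD'.le]
      · intro c' E hE hc'
        obtain ⟨h3, -, h4, h5⟩ := hc'.slope_step (by omega) hy (c.lift s) (c'.lift s)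
        obtain ⟨h6, h7, h8⟩ := hN.contact c' (E - D) (by omega) h4
        rw [hg, show E - D - (e - D) = E - e by omega] at h7
        rw [show E - D - (e - D) = E - e by omega] at h8
        refine ⟨Chain.Follows.cons ⟨h3, ?_⟩ h6, ?_, ?_⟩
        · rw [hmul]
          exact Chain.mul_eq_of_d (h3.trans hγ) (hc'.order_x' (by omega))
        · rw [hs]; exact h7
        · rw [hs]; exact fun h => h8 (h5 h)

/-- Contact along a sequence of free points. -/
theorem Chain.close_of_slopes (c c' : Chain) (s : ℕ) {D E : ℕ} (h : ℕ) (hE : h * D < E)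
    (hcl : Close (c.φ s) (c'.φ s) D E) (hs : ∀ t < h, ∃ γ, c.d (s + t) = .slope γ) :
    c.Follows c' s h ∧ Close (c.φ (s + h)) (c'.φ (s + h)) D (E - h * D) := by
  induction h with
  | zero =>
    refine ⟨fun t ht => absurd ht (Nat.not_lt_zero t), ?_⟩
    simpa using hcl
  | succ h ih =>
    rw [Nat.succ_mul] at hE
    obtain ⟨h1, h2⟩ := ih (by omega) (fun t ht => hs t (by omega))
    obtain ⟨γ, hγ⟩ := hs h (by omega)
    have hl := c.lift (s + h)
    rw [hγ] at hl
    obtain ⟨h3, -, h4, -⟩ := h2.slope_step (by omega)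
      (by rw [← h2.order_x]; exact hl.order_slope_le) hl (c'.lift (s + h))
    refine ⟨h1.append ?_, ?_⟩
    · refine Chain.Follows.cons ⟨h3.trans hγ.symm, ?_⟩ fun t ht => absurd ht (Nat.not_lt_zero t)
      rw [Chain.mul_eq_of_d hγ h2.order_x]
      exact Chain.mul_eq_of_d h3 (h2.order_x' (by omega))
    · rw [Nat.succ_mul, ← Nat.sub_sub]; exact h4

end PlaneCurve

end

noncomputable section

namespace PlaneCurve

/-! ### The blocks of the chain of a Puiseux series -/

theorem charGcd_pos {n : ℕ} (hn : 0 < n) (m : ℕ → ℕ) (i : ℕ) : 0 < charGcd n m i := by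
  induction i with
  | zero => exact hn
  | succ i ih => exact Nat.gcd_pos_of_pos_left _ ih

theorem charGcd_dvd (n : ℕ) (m : ℕ → ℕ) {i j : ℕ} (h : i ≤ j) :
    charGcd n m j ∣ charGcd n m i := by
  induction j, h using Nat.le_induction with
  | base => exact dvd_rfl
  | succ j _ ih => exact (Nat.gcd_dvd_left _ _).trans ih

theorem charGcd_dvd_m (n : ℕ) {m : ℕ → ℕ} (h0 : m 0 = 0) (i : ℕ) : charGcd n m i ∣ m i := by
  cases i with
  | zero => rw [h0]; exact dvd_zero _
  | succ i => exact Nat.gcd_dvd_right _ _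

namespace PuiseuxSeries.IsCharSeq
variable {S : PuiseuxSeries} {g : ℕ} {m : ℕ → ℕ} (h : S.IsCharSeq g m)
include h

theorem coeff_ne {i : ℕ} (hi : i < g) : PowerSeries.coeff (m (i + 1)) S.ser ≠ 0 :=
  (h.2.2.1 (i + 1) (by omega) (by omega)).1.1

theorem not_dvd {i : ℕ} (hi : i < g) : ¬ charGcd S.ν m i ∣ m (i + 1) :=
  (h.2.2.1 (i + 1) (by omega) (by omega)).1.2

theorem dvd_of_lt {i : ℕ} (hi : i < g) {k : ℕ} (hk : k < m (i + 1))
    (hk0 : PowerSeries.coeff k S.ser ≠ 0) : charGcd S.ν m i ∣ k := by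
  by_contra hd
  exact absurd ((h.2.2.1 (i + 1) (by omega) (by omega)).2 ⟨hk0, hd⟩) (not_le.2 hk)

theorem lt_succ {i : ℕ} (hi : i < g) : m i < m (i + 1) := by
  refine lt_of_le_of_ne ?_ fun he => h.not_dvd hi (he ▸ charGcd_dvd_m S.ν h.2.1 i)
  cases i with
  | zero => rw [h.2.1]; exact Nat.zero_le _
  | succ i =>
    refine (h.2.2.1 (i + 1) (by omega) (by omega)).2 ⟨h.coeff_ne hi, fun hd => ?_⟩
    exact h.not_dvd hi ((charGcd_dvd S.ν m (Nat.le_succ i)).trans hd)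

theorem m_mono {i j : ℕ} (hij : i ≤ j) (hj : j ≤ g) : m i ≤ m j := by
  induction j, hij using Nat.le_induction with
  | base => exact le_rfl
  | succ j _ ih => exact (ih (by omega)).trans (h.lt_succ (by omega)).le

theorem not_dvd_sub {i : ℕ} (hi : i < g) : ¬ charGcd S.ν m i ∣ m (i + 1) - m i := fun hd => by
  have := dvd_add hd (charGcd_dvd_m S.ν h.2.1 i)
  rw [Nat.sub_add_cancel (h.lt_succ hi).le] at this
  exact h.not_dvd hi this

theorem gcd_sub {i : ℕ} (hi : i < g) :
    Nat.gcd (m (i + 1) - m i) (charGcd S.ν m i) = charGcd S.ν m (i + 1) := by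
  obtain ⟨k, hk⟩ := charGcd_dvd_m S.ν h.2.1 i
  have h1 : m (i + 1) = m (i + 1) - m i + charGcd S.ν m i * k := by
    have := h.lt_succ hi
    omega
  change _ = Nat.gcd (charGcd S.ν m i) (m (i + 1))
  rw [Nat.gcd_comm (charGcd S.ν m i), h1, Nat.gcd_add_mul_left_left]
  congr 1
  omega

theorem charGcd_ge_two {i : ℕ} (hi : i < g) : 2 ≤ charGcd S.ν m i := by
  have h1 := charGcd_pos S.ν_pos m i
  by_contra h2
  have h3 : charGcd S.ν m i = 1 := by omega
  have h4 := h.not_dvd hi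
  rw [h3] at h4
  exact h4 (one_dvd _)

end PuiseuxSeries.IsCharSeq

theorem gam_succ (n : ℕ) (m : ℕ → ℕ) (i : ℕ) :
    gam n m (i + 1) = gam n m i + euclidSum (m (i + 1) - m i) (charGcd n m i) := rfl

theorem gam_mono (n : ℕ) (m : ℕ → ℕ) {i j : ℕ} (h : i ≤ j) : gam n m i ≤ gam n m j := by
  induction j, h using Nat.le_induction with
  | base => exact le_rfl
  | succ j _ ih => rw [gam_succ]; omega

theorem rescale_X_pow {ζ : ℂ} {n : ℕ} (h : ζ ^ n = 1) :
    PowerSeries.rescale ζ (PowerSeries.X ^ n : PowerSeries ℂ) = PowerSeries.X ^ n := by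
  ext k
  rw [PowerSeries.coeff_rescale, PowerSeries.coeff_X_pow]
  split_ifs with hk
  · rw [hk, h, one_mul]
  · rw [mul_zero]

section
variable {S : PuiseuxSeries} {g : ℕ} {m : ℕ → ℕ} (hS : S.IsCharSeq g m) {c : Chain}
  (hc : c.φ 0 = S.param)
include hS hc

/-- At the start this is the definition of the characteristic exponents. In the induction the
conjugate belonging to i itself shows that a block starts at γ_i, and the contact clause of this
block transports all the other conjugates to γ_{i+1}; hence the statement for all i' ≥ i
simultaneously. -/
theorem Chain.close_conj {i : ℕ} (hi : i ≤ g) {i' : ℕ} (hi' : i ≤ i') (hg : i' < g) {ζ : ℂ}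
    (hζ : IsPrimitiveRoot ζ (charGcd S.ν m i')) (hζ0 : ζ ≠ 0) :
    Close (c.φ (gam S.ν m i)) ((c.reparam (.rescale ζ hζ0)).φ (gam S.ν m i)) (charGcd S.ν m i)
      (m (i' + 1) - m i) ∧
    ¬ PowerSeries.X ^ (m (i' + 1) - m i + 1) ∣
      ((c.reparam (.rescale ζ hζ0)).φ (gam S.ν m i)).y - (c.φ (gam S.ν m i)).y := by
  induction i generalizing i' ζ with
  | zero =>
    rw [hS.2.1, Nat.sub_zero]
    change Close (c.φ 0) ((c.φ 0).reparam _) S.ν _ ∧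
      ¬ _ ∣ ((c.φ 0).reparam (.rescale ζ hζ0)).y - (c.φ 0).y
    rw [hc]
    have hx : (S.param.reparam (.rescale ζ hζ0)).x = S.param.x := by
      refine (Reparam.rescale_hom ζ hζ0 _).trans (rescale_X_pow ?_)
      rw [hζ.pow_eq_one_iff_dvd]
      exact charGcd_dvd S.ν m (Nat.zero_le i')
    have hy : (S.param.reparam (.rescale ζ hζ0)).y = PowerSeries.rescale ζ S.ser :=
      Reparam.rescale_hom ζ hζ0 _
    refine ⟨⟨PowerSeries.order_X_pow _, ?_, ?_⟩, ?_⟩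
    · rw [hx, sub_self]; exact dvd_zero _
    · rw [hy]
      refine X_pow_dvd_rescale_sub.2 fun k hk hk0 => ?_
      rw [hζ.pow_eq_one_iff_dvd]
      exact hS.dvd_of_lt hg hk hk0
    · rw [hy]
      intro hd
      have := X_pow_dvd_rescale_sub.1 hd _ (Nat.lt_succ_self _) (hS.coeff_ne hg)
      rw [hζ.pow_eq_one_iff_dvd] at this
      exact hS.not_dvd hg this
  | succ i ih =>
    obtain ⟨ξ, hξ⟩ : ∃ ξ : ℂ, IsPrimitiveRoot ξ (charGcd S.ν m i) :=
      ⟨_, Complex.isPrimitiveRoot_exp _ (charGcd_pos S.ν_pos m i).ne'⟩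
    have hξ0 : ξ ≠ 0 := hξ.ne_zero (charGcd_pos S.ν_pos m i).ne'
    obtain ⟨h1, h2⟩ := ih (by omega) le_rfl (by omega) hξ hξ0
    obtain ⟨N, hN⟩ := c.block _ (charGcd_pos S.ν_pos m i) (hS.not_dvd_sub (by omega)) hξ hξ0 h1 h2
    obtain ⟨h3, h4⟩ := ih (by omega) (by omega) hg hζ hζ0
    have hlt := hS.lt_succ (i := i) (by omega)
    have hlt' := hS.lt_succ hg
    have hle := hS.m_mono hi' hg.le
    -- Since i' ≥ i + 1, the contact m_{i'+1} - m_i exceeds the length m_{i+1} - m_i used up by the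
    -- block.
    obtain ⟨-, h5, h6⟩ := hN.contact (c.reparam (.rescale ζ hζ0)) (m (i' + 1) - m i) (by omega) h3
    have h7 := h6 h4
    rw [hS.gcd_sub (by omega)] at h5
    rw [show m (i' + 1) - m i - (m (i + 1) - m i) = m (i' + 1) - m (i + 1) by omega] at h5 h7
    rw [gam_succ, ← hN.length, ← add_assoc]
    exact ⟨h5, h7⟩

theorem Chain.exists_isBlock {i : ℕ} (hi : i < g) :
    ∃ N, c.IsBlock (gam S.ν m i) (charGcd S.ν m i) (m (i + 1) - m i) N ∧
      gam S.ν m (i + 1) = gam S.ν m i + N + 1 := by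
  obtain ⟨ξ, hξ⟩ : ∃ ξ : ℂ, IsPrimitiveRoot ξ (charGcd S.ν m i) :=
    ⟨_, Complex.isPrimitiveRoot_exp _ (charGcd_pos S.ν_pos m i).ne'⟩
  have hξ0 : ξ ≠ 0 := hξ.ne_zero (charGcd_pos S.ν_pos m i).ne'
  obtain ⟨h1, h2⟩ := c.close_conj hS hc hi.le le_rfl hi hξ hξ0
  obtain ⟨N, hN⟩ := c.block _ (charGcd_pos S.ν_pos m i) (hS.not_dvd_sub hi) hξ hξ0 h1 h2
  exact ⟨N, hN, by rw [gam_succ, ← hN.length]; rfl⟩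

theorem Chain.order_x_gam {i : ℕ} (hi : i ≤ g) :
    (c.φ (gam S.ν m i)).x.order = charGcd S.ν m i := by
  cases i with
  | zero =>
    change (c.φ 0).x.order = S.ν
    rw [hc]; exact PowerSeries.order_X_pow _
  | succ i =>
    obtain ⟨N, hN, h1⟩ := c.exists_isBlock hS hc (i := i) (by omega)
    rw [h1, hN.order_x, hS.gcd_sub (by omega)]

theorem Chain.last_gam {i : ℕ} (hi : i < g) :
    ∃ s, gam S.ν m (i + 1) = s + 1 ∧ ∃ γ, γ ≠ 0 ∧ c.d s = .slope γ := by
  obtain ⟨N, hN, h1⟩ := c.exists_isBlock hS hc hi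
  exact ⟨_, h1, hN.last⟩

theorem Chain.contact_gam {c' : Chain} {E : ℕ} (hE : Close (c.φ 0) (c'.φ 0) S.ν E) {i : ℕ}
    (hi : i ≤ g) (hm : m i < E) : c.Follows c' 0 (gam S.ν m i) ∧
      Close (c.φ (gam S.ν m i)) (c'.φ (gam S.ν m i)) (charGcd S.ν m i) (E - m i) := by
  induction i with
  | zero =>
    refine ⟨fun t ht => absurd ht (Nat.not_lt_zero t), ?_⟩
    rw [hS.2.1]; exact hE
  | succ i ih =>
    have hlt := hS.lt_succ (i := i) (by omega)
    obtain ⟨h1, h2⟩ := ih (by omega) (by omega)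
    obtain ⟨N, hN, h3⟩ := c.exists_isBlock hS hc (i := i) (by omega)
    obtain ⟨h4, h5, -⟩ := hN.contact c' (E - m i) (by omega) h2
    rw [hS.gcd_sub (by omega), show E - m i - (m (i + 1) - m i) = E - m (i + 1) by omega] at h5
    rw [h3]
    refine ⟨?_, h5⟩
    rw [add_assoc]
    exact h1.append (by rw [zero_add]; exact h4)

/-- The block after γ_i contributes (m_{i+1} - m_i) + d_i - d_{i+1}, and the sum telescopes. -/
theorem Chain.sum_mul_gam {i : ℕ} (hi : i ≤ g) :
    ∑ t ∈ Finset.range (gam S.ν m i), c.mul t + charGcd S.ν m i = m i + S.ν := by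
  induction i with
  | zero =>
    rw [hS.2.1]
    change ∑ t ∈ Finset.range 0, c.mul t + S.ν = _
    simp
  | succ i ih =>
    have hlt := hS.lt_succ (i := i) (by omega)
    obtain ⟨N, hN, h3⟩ := c.exists_isBlock hS hc (i := i) (by omega)
    have h4 := ih (by omega)
    have h5 := hN.sum_mul
    rw [hS.gcd_sub (by omega)] at h5
    rw [h3, add_assoc, Finset.sum_range_add]
    omega

theorem Chain.sum_sq_gam_succ {i : ℕ} (hi : i < g) :
    ∑ t ∈ Finset.range (gam S.ν m (i + 1)), c.mul t ^ 2 =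
      ∑ t ∈ Finset.range (gam S.ν m i), c.mul t ^ 2 + (m (i + 1) - m i) * charGcd S.ν m i := by
  obtain ⟨N, hN, h3⟩ := c.exists_isBlock hS hc hi
  rw [h3, add_assoc, Finset.sum_range_add, hN.sum_sq]

end

end PlaneCurve

end

noncomputable section

namespace PlaneCurve

/-! ### Total transforms -/

theorem mult_X_pow (e : Fin 2) (a : ℕ) : mult (MvPowerSeries.X e ^ a) = a := by
  induction a with
  | zero =>
    rw [pow_zero]
    exact mult_eq_zero_of_constantCoeff (by simp)
  | succ a ih => rw [pow_succ, mult_mul (pow_ne_zero a (X_ne_zero e)) (X_ne_zero e), ih, mult_X]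

theorem mult_isUnit {u : Series} (hu : IsUnit u) : mult u = 0 :=
  mult_eq_zero_of_constantCoeff (isUnit_iff_constantCoeff.1 hu)

theorem monomial_ne_zero {u : Series} (hu : IsUnit u) (a b : ℕ) :
    u * MvPowerSeries.X 0 ^ a * MvPowerSeries.X 1 ^ b ≠ 0 :=
  mul_ne_zero (mul_ne_zero hu.ne_zero (pow_ne_zero a (X_ne_zero 0))) (pow_ne_zero b (X_ne_zero 1))

theorem mult_monomial {u : Series} (hu : IsUnit u) (a b : ℕ) :
    mult (u * MvPowerSeries.X 0 ^ a * MvPowerSeries.X 1 ^ b) = a + b := by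
  rw [mult_mul (mul_ne_zero hu.ne_zero (pow_ne_zero a (X_ne_zero 0)))
    (pow_ne_zero b (X_ne_zero 1)), mult_mul hu.ne_zero (pow_ne_zero a (X_ne_zero 0)),
    mult_isUnit hu, mult_X_pow, mult_X_pow, zero_add]

theorem total_ne_zero (p : InfNear) {G : Series} (hG : G ≠ 0) : total p G ≠ 0 := by
  induction p using List.reverseRecOn with
  | nil => exact hG
  | append_singleton p d ih => rw [total_snoc]; exact pull_ne_zero d ih

theorem multiplicity_pull_slope_zero {G : Series} (hG : G ≠ 0) (j : ℕ) :
    multiplicity (MvPowerSeries.X 0 : Series)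
      ((Direction.slope 0).pull G * MvPowerSeries.X 0 ^ j) = mult G + j := by
  have h : (Direction.slope 0).pull G * MvPowerSeries.X 0 ^ j =
      MvPowerSeries.X 0 ^ (mult G + j) * strictStep (.slope 0) G := by
    rw [pull_eq, pow_add]; change MvPowerSeries.X 0 ^ _ * _ * _ = _; ring
  refine multiplicity_eq_of_dvd_of_not_dvd ⟨_, h⟩ fun ⟨K, hK⟩ => ?_
  rw [h, pow_succ, mul_assoc] at hK
  exact not_X_zero_dvd_strictStep_slope 0 hG
    ⟨K, mul_left_cancel₀ (pow_ne_zero _ (X_ne_zero 0)) hK⟩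

/-- The pull-back by one blow-up is the exceptional coordinate to the power of the multiplicity,
times a series not divisible by it; so the order along the exceptional divisor is the multiplicity
of the total transform at the center. -/
theorem excOrder_eq (p : InfNear) {G : Series} (hG : G ≠ 0) :
    excOrder p G = mult (total p G) := by
  have := multiplicity_pull_slope_zero (total_ne_zero p hG) 0
  rwa [pow_zero, mul_one, add_zero, ← total_snoc] at this

open Classical in
/-- Change of the exponents of the exceptional lines at a blow-up, where the strict transform
has multiplicity `w`. -/
def Direction.expoStep (d : Direction) (w : ℕ) (ab : ℕ × ℕ) : ℕ × ℕ :=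
  match d with
  | .slope c => (ab.1 + ab.2 + w, if c = 0 then ab.2 else 0)
  | .vertical => (ab.1, ab.1 + ab.2 + w)

/-- The extra exponent w is kept free to cover two recursions at once: the multiplicity of the
strict transform for total transforms, and w = 1 for the Jacobian determinant. -/
theorem pull_monomial (d : Direction) (w : ℕ) (ab : ℕ × ℕ) {u : Series} (hu : IsUnit u) :
    ∃ u', IsUnit u' ∧ d.pull (u * MvPowerSeries.X 0 ^ ab.1 * MvPowerSeries.X 1 ^ ab.2) *
      MvPowerSeries.X d.exc ^ w =
      u' * MvPowerSeries.X 0 ^ (d.expoStep w ab).1 * MvPowerSeries.X 1 ^ (d.expoStep w ab).2 := by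
  have hu' := hu.map d.pull
  cases d with
  | slope c =>
    by_cases hc : c = 0
    · subst hc
      refine ⟨_, hu', ?_⟩
      simp only [map_mul, map_pow, Direction.pull_X, Direction.expoStep, Direction.chart,
        Direction.exc, if_true, Matrix.cons_val_zero, Matrix.cons_val_one, map_zero]
      ring
    · refine ⟨_, hu'.mul (IsUnit.pow ab.2 (a := MvPowerSeries.X 1 + MvPowerSeries.C c)
        (isUnit_iff_constantCoeff.2 (by simpa using hc))), ?_⟩
      simp only [map_mul, map_pow, Direction.pull_X, Direction.expoStep, Direction.chart,
        Direction.exc, if_neg hc, Matrix.cons_val_zero, Matrix.cons_val_one, mul_pow]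
      ring
  | vertical =>
    refine ⟨_, hu', ?_⟩
    simp only [map_mul, map_pow, Direction.pull_X, Direction.expoStep, Direction.chart,
        Direction.exc, Matrix.cons_val_zero, Matrix.cons_val_one]
    ring

theorem exists_total_eq (p : InfNear) (G : Series) :
    ∃ u a b, IsUnit u ∧ total p G =
      u * MvPowerSeries.X 0 ^ a * MvPowerSeries.X 1 ^ b * strict p G := by
  induction p using List.reverseRecOn with
  | nil => exact ⟨1, 0, 0, isUnit_one, by simp [total, strict]⟩
  | append_singleton p d ih =>
    obtain ⟨u, a, b, hu, h⟩ := ih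
    obtain ⟨u', hu', h'⟩ := pull_monomial d (mult (strict p G)) (a, b) hu
    refine ⟨u', (d.expoStep (mult (strict p G)) (a, b)).1,
      (d.expoStep (mult (strict p G)) (a, b)).2, hu', ?_⟩
    rw [total_snoc, h, map_mul, strict_snoc, pull_eq d (strict p G), ← mul_assoc, h']

/-- The exponents of the exceptional lines `x = 0` and `y = 0` at the points of a chain, where
the germ has multiplicities `w`. -/
def Chain.expo (c : Chain) (w : ℕ → ℕ) : ℕ → ℕ × ℕ
  | 0 => (0, 0)
  | s + 1 => (c.d s).expoStep (w s) (c.expo w s)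

/-- The order along the exceptional divisor of the `s`-th point. -/
def Chain.excOrd (c : Chain) (w : ℕ → ℕ) (s : ℕ) : ℕ := (c.expo w s).1 + (c.expo w s).2 + w s

theorem Chain.total_eq (c : Chain) (G : Series) (s : ℕ) :
    ∃ u, IsUnit u ∧ total (c.pt s) G =
      u * MvPowerSeries.X 0 ^ (c.expo (fun t => mult (strict (c.pt t) G)) s).1 *
        MvPowerSeries.X 1 ^ (c.expo (fun t => mult (strict (c.pt t) G)) s).2 *
        strict (c.pt s) G := by
  induction s with
  | zero => exact ⟨1, isUnit_one, by simp [Chain.expo, total, strict]⟩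
  | succ s ih =>
    obtain ⟨u, hu, h⟩ := ih
    obtain ⟨u', hu', h'⟩ := pull_monomial (c.d s) (mult (strict (c.pt s) G)) (c.expo _ s) hu
    refine ⟨u', hu', ?_⟩
    rw [c.pt_succ, total_snoc, h, map_mul, strict_snoc, pull_eq (c.d s) (strict (c.pt s) G),
      ← mul_assoc, h']
    rfl

theorem Chain.excOrder_pt (c : Chain) {G : Series} (hG : G ≠ 0) (s : ℕ) :
    excOrder (c.pt s) G = c.excOrd (fun t => mult (strict (c.pt t) G)) s := by
  obtain ⟨u, hu, h⟩ := c.total_eq G s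
  rw [excOrder_eq _ hG, h, mult_mul (monomial_ne_zero hu _ _) (strict_ne_zero _ hG),
    mult_monomial hu]
  rfl

/-! ### The Jacobian determinant of a composition of blow-ups -/

/-- The chain rule. Its defect E satisfies E(c + x K + y L) = d.chart 0 · E K + d.chart 1 · E L.
Both chart functions vanish at the point, so by iteration E G has order at least N for all N. -/
theorem pderiv_pull (d : Direction) (j : Fin 2) (G : Series) :
    MvPowerSeries.pderiv ℂ j (d.pull G) =
      d.pull (MvPowerSeries.pderiv ℂ 0 G) * MvPowerSeries.pderiv ℂ j (d.chart 0) +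
      d.pull (MvPowerSeries.pderiv ℂ 1 G) * MvPowerSeries.pderiv ℂ j (d.chart 1) := by
  set E : Series → Series := fun G => MvPowerSeries.pderiv ℂ j (d.pull G) -
    (d.pull (MvPowerSeries.pderiv ℂ 0 G) * MvPowerSeries.pderiv ℂ j (d.chart 0) +
      d.pull (MvPowerSeries.pderiv ℂ 1 G) * MvPowerSeries.pderiv ℂ j (d.chart 1)) with hE
  have h00 : MvPowerSeries.pderiv ℂ 0 (MvPowerSeries.X 0 : Series) = 1 :=
    MvPowerSeries.pderiv_X_self
  have h11 : MvPowerSeries.pderiv ℂ 1 (MvPowerSeries.X 1 : Series) = 1 :=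
    MvPowerSeries.pderiv_X_self
  have h01 : MvPowerSeries.pderiv ℂ 0 (MvPowerSeries.X 1 : Series) = 0 :=
    MvPowerSeries.pderiv_X_of_ne (by decide)
  have h10 : MvPowerSeries.pderiv ℂ 1 (MvPowerSeries.X 0 : Series) = 0 :=
    MvPowerSeries.pderiv_X_of_ne (by decide)
  have hchart : ∀ i, MvPowerSeries.constantCoeff (d.chart i) = 0 := by
    intro i
    cases d <;> fin_cases i <;> simp [Direction.chart]
  have hrec : ∀ (c : ℂ) (K L : Series), E (MvPowerSeries.C c + MvPowerSeries.X 0 * K +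
      MvPowerSeries.X 1 * L) = d.chart 0 * E K + d.chart 1 * E L := by
    intro c K L
    simp only [hE, map_add, map_mul, Direction.pull_C, Direction.pull_X, Derivation.leibniz,
      MvPowerSeries.pderiv_C, smul_eq_mul, h00, h01, h10, h11, map_zero, map_one]
    ring
  have hord : ∀ (N : ℕ) (G : Series), (N : ℕ∞) ≤ (E G).order := by
    intro N
    induction N with
    | zero => intro G; simp
    | succ N ih =>
      intro G
      obtain ⟨K, L, hG, -⟩ := exists_eq_C_add G
      rw [hG, hrec]
      have key : ∀ (i : Fin 2) (K : Series), ((N + 1 : ℕ) : ℕ∞) ≤ (d.chart i * E K).order := by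
        intro i K
        refine le_trans ?_ MvPowerSeries.le_order_mul
        rw [Nat.cast_add, add_comm]
        exact add_le_add (MvPowerSeries.one_le_order_iff_constCoeff_eq_zero.2 (hchart i)) (ih K)
      exact le_trans (le_min (key 0 K) (key 1 L)) MvPowerSeries.min_order_le_add
  have h0 : E G = 0 := by
    by_contra h0
    have h1 := hord (mult (E G) + 1) G
    rw [order_eq_mult h0, Nat.cast_le] at h1
    omega
  exact sub_eq_zero.1 h0

/-- One blow-up has the exceptional coordinate as Jacobian determinant, so the coefficients of K
obey the same recursion as those of a germ of multiplicity 1 at every point. -/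
theorem jacobian_pull (d : Direction) (u v : Series) :
    jacobian (d.pull u) (d.pull v) = d.pull (jacobian u v) * MvPowerSeries.X d.exc := by
  have h00 : MvPowerSeries.pderiv ℂ 0 (MvPowerSeries.X 0 : Series) = 1 :=
    MvPowerSeries.pderiv_X_self
  have h11 : MvPowerSeries.pderiv ℂ 1 (MvPowerSeries.X 1 : Series) = 1 :=
    MvPowerSeries.pderiv_X_self
  have h01 : MvPowerSeries.pderiv ℂ 0 (MvPowerSeries.X 1 : Series) = 0 :=
    MvPowerSeries.pderiv_X_of_ne (by decide)
  have h10 : MvPowerSeries.pderiv ℂ 1 (MvPowerSeries.X 0 : Series) = 0 :=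
    MvPowerSeries.pderiv_X_of_ne (by decide)
  simp only [jacobian, pderiv_pull d, map_sub, map_mul]
  cases d <;>
  · simp only [Direction.chart, Direction.exc, Matrix.cons_val_zero, Matrix.cons_val_one,
      Derivation.leibniz, map_add, MvPowerSeries.pderiv_C, smul_eq_mul, h00, h01, h10, h11]
    ring

theorem Chain.jacobian_total (c : Chain) (s : ℕ) :
    ∃ u, IsUnit u ∧ jacobian (total (c.pt s) (MvPowerSeries.X 0))
      (total (c.pt s) (MvPowerSeries.X 1)) =
      u * MvPowerSeries.X 0 ^ (c.expo 1 s).1 * MvPowerSeries.X 1 ^ (c.expo 1 s).2 := by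
  induction s with
  | zero =>
    refine ⟨1, isUnit_one, ?_⟩
    have h00 : MvPowerSeries.pderiv ℂ 0 (MvPowerSeries.X 0 : Series) = 1 :=
      MvPowerSeries.pderiv_X_self
    have h11 : MvPowerSeries.pderiv ℂ 1 (MvPowerSeries.X 1 : Series) = 1 :=
      MvPowerSeries.pderiv_X_self
    have h10 : MvPowerSeries.pderiv ℂ 1 (MvPowerSeries.X 0 : Series) = 0 :=
      MvPowerSeries.pderiv_X_of_ne (by decide)
    simp [Chain.expo, total, jacobian, h00, h11, h10]
  | succ s ih =>
    obtain ⟨u, hu, h⟩ := ih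
    obtain ⟨u', hu', h'⟩ := pull_monomial (c.d s) 1 (c.expo 1 s) hu
    refine ⟨u', hu', ?_⟩
    rw [c.pt_succ, total_snoc, total_snoc, jacobian_pull, h]
    rw [pow_one] at h'
    exact h'

theorem Chain.canonicalCoeff_pt (c : Chain) (s : ℕ) :
    canonicalCoeff (c.pt s) = c.excOrd 1 s := by
  obtain ⟨u, hu, h⟩ := c.jacobian_total s
  have h1 := multiplicity_pull_slope_zero (monomial_ne_zero hu (c.expo 1 s).1 (c.expo 1 s).2) 1
  rw [mult_monomial hu, ← h] at h1
  rw [canonicalCoeff, excPoint, total_snoc, total_snoc, jacobian_pull]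
  rw [pow_one] at h1
  exact h1

/-! ### Intersection numbers with the branch -/

/-- Noether's formula for the exceptional part: at each blow-up the intersection number of the
branch with the exceptional lines grows by the product of the two multiplicities, whichever chart is
used. -/
theorem Chain.expo_order (c : Chain) (w : ℕ → ℕ) (s : ℕ) :
    ((c.expo w s).1 : ℕ∞) * (c.φ s).x.order + ((c.expo w s).2 : ℕ∞) * (c.φ s).y.order =
      (∑ t ∈ Finset.range s, w t * c.mul t : ℕ) := by
  induction s with
  | zero => simp [Chain.expo]
  | succ s ih =>
    have hl := c.lift s
    have hM := c.order_coord_exc s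
    rw [Finset.sum_range_succ, Nat.cast_add, ← ih, Nat.cast_mul, ← hM, Chain.expo]
    cases hd : c.d s with
    | slope γ =>
      rw [hd] at hl
      simp only [Direction.expoStep, Direction.exc, Param.coord_zero]
      rw [← hl.1]
      split_ifs with hγ
      · subst hγ
        rw [order_slope_zero hl]
        push_cast
        ring
      · rw [order_slope_ne_zero hl hγ]
        push_cast
        ring
    | vertical =>
      rw [hd] at hl
      simp only [Direction.expoStep, Direction.exc, Param.coord_one]
      rw [order_vertical hl, ← hl.2]
      push_cast
      ring

/-- At a free point that is not on the axis `y = 0`. -/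
theorem Chain.excOrd_mul (c : Chain) (w : ℕ → ℕ) {s D : ℕ} {γ : ℂ} (hγ : γ ≠ 0)
    (hd : c.d s = .slope γ) (hD : (c.φ (s + 1)).x.order = D) :
    c.excOrd w s * D = ∑ t ∈ Finset.range (s + 1), w t * c.mul t := by
  have h := c.expo_order w (s + 1)
  -- A nonzero slope leaves the older exceptional lines, so only the newest one passes through the
  -- next point.
  have h1 : c.expo w (s + 1) = (c.excOrd w s, 0) := by
    rw [Chain.expo, hd]
    simp only [Direction.expoStep, if_neg hγ]
    rfl
  rw [h1, hD] at h
  simp only [Nat.cast_zero, zero_mul, add_zero] at h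
  exact_mod_cast h

end PlaneCurve

end

noncomputable section

namespace PlaneCurve

/-! ### Proximity -/

theorem strictStep_X {d : Direction} {e : Fin 2} {K : Series}
    (h : d.chart e = MvPowerSeries.X d.exc * K) : strictStep d (MvPowerSeries.X e) = K := by
  have := pull_eq d (MvPowerSeries.X e)
  rw [Direction.pull_X, mult_X, pow_one, h] at this
  exact (mul_left_cancel₀ (X_ne_zero _) this).symm

open Classical in
/-- Strict transform of a coordinate axis under a blow-up: `some e` is the axis `X e = 0` and
`none` means that the strict transform does not pass through the point. -/
def Direction.trackStep (d : Direction) : Option (Fin 2) → Option (Fin 2)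
  | none => none
  | some e => match d with
    | .slope c => if e = 1 ∧ c = 0 then some 1 else none
    | .vertical => if e = 0 then some 0 else none

theorem Direction.trackStep_some {d : Direction} {e e' : Fin 2} (h : d.trackStep (some e) = some e') :
    strictStep d (MvPowerSeries.X e) = MvPowerSeries.X e' := by
  apply strictStep_X
  cases d with
  | slope c =>
    simp only [Direction.trackStep] at h
    split_ifs at h with hc
    · obtain ⟨rfl, rfl⟩ := hc
      obtain rfl := Option.some_injective _ h
      simp [Direction.chart, Direction.exc]
  | vertical =>
    simp only [Direction.trackStep] at h
    split_ifs at h with hc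
    · subst hc
      obtain rfl := Option.some_injective _ h
      simp [Direction.chart, Direction.exc, mul_comm]

theorem Direction.trackStep_none {d : Direction} {e : Fin 2} (h : d.trackStep (some e) = none) :
    MvPowerSeries.constantCoeff (strictStep d (MvPowerSeries.X e)) ≠ 0 := by
  cases d with
  | slope c =>
    simp only [Direction.trackStep] at h
    split_ifs at h with hc
    fin_cases e
    · rw [strictStep_X (K := 1) (by simp [Direction.chart, Direction.exc])]
      simp
    · have hc' : c ≠ 0 := fun h0 => hc ⟨rfl, h0⟩
      rw [strictStep_X (K := MvPowerSeries.X 1 + MvPowerSeries.C c)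
        (by simp [Direction.chart, Direction.exc])]
      simpa using hc'
  | vertical =>
    simp only [Direction.trackStep] at h
    split_ifs at h with hc
    fin_cases e
    · exact absurd rfl hc
    · rw [strictStep_X (K := 1) (by simp [Direction.chart, Direction.exc])]
      simp

/-- The axis that the exceptional line of the `t`-th point is at the `s`-th point. -/
def Chain.track (c : Chain) (t : ℕ) : ℕ → Option (Fin 2)
  | 0 => none
  | s + 1 => if s = t then some (c.d t).exc else (c.d s).trackStep (c.track t s)

theorem Chain.track_of_le (c : Chain) {t s : ℕ} (h : s ≤ t) : c.track t s = none := by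
  induction s with
  | zero => rfl
  | succ s ih => rw [Chain.track, if_neg (by omega), ih (by omega)]; rfl

theorem Chain.track_succ_self (c : Chain) (s : ℕ) : c.track s (s + 1) = some (c.d s).exc := by
  rw [Chain.track, if_pos rfl]

theorem Chain.track_succ (c : Chain) {t s : ℕ} (h : t < s) :
    c.track t (s + 1) = (c.d s).trackStep (c.track t s) := by
  rw [Chain.track, if_neg (by omega)]

/-- The directions after the `t`-th one. -/
def Chain.seg (c : Chain) (t n : ℕ) : InfNear := (List.range n).map fun i => c.d (t + 1 + i)

theorem Chain.seg_succ (c : Chain) (t n : ℕ) :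
    c.seg t (n + 1) = c.seg t n ++ [c.d (t + 1 + n)] := by
  rw [Chain.seg, Chain.seg, List.range_succ, List.map_append]; rfl

theorem Chain.pt_eq_append (c : Chain) (t n : ℕ) :
    c.pt (t + 1 + n) = c.pt t ++ c.d t :: c.seg t n := by
  induction n with
  | zero => rw [add_zero, c.pt_succ]; rfl
  | succ n ih =>
    rw [← add_assoc, c.pt_succ, ih, c.seg_succ, List.append_assoc, List.cons_append]

/-- In the chosen charts the strict transform of an exceptional line is, at each later point of the
chain, a coordinate axis or absent. Hence `track` decides proximity. -/
theorem Chain.strict_seg (c : Chain) (t n : ℕ) :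
    (∀ e, c.track t (t + 1 + n) = some e →
      strict (c.seg t n) (MvPowerSeries.X (c.d t).exc) = MvPowerSeries.X e) ∧
    (c.track t (t + 1 + n) = none →
      MvPowerSeries.constantCoeff (strict (c.seg t n) (MvPowerSeries.X (c.d t).exc)) ≠ 0) := by
  induction n with
  | zero =>
    rw [add_zero, c.track_succ_self]
    exact ⟨fun e h => by rw [Option.some_injective _ h]; rfl, fun h => absurd h (by simp)⟩
  | succ n ih =>
    rw [← add_assoc, c.track_succ (by omega), c.seg_succ]
    simp only [strict_snoc]
    cases h : c.track t (t + 1 + n) with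
    | none =>
      exact ⟨fun e he => absurd he (by simp [Direction.trackStep]),
        fun _ => strictStep_unit _ (ih.2 h)⟩
    | some e =>
      rw [ih.1 e h]
      exact ⟨fun e' he => Direction.trackStep_some he, Direction.trackStep_none⟩

theorem Chain.proximate_iff (c : Chain) (s t : ℕ) :
    Proximate (c.pt s) (c.pt t) ↔ c.track t s ≠ none := by
  by_cases hst : s ≤ t
  · refine ⟨fun ⟨d, p, h, _⟩ => ?_, fun h => absurd (c.track_of_le hst) h⟩
    have := congrArg List.length h
    simp only [c.length_pt, List.length_append, List.length_cons] at this
    omega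
  · obtain ⟨n, rfl⟩ : ∃ n, s = t + 1 + n := ⟨s - (t + 1), by omega⟩
    constructor
    · rintro ⟨d, p, h, h0⟩ hn
      rw [c.pt_eq_append] at h
      obtain ⟨rfl, rfl⟩ := List.cons_eq_cons.1 (List.append_cancel_left h)
      exact (c.strict_seg t n).2 hn h0
    · intro h
      obtain ⟨e, he⟩ := Option.ne_none_iff_exists'.1 h
      refine ⟨_, _, c.pt_eq_append t n, ?_⟩
      rw [(c.strict_seg t n).1 e he]
      simp

/-- The exponent of an axis is the order along the divisor whose strict transform that axis is. A
blow-up puts the new line on one axis, with exponent `excOrd`, and the other axis keeps its line or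
becomes free. -/
theorem Chain.expo_eq (c : Chain) (w : ℕ → ℕ) (s : ℕ) :
    (c.expo w s).1 = ∑ t ∈ Finset.range s, (if c.track t s = some 0 then c.excOrd w t else 0) ∧
    (c.expo w s).2 = ∑ t ∈ Finset.range s, (if c.track t s = some 1 then c.excOrd w t else 0) := by
  induction s with
  | zero => exact ⟨rfl, rfl⟩
  | succ s ih =>
    have key : ∀ e, ∑ t ∈ Finset.range s,
        (if c.track t (s + 1) = some e then c.excOrd w t else 0) =
        ∑ t ∈ Finset.range s,
        (if (c.d s).trackStep (c.track t s) = some e then c.excOrd w t else 0) := fun e =>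
      Finset.sum_congr rfl fun t ht => by rw [c.track_succ (Finset.mem_range.1 ht)]
    rw [Finset.sum_range_succ, Finset.sum_range_succ, key, key, c.track_succ_self, Chain.expo]
    have hexc : c.excOrd w s = (c.expo w s).1 + (c.expo w s).2 + w s := rfl
    cases hd : c.d s with
    | slope γ =>
      have h0 : ∀ o, (Direction.slope γ).trackStep o = some 0 ↔ False := by
        intro o
        cases o with
        | none => simp [Direction.trackStep]
        | some e => simp only [Direction.trackStep]; split_ifs <;> simp
      have h1 : ∀ o, (Direction.slope γ).trackStep o = some 1 ↔ (γ = 0 ∧ o = some 1) := by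
        intro o
        cases o with
        | none => simp [Direction.trackStep]
        | some e =>
          simp only [Direction.trackStep]
          split_ifs with h
          · simp [h.1, h.2]
          · simp only [Option.some.injEq, false_iff]
            exact fun h' => h ⟨h'.2, h'.1⟩
      simp only [h0, h1, Direction.exc, Direction.expoStep]
      refine ⟨by simp [hexc], ?_⟩
      by_cases hγ : γ = 0 <;> simp [hγ, ih.2]
    | vertical =>
      have h0 : ∀ o, Direction.vertical.trackStep o = some 0 ↔ o = some 0 := by
        intro o
        cases o with
        | none => simp [Direction.trackStep]
        | some e => simp only [Direction.trackStep]; split_ifs with h <;> simp [h]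
      have h1 : ∀ o, Direction.vertical.trackStep o = some 1 ↔ False := by
        intro o
        cases o with
        | none => simp [Direction.trackStep]
        | some e => simp only [Direction.trackStep]; split_ifs <;> simp
      simp only [h0, h1, Direction.exc, Direction.expoStep]
      exact ⟨by simp [ih.1], by simp [hexc]⟩

/-- The order along a new divisor is the multiplicity at its center plus the orders along the
divisors to which the center is proximate: this is P · excOrd = w, row by row. -/
theorem Chain.excOrd_eq (c : Chain) (w : ℕ → ℕ) (s : ℕ) :
    c.excOrd w s = w s +
      ∑ t ∈ Finset.range s, (if c.track t s ≠ none then c.excOrd w t else 0) := by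
  conv_lhs => rw [Chain.excOrd, (c.expo_eq w s).1, (c.expo_eq w s).2]
  rw [← Finset.sum_add_distrib, add_comm]
  congr 1
  refine Finset.sum_congr rfl fun t _ => ?_
  cases h : c.track t s with
  | none => simp
  | some e => fin_cases e <;> simp

section
variable (c : Chain) {k : ℕ} {q : Fin k → InfNear} (hq : ∀ i, q i = c.pt i)
include hq

theorem Chain.proximityMatrix_mulVec (w : ℕ → ℕ) :
    Matrix.mulVec (proximityMatrix q) (fun i : Fin k => (c.excOrd w i : ℚ)) = fun i : Fin k => (w i : ℚ) := by
  classical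
  funext i
  have h1 : ∀ j : Fin k, proximityMatrix q i j * (c.excOrd w j : ℚ) =
      (if i = j then (c.excOrd w j : ℚ) else 0) -
        (fun t : ℕ => if c.track t i ≠ none then (c.excOrd w t : ℚ) else 0) j := by
    intro j
    rw [proximityMatrix, hq, hq]
    by_cases hij : i = j
    · subst hij
      simp [c.track_of_le le_rfl]
    · simp only [if_neg hij, c.proximate_iff]
      split_ifs <;> simp
  rw [Matrix.mulVec, dotProduct, Finset.sum_congr rfl fun j _ => h1 j, Finset.sum_sub_distrib,
    Fin.sum_univ_eq_sum_range (fun t : ℕ => if c.track t i ≠ none then (c.excOrd w t : ℚ) else 0)]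
  simp only [Finset.sum_ite_eq, Finset.mem_univ, if_true]
  rw [c.excOrd_eq, sub_eq_iff_eq_add, Nat.cast_add, Nat.cast_sum]
  congr 1
  -- No point is proximate to itself or to a later one, so only the columns before i contribute.
  rw [← Finset.sum_subset (Finset.range_subset_range.2 i.2.le)]
  · refine Finset.sum_congr rfl fun t _ => ?_
    split_ifs <;> simp
  · intro t _ ht
    rw [c.track_of_le (by simpa using ht)]
    simp

theorem Chain.isUnit_det_proximityMatrix : IsUnit (proximityMatrix q).det := by
  classical
  rw [Matrix.det_of_isLowerTriangular]
  · simp [proximityMatrix]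
  · intro i j hij
    have hij' : (i : ℕ) < j := hij
    rw [proximityMatrix, if_neg (by rintro rfl; omega), hq, hq, c.proximate_iff,
      c.track_of_le hij'.le]
    simp

theorem Chain.ordVec_dotProduct_invRow (G : Series) (r : Fin k) :
    ordVec q G ⬝ᵥ invRow q r = c.excOrd (fun t => mult (strict (c.pt t) G)) r := by
  have h1 : ordVec q G = Matrix.mulVec (proximityMatrix q)
      (fun i : Fin k => (c.excOrd (fun t => mult (strict (c.pt t) G)) i : ℚ)) := by
    rw [c.proximityMatrix_mulVec hq]
    funext i
    rw [ordVec, hq]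
  have h2 : ordVec q G ⬝ᵥ invRow q r = Matrix.mulVec (proximityMatrix q)⁻¹ (ordVec q G) r :=
    dotProduct_comm _ _
  rw [h2, h1, Matrix.mulVec_mulVec, Matrix.nonsing_inv_mul _ (c.isUnit_det_proximityMatrix hq),
    Matrix.one_mulVec]

end

end PlaneCurve

end

noncomputable section

namespace PlaneCurve

/-! ### Normal crossings along a branch -/

theorem constantCoeff_pderiv (i : Fin 2) (G : Series) :
    MvPowerSeries.constantCoeff (MvPowerSeries.pderiv ℂ i G) =
      MvPowerSeries.coeff (Finsupp.single i 1) G := by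
  rw [← MvPowerSeries.coeff_zero_eq_constantCoeff_apply, MvPowerSeries.coeff_pderiv]
  simp

theorem constantCoeff_jacobian (u v : Series) :
    MvPowerSeries.constantCoeff (jacobian u v) =
      MvPowerSeries.coeff (mon 1 0) u * MvPowerSeries.coeff (mon 0 1) v -
        MvPowerSeries.coeff (mon 0 1) u * MvPowerSeries.coeff (mon 1 0) v := by
  have h0 : mon 1 0 = Finsupp.single 0 1 := by simp [mon]
  have h1 : mon 0 1 = Finsupp.single 1 1 := by simp [mon]
  rw [jacobian, map_sub, map_mul, map_mul, constantCoeff_pderiv, constantCoeff_pderiv,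
    constantCoeff_pderiv, constantCoeff_pderiv, h0, h1]

theorem one_le_mult {G : Series} (hG : G ≠ 0) (h : MvPowerSeries.constantCoeff G = 0) :
    1 ≤ mult G := by
  refine le_mult hG fun a b hab => ?_
  obtain ⟨rfl, rfl⟩ : a = 0 ∧ b = 0 := by omega
  rwa [coeff_mon_zero_zero]

theorem isUnit_of_mult_eq_zero {G : Series} (hG : G ≠ 0) (h : mult G = 0) : IsUnit G := by
  rw [isUnit_iff_constantCoeff]
  intro h0
  have := one_le_mult hG h0
  omega

theorem mult_of_coeff_ne_zero {G : Series} (h0 : MvPowerSeries.constantCoeff G = 0)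
    (h : MvPowerSeries.coeff (mon 1 0) G ≠ 0 ∨ MvPowerSeries.coeff (mon 0 1) G ≠ 0) :
    G ≠ 0 ∧ mult G = 1 := by
  have hG : G ≠ 0 := by
    rintro rfl
    simp at h
  have h1 := one_le_mult hG h0
  refine ⟨hG, ?_⟩
  rcases h with h | h <;> have := mult_le h <;> omega

theorem prime_X_zero : Prime (MvPowerSeries.X 0 : Series) := by
  refine ⟨X_ne_zero 0, fun hu => ?_, fun a b h => ?_⟩
  · have := isUnit_iff_constantCoeff.1 hu
    simp at this
  · simp only [X_zero_dvd_iff, map_mul, mul_eq_zero] at h ⊢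
    exact h

theorem prime_X_one : Prime (MvPowerSeries.X 1 : Series) := by
  refine ⟨X_ne_zero 1, fun hu => ?_, fun a b h => ?_⟩
  · have := isUnit_iff_constantCoeff.1 hu
    simp at this
  · simp only [X_one_dvd_iff, map_mul, mul_eq_zero] at h ⊢
    exact h

theorem IsEquation.prime {G : Series} {φ : Param} (h : IsEquation G φ) : Prime G := by
  refine ⟨h.ne_zero, fun hu => isUnit_iff_constantCoeff.1 hu h.constantCoeff, fun a b hab => ?_⟩
  obtain ⟨k, hk⟩ := hab
  have h1 := congrArg φ.eval hk
  rw [map_mul, map_mul, h.eval_eq_zero, zero_mul, mul_eq_zero] at h1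
  exact h1.imp (h.dvd_of_eval a) (h.dvd_of_eval b)

theorem associated_of_dvd {P u : Series} (hP : Prime P) (hu : u ≠ 0) (hm : mult u = 1)
    (h : P ∣ u) : Associated P u := by
  obtain ⟨k, rfl⟩ := h
  have hk := right_ne_zero_of_mul hu
  rw [mult_mul hP.ne_zero hk] at hm
  have h1 : mult P ≠ 0 := fun h0 => hP.not_isUnit (isUnit_of_mult_eq_zero hP.ne_zero h0)
  obtain ⟨k, rfl⟩ := isUnit_of_mult_eq_zero hk (by omega)
  exact ⟨k, rfl⟩

theorem Associated.mult_eq {P u : Series} (h : Associated P u) (hP : P ≠ 0) :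
    mult u = mult P := by
  obtain ⟨k, rfl⟩ := h
  rw [mult_mul hP k.isUnit.ne_zero, mult_isUnit k.isUnit, add_zero]

/-- Extracts what is needed to refute normal crossings: all prime divisors lie among two smooth
germs, at least one of which is transverse to x = 0. -/
theorem HasNormalCrossing.exists_associated {T : Series} (h : HasNormalCrossing T) :
    ∃ u v : Series, mult u = 1 ∧ mult v = 1 ∧
      (MvPowerSeries.coeff (mon 0 1) u ≠ 0 ∨ MvPowerSeries.coeff (mon 0 1) v ≠ 0) ∧
      ∀ P, Prime P → P ∣ T → Associated P u ∨ Associated P v := by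
  obtain ⟨u, v, w, a, b, hu, hv, hj, hw, rfl⟩ := h
  rw [constantCoeff_jacobian] at hj
  obtain ⟨hu0, hu1⟩ := mult_of_coeff_ne_zero hu (by
    by_contra! h
    rw [h.1, h.2] at hj
    simp at hj)
  obtain ⟨hv0, hv1⟩ := mult_of_coeff_ne_zero hv (by
    by_contra! h
    rw [h.1, h.2] at hj
    simp at hj)
  refine ⟨u, v, hu1, hv1, ?_, fun P hP hd => ?_⟩
  · by_contra! h
    rw [h.1, h.2] at hj
    simp at hj
  · rcases hP.dvd_or_dvd hd with hd | hd
    · rcases hP.dvd_or_dvd hd with hd | hd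
      · exact absurd (isUnit_of_dvd_unit hd hw) hP.not_isUnit
      · exact Or.inl (associated_of_dvd hP hu0 hu1 (hP.dvd_of_dvd_pow hd))
    · exact Or.inr (associated_of_dvd hP hv0 hv1 (hP.dvd_of_dvd_pow hd))

theorem IsEquation.not_associated {G : Series} {φ : Param} (h : IsEquation G φ) {e : Fin 2}
    (he : φ.coord e ≠ 0) : ¬ Associated (MvPowerSeries.X e) G := by
  rintro hA
  obtain ⟨k, hk⟩ := hA.symm.dvd
  apply he
  rw [← φ.eval_X, hk, map_mul, h.eval_eq_zero, zero_mul]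

theorem coeff_eq_zero_of_two_le_order {P u : Series} (h2 : 2 ≤ (yAxis.eval P).order)
    (h : Associated P u) : MvPowerSeries.coeff (mon 0 1) u = 0 := by
  rw [← coeff_yAxis_eval]
  refine PowerSeries.coeff_of_lt_order _ ?_
  exact lt_of_lt_of_le (by decide) (h2.trans (order_ge_of_dvd yAxis h.dvd))

theorem not_associated_X : ¬ Associated (MvPowerSeries.X 0 : Series) (MvPowerSeries.X 1) := by
  intro h
  have := X_zero_dvd_iff.1 h.dvd
  rw [Param.eval_X_one] at this
  exact PowerSeries.X_ne_zero this

/-- The three obstructions are a singular branch, a branch having contact at least 2 with the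
exceptional line x = 0, and three distinct components through one point. -/
theorem not_hasNormalCrossing {F u : Series} {φ : Param} {a b : ℕ} (hF : IsEquation F φ)
    (hx : φ.x ≠ 0)
    (h : 2 ≤ mult F ∨ (0 < a ∧ 2 ≤ (yAxis.eval F).order) ∨ (0 < a ∧ 0 < b ∧ φ.y ≠ 0)) :
    ¬ HasNormalCrossing (u * MvPowerSeries.X 0 ^ a * MvPowerSeries.X 1 ^ b * F) := by
  intro hNC
  obtain ⟨v, w, hv, hw, hc, hA⟩ := hNC.exists_associated
  have hFA := hA F hF.prime (dvd_mul_left _ _)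
  have hXA : 0 < a → Associated (MvPowerSeries.X 0) v ∨ Associated (MvPowerSeries.X 0) w :=
    fun ha => hA _ prime_X_zero (((dvd_pow_self _ ha.ne').mul_left u).mul_right _ |>.mul_right _)
  have hYA : 0 < b → Associated (MvPowerSeries.X 1) v ∨ Associated (MvPowerSeries.X 1) w :=
    fun hb => hA _ prime_X_one (((dvd_pow_self _ hb.ne').mul_left _).mul_right _)
  have hXF := hF.not_associated (e := 0) hx
  rcases h with h | ⟨ha, h⟩ | ⟨ha, hb, hy⟩
  · rcases hFA with h1 | h1
    · rw [Associated.mult_eq h1 hF.ne_zero] at hv; omega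
    · rw [Associated.mult_eq h1 hF.ne_zero] at hw; omega
  · have hX2 : 2 ≤ (yAxis.eval (MvPowerSeries.X 0)).order := by
      rw [Param.eval_X_zero]
      change 2 ≤ (0 : PowerSeries ℂ).order
      rw [PowerSeries.order_zero]
      exact le_top
    rcases hFA with h1 | h1 <;> rcases hXA ha with h2 | h2
    · exact hXF (h2.trans h1.symm)
    · exact hc.elim (fun h' => h' (coeff_eq_zero_of_two_le_order h h1))
        (fun h' => h' (coeff_eq_zero_of_two_le_order hX2 h2))
    · exact hc.elim (fun h' => h' (coeff_eq_zero_of_two_le_order hX2 h2))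
        (fun h' => h' (coeff_eq_zero_of_two_le_order h h1))
    · exact hXF (h2.trans h1.symm)
  · have hYF := hF.not_associated (e := 1) hy
    rcases hFA with h1 | h1 <;> rcases hXA ha with h2 | h2 <;> rcases hYA hb with h3 | h3
    · exact hXF (h2.trans h1.symm)
    · exact hXF (h2.trans h1.symm)
    · exact hYF (h3.trans h1.symm)
    · exact not_associated_X (h2.trans h3.symm)
    · exact not_associated_X (h2.trans h3.symm)
    · exact hYF (h3.trans h1.symm)
    · exact hXF (h2.trans h1.symm)
    · exact hXF (h2.trans h1.symm)

theorem hasNormalCrossing_of_unit {u F : Series} (a b : ℕ) (hu : IsUnit u) (hF : IsUnit F) :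
    HasNormalCrossing (u * MvPowerSeries.X 0 ^ a * MvPowerSeries.X 1 ^ b * F) := by
  refine ⟨MvPowerSeries.X 0, MvPowerSeries.X 1, u * F, a, b, by simp, by simp, ?_, hu.mul hF,
    by ring⟩
  have h00 : MvPowerSeries.pderiv ℂ 0 (MvPowerSeries.X 0 : Series) = 1 :=
    MvPowerSeries.pderiv_X_self
  have h11 : MvPowerSeries.pderiv ℂ 1 (MvPowerSeries.X 1 : Series) = 1 :=
    MvPowerSeries.pderiv_X_self
  have h10 : MvPowerSeries.pderiv ℂ 1 (MvPowerSeries.X 0 : Series) = 0 :=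
    MvPowerSeries.pderiv_X_of_ne (by decide)
  simp [jacobian, h00, h11, h10]

/-! ### The centers of the standard resolution -/

section
variable (c : Chain) {f : Series} (hf : IsEquation f (c.φ 0))
  (hA : (yAxis.eval f).order = (c.φ 0).x.order)
include hf hA

theorem Chain.mult_strict_eq : (fun t => mult (strict (c.pt t) f)) = c.mul :=
  funext fun s => c.mult_strict hf hA s

theorem Chain.not_hasNormalCrossing_pt (s : ℕ) (h : 2 ≤ c.mul s ∨
    (0 < (c.expo c.mul s).1 ∧ 2 ≤ (c.φ s).x.order) ∨
    (0 < (c.expo c.mul s).1 ∧ 0 < (c.expo c.mul s).2)) :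
    ¬ HasNormalCrossing (total (c.pt s) f) := by
  obtain ⟨u, hu, hT⟩ := c.total_eq f s
  rw [c.mult_strict_eq hf hA] at hT
  obtain ⟨h1, h2⟩ := c.isEquation_strict hf hA s
  rw [hT]
  refine not_hasNormalCrossing h1 (c.x_ne s) ?_
  rw [c.mult_strict hf hA, h2]
  refine h.imp_right (Or.imp_right fun ⟨h3, h4⟩ => ⟨h3, h4, fun h0 => ?_⟩)
  -- The intersection number with the exceptional part is finite, so y is not identically zero on
  -- the branch when y = 0 is exceptional.
  have h5 := c.expo_order c.mul s
  rw [h0, PowerSeries.order_zero, ENat.mul_top (by exact_mod_cast h4.ne'), add_top] at h5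
  exact ENat.natCast_ne_top _ h5.symm

theorem Chain.hasNormalCrossing_of_ne {p : InfNear} (hp : p ≠ c.pt p.length) :
    HasNormalCrossing (total p f) := by
  obtain ⟨u, a, b, hu, hT⟩ := exists_total_eq p f
  rw [hT]
  exact hasNormalCrossing_of_unit a b hu
    (isUnit_iff_constantCoeff.2 (c.strict_unit_of_ne hf hA p hp))

omit hf hA in
theorem Chain.pt_injective : Function.Injective c.pt := fun s t h => by
  have := congrArg List.length h
  rwa [c.length_pt, c.length_pt] at this

-- A point that is not a center remains on the final surface once its predecessor has been blown up,
-- so the points of the branch without normal crossings are successively forced to be centers.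
omit hf hA in
theorem Chain.pt_mem_range {k : ℕ} {q : Fin k → InfNear} (hq : IsResolution f q) {K : ℕ}
    (hK : ∀ s < K, ¬ HasNormalCrossing (total (c.pt s) f)) (s : ℕ) (hs : s < K) :
    c.pt s ∈ Set.range q := by
  induction s with
  | zero =>
    by_contra h
    exact hK 0 hs (hq.2 _ ⟨h, Or.inl rfl⟩)
  | succ s ih =>
    obtain ⟨i, hi⟩ := ih (by omega)
    by_contra h
    exact hK _ hs (hq.2 _ ⟨h, Or.inr ⟨i, c.d s, by rw [hi, c.pt_succ]⟩⟩)

omit hf hA in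
theorem Chain.le_of_resolution {k : ℕ} {q : Fin k → InfNear} (hq : IsResolution f q) {K : ℕ}
    (hK : ∀ s < K, ¬ HasNormalCrossing (total (c.pt s) f)) : K ≤ k := by
  choose j hj using fun s : Fin K => c.pt_mem_range hq hK s s.2
  have hinj : Function.Injective j := fun s t h => by
    have := hj s
    rw [h, hj t] at this
    exact Fin.ext (c.pt_injective this.symm)
  simpa using Fintype.card_le_of_injective j hinj

/-- Of the points over O on this surface only `c.pt K` lies on the branch; at all the others the
strict transform of f is a unit. -/
theorem Chain.isResolution_pt {K : ℕ} (hK : HasNormalCrossing (total (c.pt K) f)) :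
    IsResolution f (fun i : Fin K => c.pt i) := by
  refine ⟨⟨fun s t h => Fin.ext (c.pt_injective h), fun i => ?_⟩, fun p hp => ?_⟩
  · rcases Nat.eq_zero_or_pos (i : ℕ) with h | h
    · left
      change c.pt i = []
      rw [h]; rfl
    · right
      refine ⟨⟨i - 1, by omega⟩, Fin.lt_def.2 (by simp only; omega), c.d (i - 1), ?_⟩
      rw [← c.pt_succ, Nat.sub_add_cancel h]
  · obtain ⟨hp, hp'⟩ := hp
    by_cases hc : p = c.pt p.length
    · have hlen : p.length ≤ K := by
        rcases hp' with rfl | ⟨i, d, rfl⟩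
        · exact Nat.zero_le _
        · rw [List.length_append, c.length_pt]
          exact i.2
      rcases lt_or_eq_of_le hlen with h | h
      · exact absurd ⟨⟨p.length, h⟩, hc.symm⟩ hp
      · rw [hc, h]; exact hK
    · exact c.hasNormalCrossing_of_ne hf hA hc

/-- The centers of the standard resolution of a branch are the first points of the branch. -/
theorem Chain.eq_pt_of_isStandardResolution {k : ℕ} {q : Fin k → InfNear}
    (hq : IsStandardResolution f q) (i : Fin k) : q i = c.pt i := by
  classical
  have hex : ∃ s, HasNormalCrossing (total (c.pt s) f) := by
    by_contra! h
    have := c.le_of_resolution hq.1 (K := k + 1) fun s _ => h s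
    omega
  set K := Nat.find hex with hKdef
  have hmin : ∀ s < K, ¬ HasNormalCrossing (total (c.pt s) f) := fun s hs => Nat.find_min hex hs
  -- Blowing up the points before the first normal crossing is a resolution, so minimality gives k ≤
  -- K. Conversely the first k points of the branch are forced to be centers, and counting shows
  -- that there are no others.
  have hkK : k ≤ K := hq.2 K _ (c.isResolution_pt hf hA (Nat.find_spec hex))
  choose j hj using fun s : Fin k => c.pt_mem_range hq.1 hmin s (by omega)
  have hinj : Function.Injective j := fun s t h => by
    have := hj s
    rw [h, hj t] at this
    exact Fin.ext (c.pt_injective this.symm)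
  have hsurj := Finite.surjective_of_injective hinj
  have hpt : ∀ i, ∃ s : ℕ, q i = c.pt s := fun i => by
    obtain ⟨s, rfl⟩ := hsurj i
    exact ⟨s, hj s⟩
  -- It remains to see that the order is the right one: a center lies one step above an earlier
  -- center, so the i-th one has level at most i, and lower levels are already taken.
  induction hn : (i : ℕ) using Nat.strong_induction_on generalizing i with
  | _ n ih =>
    subst hn
    obtain ⟨s, hs⟩ := hpt i
    have hle : s ≤ i := by
      rcases hq.1.1.2 i with h | ⟨i', hi', d, h⟩
      · have := congrArg List.length (hs.symm.trans h)
        rw [c.length_pt] at this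
        exact this.le.trans (Nat.zero_le _)
      · have h1 := ih i' hi' i' rfl
        rw [h1, hs] at h
        have := congrArg List.length h
        rw [c.length_pt, List.length_append, c.length_pt] at this
        simp only [List.length_singleton] at this
        have : (i' : ℕ) < i := hi'
        omega
    rcases lt_or_eq_of_le hle with h | h
    · have h1 := ih s h ⟨s, h.trans i.2⟩ rfl
      have h2 := hq.1.1.1 (hs.trans h1.symm)
      exact absurd (congrArg Fin.val h2) (by simp only; omega)
    · rw [hs, h]

end

theorem Chain.mul_pos (c : Chain) (s : ℕ) : 0 < c.mul s := by
  have h := c.order_coord_exc s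
  have h1 : 1 ≤ ((c.φ s).coord (c.d s).exc).order := by
    refine one_le_order ?_
    cases c.d s
    · exact (c.φ s).x_zero
    · exact (c.φ s).y_zero
  rw [h] at h1
  exact_mod_cast h1

/-- A slope direction makes x = 0 the new exceptional line, and a vertical one keeps the old line x
= 0. So once the first direction is a slope, this axis stays exceptional; this is where the position
of the tangent of the germ enters. -/
theorem Chain.expo_fst_pos (c : Chain) (h0 : ∃ γ, c.d 0 = .slope γ) (s : ℕ) (hs : 0 < s) :
    0 < (c.expo c.mul s).1 := by
  induction s with
  | zero => omega
  | succ s ih =>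
    rw [Chain.expo]
    cases hd : c.d s with
    | slope γ =>
      have := c.mul_pos s
      simp only [Direction.expoStep]
      omega
    | vertical =>
      rcases Nat.eq_zero_or_pos s with h | h
      · obtain ⟨γ, hγ⟩ := h0
        rw [h, hγ] at hd
        exact absurd hd (by simp)
      · exact ih h

theorem Chain.expo_snd_pos (c : Chain) (s : ℕ)
    (h : c.d s = .vertical ∨ (c.d s = .slope 0 ∧ 0 < (c.expo c.mul s).2)) :
    0 < (c.expo c.mul (s + 1)).2 := by
  rw [Chain.expo]
  rcases h with h | ⟨h, h'⟩
  · have := c.mul_pos s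
    simp only [h, Direction.expoStep]
    omega
  · simpa only [h, Direction.expoStep, if_true] using h'

/-- The points of the branch before the end of its last block are not normal crossings. -/
theorem Chain.not_hasNormalCrossing_of_lt_gam {S : PuiseuxSeries} {g : ℕ} {m : ℕ → ℕ}
    (hS : S.IsCharSeq g m) {c : Chain} (hc : c.φ 0 = S.param) {f : Series}
    (hf : IsEquation f (c.φ 0)) (hA : (yAxis.eval f).order = (c.φ 0).x.order)
    (h0 : ∃ γ, c.d 0 = .slope γ) {s : ℕ} (hs : s < gam S.ν m g) :
    ¬ HasNormalCrossing (total (c.pt s) f) := by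
  obtain ⟨i, hi, h1, h2⟩ : ∃ i < g, gam S.ν m i ≤ s ∧ s < gam S.ν m (i + 1) := by
    by_contra! h
    have : ∀ i ≤ g, gam S.ν m i ≤ s := by
      intro i
      induction i with
      | zero => exact fun _ => Nat.zero_le _
      | succ i ih => exact fun hi => h i hi (ih (by omega))
    exact absurd (this g le_rfl) (by omega)
  obtain ⟨N, hN, hγ⟩ := c.exists_isBlock hS hc hi
  obtain ⟨t, rfl⟩ : ∃ t, s = gam S.ν m i + t := ⟨s - gam S.ν m i, by omega⟩
  have hD := hS.charGcd_ge_two hi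
  refine c.not_hasNormalCrossing_pt hf hA _ ?_
  set s₀ := gam S.ν m i
  -- Before the turn the multiplicity is d_i ≥ 2. At the turn it may be 1, but the branch meets the
  -- exceptional line x = 0 with intersection number d_i. After the turn the point lies on two
  -- exceptional lines.
  rcases lt_trichotomy t ((m (i + 1) - m i) / charGcd S.ν m i) with h | h | h
  · left
    rw [(hN.slope t h).2]; exact hD
  · right; left
    subst h
    refine ⟨c.expo_fst_pos h0 _ ?_, ?_⟩
    -- A turn at the origin itself, where no line is exceptional yet, would make the branch tangent
    -- to the y-axis.
    · by_contra hn
      obtain ⟨γ, hγ⟩ := h0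
      have := hN.turn.1
      rw [show s₀ + (m (i + 1) - m i) / charGcd S.ν m i = 0 by omega, hγ] at this
      exact absurd this (by simp)
    · rw [hN.turn.2.1]; exact_mod_cast hD
  · right; right
    refine ⟨c.expo_fst_pos h0 _
      (((Nat.zero_le _).trans_lt h).trans_le (Nat.le_add_left _ _)), ?_⟩
    have htN : t ≤ N := by omega
    clear hs h1 h2
    induction t, h using Nat.le_induction with
    | base => exact c.expo_snd_pos _ (Or.inl hN.turn.1)
    | succ t ht ih =>
      refine c.expo_snd_pos _ ?_
      rcases hN.corner t ht (by omega) with h | h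
      · exact Or.inr ⟨h, ih (by omega)⟩
      · exact Or.inl h

end PlaneCurve

end

noncomputable section

namespace PlaneCurve

/-! ### The branch of an irreducible germ -/

theorem order_yAxis_le_mult {f : Series} (hy : NotTangentToYAxis f) :
    (yAxis.eval f).order ≤ mult f := by
  refine PowerSeries.order_le _ ?_
  rw [coeff_yAxis_eval]
  have : mon 0 (mult f) = Finsupp.single 1 (mult f) := by simp [mon]
  rw [this]
  exact hy

theorem Chain.d_zero_of_notTangent {c : Chain} {f : Series} (hf : IsEquation f (c.φ 0))
    (hA : (yAxis.eval f).order = (c.φ 0).x.order) (hy : NotTangentToYAxis f) :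
    ∃ γ, c.d 0 = .slope γ := by
  cases hd : c.d 0 with
  | slope γ => exact ⟨γ, rfl⟩
  | vertical =>
    have h1 := order_yAxis_le_mult hy
    have h2 := c.mult_strict hf hA 0
    change mult f = c.mul 0 at h2
    have h3 := c.order_coord_exc 0
    have hl := c.lift 0
    rw [hd] at h3 hl
    have h4 := hl.order_vertical_lt (c.x_ne 0)
    change (c.φ 0).y.order = _ at h3
    rw [hA, h2, ← h3] at h1
    exact absurd h4 (not_lt.2 h1)

/-! ### Series with a truncated root -/

/-- Multiplicities of an irreducible germ one of whose roots is a truncation of `S` (up to higher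
order), at the points of the branch of `S`. -/
structure Chain.TruncatedMult (c : Chain) (W : ℕ → ℕ) (D A h : ℕ) : Prop where
  before : ∀ t < A + h, W t * D = c.mul t
  turn : W (A + h) = 1
  after : ∀ t, A + h < t → W t = 0

theorem Chain.pt_congr {c c' : Chain} {s : ℕ} (h : ∀ t < s, c'.d t = c.d t) :
    c'.pt s = c.pt s :=
  List.map_congr_left fun t ht => h t (List.mem_range.1 ht)

theorem Chain.reparam_expand_mul (c : Chain) {D : ℕ} (hD : D ≠ 0) (s : ℕ) :
    (c.reparam (.expand D hD)).mul s = D * c.mul s := by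
  have h : ((c.φ s).reparam (.expand D hD)).coord (c.d s).exc =
      PowerSeries.expand D hD ((c.φ s).coord (c.d s).exc) := by
    cases c.d s <;> rfl
  change (((c.φ s).reparam (.expand D hD)).coord (c.d s).exc).order.toNat = _
  rw [h, PowerSeries.order_expand, c.order_coord_exc, nsmul_eq_mul, ← Nat.cast_mul]
  rfl

theorem PuiseuxSeries.coeff_eq_of_agreeUpTo {S S' : PuiseuxSeries} {D L : ℕ} (hD : D ≠ 0)
    (hν : S'.ν * D = S.ν) (h : S'.AgreeUpTo S ((L : ℚ) / S.ν)) {k : ℕ} (hk : k ≤ L) :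
    PowerSeries.coeff k (PowerSeries.expand D hD S'.ser) = PowerSeries.coeff k S.ser := by
  have hS : (S.ν : ℚ) ≠ 0 := Nat.cast_ne_zero.2 S.ν_pos.ne'
  have hD' : (D : ℚ) ≠ 0 := Nat.cast_ne_zero.2 hD
  have hν' : (S'.ν : ℚ) * D = S.ν := by exact_mod_cast hν
  have h1 := h ((k : ℚ) / S.ν) (by gcongr)
  have h2 : (k : ℚ) / S.ν * S.ν = (k : ℕ) := div_mul_cancel₀ _ hS
  have h3 : (k : ℚ) / S.ν * S'.ν = (k : ℚ) / D := by
    rw [div_mul_eq_mul_div, div_eq_div_iff hS hD', ← hν']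
    ring
  rw [coeffAt, coeffAt, h2, h3] at h1
  simp only [Rat.den_natCast, Rat.num_natCast, Int.toNat_natCast, if_true] at h1
  rw [← h1, PowerSeries.coeff_expand]
  by_cases hd : D ∣ k
  · obtain ⟨j, rfl⟩ := hd
    have h4 : ((D * j : ℕ) : ℚ) / D = (j : ℕ) := by
      rw [Nat.cast_mul, mul_div_cancel_left₀ _ hD']
    rw [if_pos (dvd_mul_right _ _), h4, Nat.mul_div_cancel_left _ (Nat.pos_of_ne_zero hD)]
    simp
  · rw [if_neg hd, if_neg]
    intro hden
    apply hd
    have h4 : (((k : ℚ) / D).num : ℚ) = (k : ℚ) / D := Rat.coe_int_num_of_den_eq_one hden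
    rw [eq_div_iff hD'] at h4
    have h5 : ((k : ℚ) / D).num * (D : ℤ) = k := by exact_mod_cast h4
    exact_mod_cast Dvd.intro_left _ h5

/-- Composed with t ↦ t^D, the root of F has contact with S just large enough to follow it through
the blocks before γ_j and the free points of the next block. There the branch of F is smooth and
transverse to x = 0 while that of S turns vertical, so the two part. -/
theorem Chain.truncatedMult {S : PuiseuxSeries} {g : ℕ} {m : ℕ → ℕ} (hS : S.IsCharSeq g m)
    {c : Chain} (hc : c.φ 0 = S.param) {j : ℕ} (hj : j < g) {F : Series} {S' : PuiseuxSeries}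
    (hF : IsEquation F S'.param) (hA : (yAxis.eval F).order = S'.ν)
    (hν : S'.ν = S.ν / charGcd S.ν m j)
    (h : S'.AgreeUpTo S (((m j : ℚ) + firstQuotient S.ν m (j + 1) * charGcd S.ν m j) / S.ν)) :
    c.TruncatedMult (fun t => mult (strict (c.pt t) F)) (charGcd S.ν m j) (gam S.ν m j)
      (firstQuotient S.ν m (j + 1)) := by
  set D := charGcd S.ν m j with hDdef
  set q := firstQuotient S.ν m (j + 1) with hqdef
  set A := gam S.ν m j with hAdef
  have hD : D ≠ 0 := (charGcd_pos S.ν_pos m j).ne'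
  have hν' : S'.ν * D = S.ν := by
    rw [hν]; exact Nat.div_mul_cancel (charGcd_dvd S.ν m (Nat.zero_le j))
  obtain ⟨c', hc'⟩ := exists_chain S'.param (pow_ne_zero _ PowerSeries.X_ne_zero)
  rw [← hc'] at hF
  have hA' : (yAxis.eval F).order = (c'.φ 0).x.order := by
    rw [hA, hc']; exact (PowerSeries.order_X_pow _).symm
  -- Agreement through the exponent m_j + q D is contact m_j + q D + 1, one more than the m_j + q D
  -- used up before the turn.
  have hcl : Close (c.φ 0) ((c'.reparam (.expand D hD)).φ 0) S.ν (m j + q * D + 1) := by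
    change Close (c.φ 0) ((c'.φ 0).reparam (.expand D hD)) _ _
    rw [hc, hc']
    refine ⟨PowerSeries.order_X_pow _, ?_, ?_⟩
    · have : (S'.param.reparam (.expand D hD)).x = S.param.x := by
        change PowerSeries.expand D hD (PowerSeries.X ^ S'.ν) = PowerSeries.X ^ S.ν
        rw [map_pow, PowerSeries.expand_X, ← pow_mul, mul_comm, hν']
      rw [this, sub_self]
      exact dvd_zero _
    · rw [PowerSeries.X_pow_dvd_iff]
      intro k hk
      change PowerSeries.coeff k (PowerSeries.expand D hD S'.ser - S.ser) = 0
      rw [map_sub, sub_eq_zero]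
      refine PuiseuxSeries.coeff_eq_of_agreeUpTo hD hν' (L := m j + q * D) ?_ (by omega)
      push_cast
      exact h
  obtain ⟨h1, h2'⟩ := c.contact_gam hS hc hcl hj.le (by omega)
  have h2 : Close (c.φ A) ((c'.reparam (.expand D hD)).φ A) D (q * D + 1) := by
    rwa [add_assoc, Nat.add_sub_cancel_left] at h2'
  obtain ⟨N, hN, -⟩ := c.exists_isBlock hS hc hj
  obtain ⟨h3, h4⟩ := c.close_of_slopes _ _ q (Nat.lt_succ_self _) h2 fun t ht => (hN.slope t ht).1
  rw [Nat.succ_eq_add_one, Nat.add_sub_cancel_left] at h4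
  have h5 : c.Follows (c'.reparam (.expand D hD)) 0 (A + q) := h1.append (by rwa [zero_add])
  have hd : ∀ t < A + q, c'.d t = c.d t := fun t ht => by
    have := (h5 t ht).1
    rwa [zero_add] at this
  have hm : ∀ t < A + q, c'.mul t * D = c.mul t := fun t ht => by
    have := (h5 t ht).2
    rwa [c'.reparam_expand_mul hD, zero_add, mul_comm] at this
  -- The expanded branch still has order D in x, so the branch of F has order 1. A vertical
  -- direction would need a positive order of y below it.
  have hx1 : (c'.φ (A + q)).x.order = (1 : ℕ) := by
    have h6 := h4.order_x' one_pos
    change (PowerSeries.expand D hD (c'.φ (A + q)).x).order = D at h6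
    rw [PowerSeries.order_expand, order_eq_coe (c'.x_ne (A + q)), nsmul_eq_mul] at h6
    rw [order_eq_coe (c'.x_ne (A + q))]
    norm_cast at h6 ⊢
    exact Nat.eq_of_mul_eq_mul_left (Nat.pos_of_ne_zero hD) (by rw [h6, mul_one])
  obtain ⟨γ, hγ⟩ : ∃ γ, c'.d (A + q) = .slope γ := by
    cases hd' : c'.d (A + q) with
    | slope γ => exact ⟨γ, rfl⟩
    | vertical =>
      have hl := c'.lift (A + q)
      rw [hd'] at hl
      have h6 := hl.order_vertical_lt (c'.x_ne _)
      rw [hx1] at h6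
      exact absurd h6 (not_lt.2 (by exact_mod_cast one_le_order (c'.φ (A + q)).y_zero))
  refine ⟨fun t ht => ?_, ?_, fun t ht => ?_⟩
  · rw [← hm t ht, ← c'.mult_strict hF hA' t, Chain.pt_congr fun t' ht' => hd t' (by omega)]
  · rw [← Chain.pt_congr hd, c'.mult_strict hF hA']
    exact Chain.mul_eq_of_d hγ hx1
  · refine mult_eq_zero_of_constantCoeff (c'.strict_unit_of_ne hF hA' _ fun he => ?_)
    rw [c.length_pt, Chain.pt, Chain.pt, List.map_inj_left] at he
    have := he (A + q) (List.mem_range.2 ht)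
    rw [hγ] at this
    have h6 : c.d (A + q) = .vertical := hN.turn.1
    rw [h6] at this
    exact absurd this (by simp)

section
variable {S : PuiseuxSeries} {g : ℕ} {m : ℕ → ℕ} (hS : S.IsCharSeq g m) {c : Chain}
  (hc : c.φ 0 = S.param) {W : ℕ → ℕ} {j : ℕ} (hj : j < g)
  (hW : c.TruncatedMult W (charGcd S.ν m j) (gam S.ν m j) (firstQuotient S.ν m (j + 1)))
include hS hc hj hW

omit hS hc hj in
theorem Chain.TruncatedMult.sum_of_le {i : ℕ} (hij : i ≤ j) :
    (∑ t ∈ Finset.range (gam S.ν m i), W t * c.mul t) * charGcd S.ν m j =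
      ∑ t ∈ Finset.range (gam S.ν m i), c.mul t ^ 2 := by
  rw [Finset.sum_mul]
  refine Finset.sum_congr rfl fun t ht => ?_
  have h1 := Finset.mem_range.1 ht
  have h2 := gam_mono S.ν m hij
  rw [mul_right_comm, hW.before t (by omega), sq]

/-- Beyond γ_j the contributions are D = d_j at each of the q = h_{j+1,0} free points, where W = 1,
and the remainder r at the turning point. Division with remainder gives q d_j + r = m_{j+1} - m_j.
-/
theorem Chain.TruncatedMult.sum_of_lt {i : ℕ} (hij : j < i) :
    ∑ t ∈ Finset.range (gam S.ν m i), W t * c.mul t =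
      ∑ t ∈ Finset.range (gam S.ν m j), W t * c.mul t + (m (j + 1) - m j) := by
  obtain ⟨N, hN, hγ⟩ := c.exists_isBlock hS hc hj
  set q := firstQuotient S.ν m (j + 1) with hq
  have hqN : q < N := hN.turn_lt
  have h1 := gam_mono S.ν m (show j + 1 ≤ i from hij)
  obtain ⟨R, hR⟩ : ∃ R, gam S.ν m i = gam S.ν m j + q + 1 + R :=
    ⟨gam S.ν m i - (gam S.ν m j + q + 1), by omega⟩
  have h2 : ∑ t ∈ Finset.range R, W (gam S.ν m j + q + 1 + t) *
      c.mul (gam S.ν m j + q + 1 + t) = 0 :=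
    Finset.sum_eq_zero fun t _ => by rw [hW.after _ (by omega), zero_mul]
  have h3 : ∑ t ∈ Finset.range q, W (gam S.ν m j + t) * c.mul (gam S.ν m j + t) =
      q * charGcd S.ν m j := by
    rw [Finset.sum_congr rfl (g := fun _ => charGcd S.ν m j), Finset.sum_const, Finset.card_range,
      smul_eq_mul]
    intro t ht
    have h4 := Finset.mem_range.1 ht
    have h5 := (hN.slope t h4).2
    have h6 := hW.before (gam S.ν m j + t) (by omega)
    rw [h5] at h6 ⊢
    exact h6
  have h4 : c.mul (gam S.ν m j + q) = (m (j + 1) - m j) % charGcd S.ν m j := hN.turn.2.2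
  rw [hR, Finset.sum_range_add, h2, Finset.sum_range_succ, Finset.sum_range_add, h3, hW.turn, h4,
    one_mul, add_zero, add_assoc]
  congr 1
  exact Nat.div_add_mod' _ _

end

/-! ### Assembling -/

theorem sumSqMult_eq {f : Series} {k : ℕ} {q : Fin k → InfNear} {c : Chain}
    (hq : ∀ i, q i = c.pt i) (hm : ∀ t, mult (strict (c.pt t) f) = c.mul t) {N : ℕ} (hN : N ≤ k) :
    sumSqMult f q N = (∑ t ∈ Finset.range N, c.mul t ^ 2 : ℕ) := by
  have h1 : ∀ s : Fin k, ordVec q f s ^ 2 = ((c.mul s ^ 2 : ℕ) : ℚ) := fun s => by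
    rw [ordVec, hq, hm]; push_cast; rfl
  rw [sumSqMult, Finset.sum_filter, Finset.sum_congr rfl fun s _ => by rw [h1 s],
    Fin.sum_univ_eq_sum_range (fun s => if s < N then ((c.mul s ^ 2 : ℕ) : ℚ) else 0),
    ← Finset.sum_filter, Nat.cast_sum]
  refine Finset.sum_congr ?_ fun _ _ => rfl
  ext t
  simp only [Finset.mem_filter, Finset.mem_range]
  omega

/-- The branch `c` with root `S`, resolved by the first points `q` of the branch. -/
structure ResolvedBranch (f : Series) (S : PuiseuxSeries) (g : ℕ) (m : ℕ → ℕ) {k : ℕ}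
    (q : Fin k → InfNear) (c : Chain) : Prop where
  charSeq : S.IsCharSeq g m
  start : c.φ 0 = S.param
  equation : IsEquation f (c.φ 0)
  order : (yAxis.eval f).order = (c.φ 0).x.order
  centers : ∀ i, q i = c.pt i
  gam_le : gam S.ν m g ≤ k

theorem exists_resolvedBranch {f : ConvergentSeries} (hf : Irreducible f)
    (hy : NotTangentToYAxis (f : Series)) {S : PuiseuxSeries} (hSf : S.IsRoot (f : Series))
    {g : ℕ} {m : ℕ → ℕ} (hS : S.IsCharSeq g m) {k : ℕ} {q : Fin k → InfNear}
    (hq : IsStandardResolution (f : Series) q) :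
    ∃ c, ResolvedBranch (f : Series) S g m q c := by
  obtain ⟨hE, hA⟩ := S.isEquation_of_irreducible hf hSf
  obtain ⟨c, hc⟩ := exists_chain S.param (pow_ne_zero _ PowerSeries.X_ne_zero)
  rw [← hc] at hE
  have hA' : (yAxis.eval (f : Series)).order = (c.φ 0).x.order := by
    rw [hA, hc]; exact (PowerSeries.order_X_pow _).symm
  refine ⟨c, hS, hc, hE, hA', c.eq_pt_of_isStandardResolution hE hA' hq,
    c.le_of_resolution hq.1 fun s hs => Chain.not_hasNormalCrossing_of_lt_gam hS hc hE hA'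
      (Chain.d_zero_of_notTangent hE hA' hy) hs⟩

namespace ResolvedBranch
variable {f : Series} {S : PuiseuxSeries} {g : ℕ} {m : ℕ → ℕ} {k : ℕ} {q : Fin k → InfNear}
  {c : Chain} (h : ResolvedBranch f S g m q c)
include h

theorem gam_le_card {i : ℕ} (hi : i ≤ g) : gam S.ν m i ≤ k :=
  (gam_mono S.ν m hi).trans h.gam_le

theorem one_le_gam {i : ℕ} (hi0 : 1 ≤ i) (hi : i ≤ g) : 1 ≤ gam S.ν m i := by
  obtain ⟨i, rfl⟩ := Nat.exists_eq_add_one_of_ne_zero (by omega : i ≠ 0)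
  obtain ⟨s, hs, -⟩ := c.last_gam h.charSeq h.start (i := i) (by omega)
  omega

theorem sumSqMult_gam {i : ℕ} (hi : i ≤ g) :
    sumSqMult f q (gam S.ν m i) = (∑ t ∈ Finset.range (gam S.ν m i), c.mul t ^ 2 : ℕ) :=
  sumSqMult_eq h.centers (c.mult_strict h.equation h.order) (h.gam_le_card hi)

/-- The common source of all formulas of the lemma, applied with w constant 1, with w the
multiplicities of f, and with w those of a standard factor. It applies because each block ends with
a nonzero slope; centers being counted from 0, that point has index γ_i - 1. -/
theorem excOrd_mul {i : ℕ} (hi : i ≤ g) {r : Fin k}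
    (hr : (r : ℕ) + 1 = gam S.ν m i) (w : ℕ → ℕ) :
    c.excOrd w r * charGcd S.ν m i = ∑ t ∈ Finset.range (gam S.ν m i), w t * c.mul t := by
  obtain ⟨i, rfl⟩ : ∃ i', i = i' + 1 := Nat.exists_eq_add_one_of_ne_zero (by
    rintro rfl
    exact absurd hr (Nat.succ_ne_zero _))
  obtain ⟨s, hs, γ, hγ, hd⟩ := c.last_gam h.charSeq h.start (i := i) (by omega)
  have hrs : (r : ℕ) = s := by omega
  rw [hrs, hs]
  refine c.excOrd_mul w hγ hd ?_
  rw [← hs]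
  exact c.order_x_gam h.charSeq h.start hi

theorem canonicalCoeff_gam {i : ℕ} (hi : i ≤ g) {r : Fin k} (hr : (r : ℕ) + 1 = gam S.ν m i) :
    (canonicalCoeff (q r) : ℚ) + 1 = ((m i : ℚ) + S.ν) / charGcd S.ν m i := by
  have hd : (charGcd S.ν m i : ℚ) ≠ 0 := Nat.cast_ne_zero.2 (charGcd_pos S.ν_pos m i).ne'
  have h1 := h.excOrd_mul hi hr 1
  have h2 := c.sum_mul_gam h.charSeq h.start hi
  simp only [Pi.one_apply, one_mul] at h1
  rw [h.centers, c.canonicalCoeff_pt, eq_div_iff hd, add_one_mul]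
  exact_mod_cast (by rw [h1, h2] :
    c.excOrd 1 r * charGcd S.ν m i + charGcd S.ν m i = m i + S.ν)

theorem excOrder_gam {i : ℕ} (hi : i ≤ g) {r : Fin k} (hr : (r : ℕ) + 1 = gam S.ν m i) :
    (excOrder (q r) f : ℚ) = sumSqMult f q (gam S.ν m i) / charGcd S.ν m i := by
  have hd : (charGcd S.ν m i : ℚ) ≠ 0 := Nat.cast_ne_zero.2 (charGcd_pos S.ν_pos m i).ne'
  have h1 := h.excOrd_mul hi hr c.mul
  simp only [← sq] at h1
  rw [h.centers, c.excOrder_pt h.equation.ne_zero, c.mult_strict_eq h.equation h.order,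
    eq_div_iff hd, h.sumSqMult_gam hi]
  exact_mod_cast h1

theorem ordVec_gam {i : ℕ} (hi : i ≤ g) {r : Fin k} (hr : (r : ℕ) + 1 = gam S.ν m i)
    (G : Series) : ordVec q G ⬝ᵥ invRow q r * charGcd S.ν m i =
      (∑ t ∈ Finset.range (gam S.ν m i), mult (strict (c.pt t) G) * c.mul t : ℕ) := by
  rw [c.ordVec_dotProduct_invRow h.centers]
  exact_mod_cast h.excOrd_mul hi hr _

theorem standardFactor {F : ℕ → MvPolynomial (Fin 2) ℂ} (hF : IsStandardFactors q S g m F)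
    {j : ℕ} (hj0 : 1 ≤ j) (hj : j < g) :
    c.TruncatedMult (fun t => mult (strict (c.pt t) (F j : Series))) (charGcd S.ν m j)
      (gam S.ν m j) (firstQuotient S.ν m (j + 1)) := by
  obtain ⟨-, -, H, h1, h2⟩ := hF
  obtain ⟨hFj, hirr⟩ := h2 j hj0 hj
  obtain ⟨⟨S', hS', hν, hagree⟩, -⟩ := h1 j _ (Or.inl ⟨hj0, hj, le_rfl⟩)
  rw [← hFj] at hS'
  obtain ⟨hE, hA⟩ := S'.isEquation_of_irreducible hirr hS'
  exact Chain.truncatedMult h.charSeq h.start hj hE hA hν hagree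

theorem ordVec_standardFactor_of_le {F : ℕ → MvPolynomial (Fin 2) ℂ}
    (hF : IsStandardFactors q S g m F) {i j : ℕ} (hj0 : 1 ≤ j) (hj : j < g) {r : Fin k}
    (hr : (r : ℕ) + 1 = gam S.ν m i) (hij : i ≤ j) :
    ordVec q (F j : Series) ⬝ᵥ invRow q r =
        sumSqMult f q (gam S.ν m i) / ((charGcd S.ν m i : ℚ) * charGcd S.ν m j) := by
  have hd : (charGcd S.ν m i : ℚ) ≠ 0 := Nat.cast_ne_zero.2 (charGcd_pos S.ν_pos m i).ne'
  have hd' : (charGcd S.ν m j : ℚ) ≠ 0 := Nat.cast_ne_zero.2 (charGcd_pos S.ν_pos m j).ne'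
  have hi : i ≤ g := hij.trans hj.le
  rw [eq_div_iff (mul_ne_zero hd hd'), ← mul_assoc, h.ordVec_gam hi hr, h.sumSqMult_gam hi]
  exact_mod_cast (h.standardFactor hF hj0 hj).sum_of_le hij

theorem sumSqMult_gam_succ {j : ℕ} (hj : j < g) :
    sumSqMult f q (gam S.ν m (j + 1)) =
      sumSqMult f q (gam S.ν m j) + ((m (j + 1) : ℚ) - m j) * charGcd S.ν m j := by
  rw [h.sumSqMult_gam hj, h.sumSqMult_gam hj.le, c.sum_sq_gam_succ h.charSeq h.start hj,
    Nat.cast_add, Nat.cast_mul, Nat.cast_sub (h.charSeq.lt_succ hj).le]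

theorem ordVec_standardFactor_of_lt {F : ℕ → MvPolynomial (Fin 2) ℂ}
    (hF : IsStandardFactors q S g m F) {i j : ℕ} (hj0 : 1 ≤ j) (hi : i ≤ g) {r : Fin k}
    (hr : (r : ℕ) + 1 = gam S.ν m i) (hij : j < i) :
    ordVec q (F j : Series) ⬝ᵥ invRow q r =
        sumSqMult f q (gam S.ν m (j + 1)) / ((charGcd S.ν m i : ℚ) * charGcd S.ν m j) := by
  have hd : (charGcd S.ν m i : ℚ) ≠ 0 := Nat.cast_ne_zero.2 (charGcd_pos S.ν_pos m i).ne'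
  have hd' : (charGcd S.ν m j : ℚ) ≠ 0 := Nat.cast_ne_zero.2 (charGcd_pos S.ν_pos m j).ne'
  have hj : j < g := hij.trans_le hi
  have hW := h.standardFactor hF hj0 hj
  have h1 := hW.sum_of_lt h.charSeq h.start hj hij
  have h2 := hW.sum_of_le le_rfl
  rw [eq_div_iff (mul_ne_zero hd hd'), ← mul_assoc, h.ordVec_gam hi hr, h.sumSqMult_gam_succ hj,
    h.sumSqMult_gam hj.le, h1, ← h2, ← Nat.cast_sub (h.charSeq.lt_succ hj).le]
  push_cast
  ring

end ResolvedBranch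

end PlaneCurve

end

open PlaneCurve in
theorem lemma2p16 (f : ConvergentSeries) (hf : Irreducible f)
    (hy : NotTangentToYAxis (f : Series))
    (n g : ℕ) (m : ℕ → ℕ) (hchar : HasCharSeq (f : Series) n g m)
    (k : ℕ) (q : Fin k → InfNear) (hq : IsStandardResolution (f : Series) q) :
    (∀ i, 1 ≤ i → i ≤ g → 1 ≤ gam n m i ∧ gam n m i ≤ k) ∧
    (∀ i, 1 ≤ i → i ≤ g → ∀ r : Fin k, (r : ℕ) + 1 = gam n m i →
      (canonicalCoeff (q r) : ℚ) + 1 = ((m i : ℚ) + n) / charGcd n m i ∧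
      (excOrder (q r) (f : Series) : ℚ) =
        sumSqMult (f : Series) q (gam n m i) / charGcd n m i) ∧
    (∀ (S : PuiseuxSeries), S.IsRoot (f : Series) →
      ∀ F : ℕ → MvPolynomial (Fin 2) ℂ, IsStandardFactors q S g m F →
      ∀ i j, 1 ≤ i → i ≤ g → 1 ≤ j → j + 1 ≤ g →
      ∀ r s : Fin k, (r : ℕ) + 1 = gam n m i → (s : ℕ) + 1 = gam n m j →
        (i ≤ j →
          ordVec q (F j : Series) ⬝ᵥ invRow q r =
              (excOrder (q r) (f : Series) : ℚ) / charGcd n m j ∧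
          (excOrder (q r) (f : Series) : ℚ) / charGcd n m j =
              sumSqMult (f : Series) q (gam n m i) / ((charGcd n m i : ℚ) * charGcd n m j)) ∧
        (j < i →
          ordVec q (F j : Series) ⬝ᵥ invRow q r =
              (excOrder (q s) (f : Series) : ℚ) / charGcd n m i +
                ((m (j + 1) : ℚ) - m j) / charGcd n m i ∧
          (excOrder (q s) (f : Series) : ℚ) / charGcd n m i +
                ((m (j + 1) : ℚ) - m j) / charGcd n m i =
              sumSqMult (f : Series) q (gam n m (j + 1)) /
                ((charGcd n m i : ℚ) * charGcd n m j))) := by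
  obtain ⟨S₀, hS₀f, rfl, hS₀⟩ := hchar
  obtain ⟨c₀, h₀⟩ := exists_resolvedBranch hf hy hS₀f hS₀ hq
  refine ⟨fun i hi hig => ⟨h₀.one_le_gam hi hig, h₀.gam_le_card hig⟩,
    fun i _ hig r hr => ⟨h₀.canonicalCoeff_gam hig hr, h₀.excOrder_gam hig hr⟩, ?_⟩
  intro S hSf F hF i j _ hig hj0 hjg r s hr hs
  -- S need not be the root that exhibits the characteristic sequence of f, but the polydromy order
  -- of any root is the order of f(0, y).
  have hν : S₀.ν = S.ν := by
    have h1 := (S₀.isEquation_of_irreducible hf hS₀f).2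
    have h2 := (S.isEquation_of_irreducible hf hSf).2
    exact_mod_cast h1.symm.trans h2
  rw [hν] at hr hs ⊢
  -- The standard factors approximate S itself, so the chain is now started at S.
  obtain ⟨c, h⟩ := exists_resolvedBranch hf hy hSf hF.2.1 hq
  have hd : (charGcd S.ν m i : ℚ) ≠ 0 := Nat.cast_ne_zero.2 (charGcd_pos S.ν_pos m i).ne'
  have hd' : (charGcd S.ν m j : ℚ) ≠ 0 := Nat.cast_ne_zero.2 (charGcd_pos S.ν_pos m j).ne'
  refine ⟨fun hij => ?_, fun hij => ?_⟩
  · rw [h.ordVec_standardFactor_of_le hF hj0 hjg hr hij, h.excOrder_gam hig hr, div_div]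
    exact ⟨rfl, rfl⟩
  · have hsum : (excOrder (q s) (f : Series) : ℚ) / charGcd S.ν m i +
        ((m (j + 1) : ℚ) - m j) / charGcd S.ν m i =
        sumSqMult (f : Series) q (gam S.ν m (j + 1)) /
          ((charGcd S.ν m i : ℚ) * charGcd S.ν m j) := by
      rw [h.excOrder_gam (by omega) hs, h.sumSqMult_gam_succ (by omega)]
      field_simp
    rw [hsum, h.ordVec_standardFactor_of_lt hF hj0 hig hr hij]
    exact ⟨rfl, rfl⟩
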